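/- **Model.** Fix an integer $K\ge 0$. For each $N\in\mathbb N$ let $(x_{ij})_{0\le i\le j\le N-1}$ be square-integrable centered real random variables on a probability space with $\mathbb E\,x_{ij}^2\le 1$, which are $K$-dependent: $x_{ij}$ is independent of the family $(x_{kl})_{|i-k|\vee|j-l|>K}$. For $i\le j$, $k\le l$ put $\xi_{ijkl}=\mathbb E\,x_{ij}x_{kl}$; put $\xi_{ijkl}=\xi_{jilk}$ if $i>j$ and $k>l$, and $\xi_{ijkl}=0$ in the remaining cases. Let $\psi:[0,1)^2\times\mathbb Z^2\to\mathbb R$ satisfy $\psi(\theta,\phi,k,l)=\psi(\theta,\phi,-k,-l)=\psi(\phi,\theta,l,k)$ and be piecewise Lipschitz: $[0,1)$ is a finite disjoint union of nondegenerate intervals $I_\alpha$ such that each $\psi(\cdot,\cdot,k,l)$ is Lipschitz on each $I_\alpha\times I_{\alpha'}$. Assume that $\xi$ is the discretization of $\psi$: there is a constant $C$ such that for all $N$ and all $i\le j$, $k\le l$, $$|\xi_{ijkl}-\psi(i/N,j/N,k-i,l-j)|\le C/N,$$ unless $(i/N,j/N)$ is within distance $K/N$ (in the maximum norm) of a discontinuity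 point of $\psi(\cdot,\cdot,k-i,l-j)$. **Equations.** For $M\in\mathbb C^{N\times N}$ let $\Xi(M)_{ik}=\frac1N\sum_{j,l}\xi_{ijkl}M_{jl}$ and, where the inverse exists, $F(M)=(-z-\Xi(M))^{-1}$. Let $\mathcal K$ be the algebra of sequences $a=(a(k))_{k\in\mathbb Z}$ with $a*f\in\ell^2(\mathbb Z)$ for all $f\in\ell^2(\mathbb Z)$, under convolution and with the operator norm on $\ell^2(\mathbb Z)$. Let $\mathcal T=L^\infty([0,1),\mathcal K)$ be the space of bounded functions $f:[0,1)\to\mathcal K$ (defined everywhere) with measurable coefficients $f(\cdot,k)$. Write $\check f(\theta,\zeta)=\sum_k f(\theta,k)e^{2\pi i k\zeta}$ (series in $L^2$ in $\zeta$), $\operatorname{tr} f=\int_0^1 f(\theta,0)\,d\theta$, $\Psi(f)(\theta,k)=\sum_l\int_0^1\psi(\theta,\phi,k,l)f(\phi,l)\,d\phi$, and $\mathcal T_+=\{f\in\mathcal T:\inf_{\theta,\zeta}\operatorname{Im}\check f(\theta,\zeta)>0\}$, the infimum over $\zeta$ being an essential infimum. **Theorem.** 1. For all $N\in\mathbb N$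 and $z\in\mathbb C^+$, the equation $M(-z-\Xi(M))=I$ has a unique solution $M=M(N,z)$ among the matrices $A\in\mathbb C^{N\times N}$ with $\frac1{2i}(A-A^*)$ positive definite. 2. For all $z\in\mathbb C^+$, the equation $m(\theta)=(-z-\Psi(m)(\theta))^{-1}$ for all $\theta\in[0,1)$, the inverse being taken in $\mathcal K$ and $z$ standing for $(z\delta_{k0})_k$, has a unique solution $m=m(z)$ in $\mathcal T_+$. 3. Let $\hat M_{i,i+k}=m(i/N,k)$ for $0\le i,i+k\le N-1$. For each $z\in\mathbb C^+$, $F(\hat M)$ is defined for all sufficiently large $N$, and there is a constant $c_z$ such that, in operator norm, $\|M-F(\hat M)\|\le c_z/N$ for all $N\geq 1$ for which $F(\hat M)$ is defined. 4. Assume moreover that $\xi$ is positive definite: for some $c_0>0$ and all $N$ the covariance matrix $\Sigma^{(N)}$ of $(x_{ij})_{i\le j}$ satisfies $\Sigma^{(N)}\ge c_0$. Let $\mathcal D\subset\mathbb C^+$ be a bounded domain on which $\operatorname{Im}\operatorname{tr} m(z)\ge\omega$ for some $\omega>0$. Then there are $c_{\mathcal D}$ and $N_{\mathcal D}$ such that,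 for all $N\ge N_{\mathcal D}$ and all $z\in\mathcal D$, $F(\hat M)$ is defined and $\|M-F(\hat M)\|\le c_{\mathcal D}/N$. -/

import Mathlib

open MeasureTheory ProbabilityTheory
open scoped Matrix ComplexOrder

noncomputable section

namespace CorrelatedMatrix

/-! ### The random matrix model -/

/-- The positions `(i, j)`, `i ≤ j`, of the upper triangle of an `N × N` matrix
(rows and columns are numbered `0, …, N - 1`, so that `i / N` lies in `[0, 1)`). -/
abbrev UpperIdx (N : ℕ) : Type := {p : Fin N × Fin N // p.1 ≤ p.2}

/-- The parameter interval `[0, 1)`. -/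
abbrev UnitIco : Type := Set.Ico (0 : ℝ) 1

/-- The positions `a` and `b` are at distance more than `K`: `|i - k| ∨ |j - l| > K`. -/
def FarApart {N : ℕ} (K : ℕ) (a b : UpperIdx N) : Prop :=
  (K : ℤ) < max |((a.1.1 : ℕ) : ℤ) - ((b.1.1 : ℕ) : ℤ)| |((a.1.2 : ℕ) : ℤ) - ((b.1.2 : ℕ) : ℤ)|

/-- `K`-dependence: each entry is independent of the family of all entries far from it. -/
def KDependent {N : ℕ} {Ω : Type*} [MeasurableSpace Ω] (P : Measure Ω) (K : ℕ)
    (x : UpperIdx N → Ω → ℝ) : Prop :=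
  ∀ a : UpperIdx N,
    IndepFun (x a) (fun (ω : Ω) (b : {b : UpperIdx N // FarApart K a b}) => x b.1 ω) P

/-- The matrix of second moments `E[x_a x_b]` of the family (its covariance matrix, as the
family is centered). -/
def covMatrix {N : ℕ} {Ω : Type*} [MeasurableSpace Ω] (P : Measure Ω)
    (x : UpperIdx N → Ω → ℝ) : Matrix (UpperIdx N) (UpperIdx N) ℝ :=
  Matrix.of fun a b => ∫ ω, x a ω * x b ω ∂P

/-- The tensor `ξ_{ijkl}`, extended to all indices: `E[x_{ij} x_{kl}]` if `i ≤ j` and `k ≤ l`,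
`ξ_{jilk}` if `i > j` and `k > l`, and `0` in the mixed cases. -/
def xi {N : ℕ} {Ω : Type*} [MeasurableSpace Ω] (P : Measure Ω)
    (x : UpperIdx N → Ω → ℝ) (i j k l : Fin N) : ℝ :=
  if h : i ≤ j ∧ k ≤ l then covMatrix P x ⟨(i, j), h.1⟩ ⟨(k, l), h.2⟩
  else if h : j < i ∧ l < k then covMatrix P x ⟨(j, i), h.1.le⟩ ⟨(l, k), h.2.le⟩
  else 0

/-- `ψ` is piecewise Lipschitz: `[0, 1)` is a finite disjoint union of (nondegenerate) intervals
`I α` such that each `ψ(·, ·, k, l)` is Lipschitz on each `I α × I β`. -/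
def PiecewiseLipschitz (ψ : UnitIco → UnitIco → ℤ → ℤ → ℝ) : Prop :=
  ∃ (n : ℕ) (I : Fin n → Set UnitIco),
    (∀ α, (I α).OrdConnected ∧ (I α).Nontrivial) ∧
    (∀ α β, α ≠ β → Disjoint (I α) (I β)) ∧
    (⋃ α, I α) = Set.univ ∧
    ∀ (α β : Fin n) (k l : ℤ), ∃ L : NNReal,
      LipschitzOnWith L (fun p : UnitIco × UnitIco => ψ p.1 p.2 k l) (I α ×ˢ I β)

/-- The grid point `i / N` of `[0, 1)`. -/
def gridPt {N : ℕ} (i : Fin N) : UnitIco :=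
  ⟨((i : ℕ) : ℝ) / (N : ℝ), by
    have hi : ((i : ℕ) : ℝ) < (N : ℝ) := by exact_mod_cast i.isLt
    have hN : (0 : ℝ) < (N : ℝ) := lt_of_le_of_lt (Nat.cast_nonneg _) hi
    exact ⟨by positivity, (div_lt_one hN).2 hi⟩⟩

/-- The difference `j - i` of two indices, as an integer. -/
def idxDiff {N : ℕ} (i j : Fin N) : ℤ := ((j : ℕ) : ℤ) - ((i : ℕ) : ℤ)

/-- The point `p` lies within `r` of a point of `[0, 1)²` where `ψ(·, ·, k, l)` is discontinuous. -/
def NearDiscontinuity (ψ : UnitIco → UnitIco → ℤ → ℤ → ℝ) (k l : ℤ) (r : ℝ)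
    (p : UnitIco × UnitIco) : Prop :=
  ∃ p' : UnitIco × UnitIco,
    ¬ ContinuousAt (fun s : UnitIco × UnitIco => ψ s.1 s.2 k l) p' ∧ dist p p' ≤ r

/-- `ξ^{(N)}` is the discretization of `ψ`: `ξ_{ijkl} = ψ(i/N, j/N, k - i, l - j) + O(1/N)` for
`i ≤ j`, `k ≤ l`, uniformly in `N` and `i, j, k, l`, unless `(i/N, j/N)` is in the
`K/N`-neighborhood of a discontinuity of `ψ(·, ·, k - i, l - j)`. -/
def IsDiscretization (K : ℕ) (ψ : UnitIco → UnitIco → ℤ → ℤ → ℝ)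
    (ξ : ∀ N : ℕ, Fin N → Fin N → Fin N → Fin N → ℝ) : Prop :=
  ∃ C : ℝ, ∀ (N : ℕ) (i j k l : Fin N), i ≤ j → k ≤ l →
    ¬ NearDiscontinuity ψ (idxDiff i k) (idxDiff j l) ((K : ℝ) / N) (gridPt i, gridPt j) →
    |ξ N i j k l - ψ (gridPt i) (gridPt j) (idxDiff i k) (idxDiff j l)| ≤ C / N

/-! ### The matrix equation -/

/-- The map `Ξ(M)_{ik} = N⁻¹ ∑_{j,l} ξ_{ijkl} M_{jl}`. -/
def Xi {N : ℕ} (ξ : Fin N → Fin N → Fin N → Fin N → ℝ) (M : Matrix (Fin N) (Fin N) ℂ) :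
    Matrix (Fin N) (Fin N) ℂ :=
  Matrix.of fun i k => (N : ℂ)⁻¹ * ∑ j, ∑ l, (ξ i j k l : ℂ) * M j l

/-- The matrix `-z - Ξ(M)`. -/
def denomMatrix {N : ℕ} (ξ : Fin N → Fin N → Fin N → Fin N → ℝ) (z : ℂ)
    (M : Matrix (Fin N) (Fin N) ℂ) : Matrix (Fin N) (Fin N) ℂ :=
  -(z • (1 : Matrix (Fin N) (Fin N) ℂ)) - Xi ξ M

/-- The map `F(M) = (-z - Ξ(M))⁻¹` (meaningful where `-z - Ξ(M)` is invertible). -/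
def F {N : ℕ} (ξ : Fin N → Fin N → Fin N → Fin N → ℝ) (z : ℂ)
    (M : Matrix (Fin N) (Fin N) ℂ) : Matrix (Fin N) (Fin N) ℂ :=
  (denomMatrix ξ z M)⁻¹

/-- `M` solves `M(-z - Ξ(M)) = I` and `(M - M*)/(2i)` is positive definite. -/
def IsMatrixSolution {N : ℕ} (ξ : Fin N → Fin N → Fin N → Fin N → ℝ) (z : ℂ)
    (M : Matrix (Fin N) (Fin N) ℂ) : Prop :=
  ((2 * Complex.I)⁻¹ • (M - Mᴴ)).PosDef ∧ M * denomMatrix ξ z M = 1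

/-- The operator norm of a matrix acting on `ℂ^N` with the Euclidean norm. -/
def opNorm {N : ℕ} (A : Matrix (Fin N) (Fin N) ℂ) : ℝ :=
  ‖Matrix.toEuclideanCLM (n := Fin N) (𝕜 := ℂ) A‖

/-! ### The limiting equation -/

/-- Convolution of bi-infinite sequences. -/
def conv (a f : ℤ → ℂ) : ℤ → ℂ := fun n => ∑' k : ℤ, a k * f (n - k)

/-- `a` acts by convolution on `ℓ²(ℤ)`, with operator norm at most `C`. -/
def ConvBoundedBy (a : ℤ → ℂ) (C : ℝ) : Prop :=
  ∀ f : lp (fun _ : ℤ => ℂ) 2, ∃ g : lp (fun _ : ℤ => ℂ) 2,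
    (g : ℤ → ℂ) = conv a f ∧ ‖g‖ ≤ C * ‖f‖

/-- The space `𝒦` of sequences `a` with `a * f ∈ ℓ²(ℤ)` for all `f ∈ ℓ²(ℤ)`. -/
def MemK (a : ℤ → ℂ) : Prop :=
  ∀ f : ℤ → ℂ, Memℓp f 2 → Memℓp (conv a f) 2

/-- The space `𝒯 = L^∞([0, 1), 𝒦)`, as functions on `[0, 1) × ℤ` that are defined everywhere:
coefficientwise measurable, `𝒦`-valued, and bounded in the norm of `𝒦`. -/
def MemT (f : UnitIco → ℤ → ℂ) : Prop :=
  (∀ k : ℤ, Measurable fun θ => f θ k) ∧ (∀ θ, MemK (f θ)) ∧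
    ∃ C : ℝ, ∀ θ, ConvBoundedBy (f θ) C

open Classical in
/-- The inverse Fourier transform `ǎ(ζ) = ∑_k a(k) e^{2πikζ}` of a square-summable sequence, the
series being taken in `L²` of the circle `ℝ/ℤ` (elements of `𝒦` are square-summable). -/
def invFourier (a : ℤ → ℂ) :
    Lp ℂ 2 (AddCircle.haarAddCircle : Measure (AddCircle (1 : ℝ))) :=
  if h : Memℓp a 2 then
    (fourierBasis (T := (1 : ℝ))).repr.symm (⟨a, h⟩ : lp (fun _ : ℤ => ℂ) 2)
  else 0

/-- The domain `𝒯₊` of those `f ∈ 𝒯` for which the infimum of `Im f̌(θ, ζ)` is positive; as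
`f̌(θ, ·)` is an `L^∞` function, the infimum over `ζ` is an essential infimum. -/
def MemTPlus (f : UnitIco → ℤ → ℂ) : Prop :=
  MemT f ∧ ∃ ε : ℝ, 0 < ε ∧ ∀ θ : UnitIco,
    ∀ᵐ ζ ∂(AddCircle.haarAddCircle : Measure (AddCircle (1 : ℝ))),
      ε ≤ (invFourier (f θ) ζ).im

/-- Lebesgue measure on `[0, 1)`. -/
def lebIco : Measure UnitIco := Measure.comap ((↑) : UnitIco → ℝ) volume

/-- The limiting trace `tr f = ∫₀¹ f(θ, 0) dθ`. -/
def trT (f : UnitIco → ℤ → ℂ) : ℂ := ∫ θ, f θ 0 ∂lebIco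

/-- The operator `Ψ(f)(θ, k) = ∑_l ∫₀¹ ψ(θ, φ, k, l) f(φ, l) dφ`. -/
def Psi (ψ : UnitIco → UnitIco → ℤ → ℤ → ℝ) (f : UnitIco → ℤ → ℂ) : UnitIco → ℤ → ℂ :=
  fun θ k => ∑' l : ℤ, ∫ φ, (ψ θ φ k l : ℂ) * f φ l ∂lebIco

/-- The unit `δ_{k0}` of the convolution algebra `𝒦`. -/
def convOne : ℤ → ℂ := Pi.single 0 1

/-- `b` is the inverse of `a` in the (commutative) convolution algebra `𝒦`. -/
def IsInverseK (a b : ℤ → ℂ) : Prop := MemK a ∧ MemK b ∧ conv a b = convOne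

/-- `m ∈ 𝒯₊` solves `m(θ) = (-z - Ψ(m)(θ))⁻¹` for all `θ ∈ [0, 1)`. -/
def IsLimitSolution (ψ : UnitIco → UnitIco → ℤ → ℤ → ℝ) (z : ℂ)
    (m : UnitIco → ℤ → ℂ) : Prop :=
  MemTPlus m ∧ ∀ θ : UnitIco, IsInverseK (-(z • convOne) - Psi ψ m θ) (m θ)

/-- The discretization `M̂_{i,i+k} = m(i/N, k)`. -/
def discretize (N : ℕ) (m : UnitIco → ℤ → ℂ) : Matrix (Fin N) (Fin N) ℂ :=
  Matrix.of fun i j => m (gridPt i) (idxDiff i j)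

end CorrelatedMatrix

end

set_option linter.unusedSectionVars false

noncomputable section

namespace CorrelatedMatrix

open scoped Matrix.Norms.L2Operator

/-! ### Sesquilinear forms of matrices -/

section Forms

variable {n : Type*} [Fintype n] [DecidableEq n]

/-! Everything rests on the positivity of `Xi`. Since ξ comes from a covariance, it is a sum of
rank-one tensors, plus c₀ times the identity when Σ ≥ c₀. Hence Ξ(A) is c₀ N⁻¹ tr A plus N⁻¹ times a
sum of terms V A V* (`IsSumOfSquares.sesq_Xi`). Such a map preserves nonnegative imaginary parts,
and it also preserves bounds 2|⟨u, Xv⟩| ≤ δ (Im A(u) + Im B(v)), called domination below. By F(A) −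
F(B) = F(A) Ξ(A − B) F(B), the map F multiplies the constant δ by a factor below 1. Iteration from 0
therefore converges to the unique solution (`existsUnique_isMatrixSolution`).

For the limiting equation, testing the covariance with plane waves on large blocks shows that the
Fourier kernel of ψ is real and at least c₀ (`le_fourierKernel_re`). So Ψ has the same positivity.
After a Fourier transform the inverse is a scalar inverse at each (θ, ζ), and the same contraction
applies (`existsUnique_isLimitSolution`). The solution is Lipschitz on the pieces, in ℓ².

For the comparison put D = −z − Ξ(M̂) and G = F(M̂) = D⁻¹. The map Ξ sees only entries within K of
the diagonal, and only through averages, so boundedly many bad rows cost O(1/N). The rows of D M̂ −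
1 are O(1/N) except for boundedly many, which are O(1); hence ‖Ξ(G − M̂)‖ = O(1/N)
(`norm_Xi_sub_le`) and G nearly solves the equation. Invertibility of D comes from approximating M̂
by block Toeplitz matrices, whose imaginary part is nonnegative (`exists_half_le_neg_imForm`). The
exact solution is then G + X with X found by a fixed-point argument
(`norm_sub_le_of_linearlyStable`), provided that X ↦ X − G Ξ(X) G has a bounded inverse.

That bound is again a domination argument, now relative to Im G. A lower bound on Im z gives it at
once (`exists_linearlyStable_of_im`). When Im z may tend to 0 (`exists_linearlyStable_of_flat`), the
c₀-term of Ξ improves the constant δ unless |tr X| is almost δ tr Im G. In that case X is close to a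
multiple of Im G, by orthogonal projection for the inner product tr(X* (Im G)⁻¹ Y). But Im G is far
from being fixed by X ↦ G Ξ(X) G: by `mul_neg_imPart_mul` the discrepancy contains 2i Im G D* Im G,
which is bounded below. So δ is controlled by the residual in this case too. -/

/-- The sesquilinear form `⟨u, A v⟩` of a matrix. -/
def sesq (A : Matrix n n ℂ) (u v : n → ℂ) : ℂ := star u ⬝ᵥ (A *ᵥ v)

/-- The squared Euclidean norm. -/
def nsq (u : n → ℂ) : ℝ := ∑ i, ‖u i‖ ^ 2

/-- The quadratic form of the imaginary part `(A - A*)/(2i)` of a matrix. -/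
def imForm (A : Matrix n n ℂ) (u : n → ℂ) : ℝ := (sesq A u u).im

lemma nsq_nonneg (u : n → ℂ) : 0 ≤ nsq u := Finset.sum_nonneg fun _ _ => by positivity

lemma nsq_eq_zero {u : n → ℂ} (h : nsq u = 0) : u = 0 := by
  funext i
  have := (Finset.sum_eq_zero_iff_of_nonneg (fun i _ => by positivity)).1 h i (Finset.mem_univ i)
  simpa using this

lemma nsq_pos {u : n → ℂ} (h : u ≠ 0) : 0 < nsq u :=
  lt_of_le_of_ne (nsq_nonneg u) fun h0 => h (nsq_eq_zero h0.symm)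

lemma nsq_eq_norm (u : n → ℂ) : nsq u = ‖WithLp.toLp 2 u‖ ^ 2 := by
  rw [EuclideanSpace.norm_sq_eq]; rfl

lemma star_dotProduct_self (u : n → ℂ) : star u ⬝ᵥ u = (nsq u : ℂ) := by
  simp [dotProduct, nsq, Complex.conj_mul']

lemma norm_star_dotProduct_le (u v : n → ℂ) :
    ‖star u ⬝ᵥ v‖ ≤ ‖WithLp.toLp 2 u‖ * ‖WithLp.toLp 2 v‖ := by
  have := norm_inner_le_norm (𝕜 := ℂ) (WithLp.toLp 2 u) (WithLp.toLp 2 v)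
  rwa [EuclideanSpace.inner_eq_star_dotProduct, dotProduct_comm] at this

lemma two_norm_star_dotProduct_le (u v : n → ℂ) : 2 * ‖star u ⬝ᵥ v‖ ≤ nsq u + nsq v := by
  rw [nsq_eq_norm, nsq_eq_norm]
  nlinarith [norm_star_dotProduct_le u v, sq_nonneg (‖WithLp.toLp 2 u‖ - ‖WithLp.toLp 2 v‖)]

lemma norm_mulVec_le (A : Matrix n n ℂ) (v : n → ℂ) :
    ‖WithLp.toLp 2 (A *ᵥ v)‖ ≤ ‖A‖ * ‖WithLp.toLp 2 v‖ :=
  Matrix.l2_opNorm_mulVec A (WithLp.toLp 2 v)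

lemma nsq_mulVec_le (A : Matrix n n ℂ) (v : n → ℂ) : nsq (A *ᵥ v) ≤ ‖A‖ ^ 2 * nsq v := by
  rw [nsq_eq_norm, nsq_eq_norm, ← mul_pow]
  exact pow_le_pow_left₀ (norm_nonneg _) (norm_mulVec_le A v) 2

lemma two_norm_sesq_le (A : Matrix n n ℂ) (u v : n → ℂ) :
    2 * ‖sesq A u v‖ ≤ ‖A‖ * (nsq u + nsq v) := by
  have h1 := norm_star_dotProduct_le u (A *ᵥ v)
  have h2 := norm_mulVec_le A v
  rw [nsq_eq_norm, nsq_eq_norm]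
  set a := ‖WithLp.toLp 2 u‖
  set b := ‖WithLp.toLp 2 v‖
  have h3 : ‖sesq A u v‖ ≤ a * (‖A‖ * b) :=
    h1.trans (mul_le_mul_of_nonneg_left h2 (norm_nonneg _))
  nlinarith [mul_nonneg (norm_nonneg A) (sq_nonneg (a - b))]

lemma abs_imForm_le (A : Matrix n n ℂ) (u : n → ℂ) : |imForm A u| ≤ ‖A‖ * nsq u := by
  have h := two_norm_sesq_le A u u
  have h2 := Complex.abs_im_le_norm (sesq A u u)
  unfold imForm
  linarith

lemma imForm_le (A : Matrix n n ℂ) (u : n → ℂ) : imForm A u ≤ ‖A‖ * nsq u :=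
  (le_abs_self _).trans (abs_imForm_le A u)

lemma sesq_add (A B : Matrix n n ℂ) (u v : n → ℂ) :
    sesq (A + B) u v = sesq A u v + sesq B u v := by
  simp [sesq, Matrix.add_mulVec, dotProduct_add]

lemma sesq_sub (A B : Matrix n n ℂ) (u v : n → ℂ) :
    sesq (A - B) u v = sesq A u v - sesq B u v := by
  simp [sesq, Matrix.sub_mulVec, dotProduct_sub]

lemma sesq_neg (A : Matrix n n ℂ) (u v : n → ℂ) : sesq (-A) u v = -sesq A u v := by
  simp [sesq, Matrix.neg_mulVec]

lemma sesq_smul (c : ℂ) (A : Matrix n n ℂ) (u v : n → ℂ) :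
    sesq (c • A) u v = c * sesq A u v := by
  simp [sesq, Matrix.smul_mulVec]

lemma sesq_one (u v : n → ℂ) : sesq (1 : Matrix n n ℂ) u v = star u ⬝ᵥ v := by
  simp [sesq]

lemma sesq_smul_left (A : Matrix n n ℂ) (t : ℝ) (u v : n → ℂ) :
    sesq A ((t : ℂ) • u) v = t * sesq A u v := by
  simp [sesq]

lemma sesq_eq_sum (A : Matrix n n ℂ) (u v : n → ℂ) :
    sesq A u v = ∑ i, ∑ j, star (u i) * A i j * v j := by
  simp only [sesq, dotProduct, Matrix.mulVec, Finset.mul_sum, mul_assoc, Pi.star_apply]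

lemma star_mulVec_dotProduct (A : Matrix n n ℂ) (u v : n → ℂ) :
    star (A *ᵥ u) ⬝ᵥ v = star u ⬝ᵥ (Aᴴ *ᵥ v) := by
  rw [Matrix.star_mulVec, ← Matrix.dotProduct_mulVec]

lemma sesq_mul_mul (A B C : Matrix n n ℂ) (u v : n → ℂ) :
    sesq (A * B * C) u v = sesq B (Aᴴ *ᵥ u) (C *ᵥ v) := by
  simp only [sesq]
  rw [star_mulVec_dotProduct, Matrix.conjTranspose_conjTranspose]
  simp [Matrix.mulVec_mulVec, mul_assoc]

lemma sesq_conjTranspose (A : Matrix n n ℂ) (u v : n → ℂ) :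
    sesq Aᴴ u v = star (sesq A v u) := by
  simp only [sesq]
  rw [← star_mulVec_dotProduct, Matrix.star_dotProduct]

lemma imForm_sub (A B : Matrix n n ℂ) (u : n → ℂ) :
    imForm (A - B) u = imForm A u - imForm B u := by simp [imForm, sesq_sub]

lemma imForm_add (A B : Matrix n n ℂ) (u : n → ℂ) :
    imForm (A + B) u = imForm A u + imForm B u := by simp [imForm, sesq_add]

lemma imForm_neg (A : Matrix n n ℂ) (u : n → ℂ) : imForm (-A) u = -imForm A u := by
  simp [imForm, sesq_neg]

lemma imForm_smul_one (z : ℂ) (u : n → ℂ) :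
    imForm (z • (1 : Matrix n n ℂ)) u = z.im * nsq u := by
  simp [imForm, sesq_smul, sesq_one, star_dotProduct_self]

/-- The test vector u = c⁻¹ A v balances the two terms on the right and recovers the operator norm
without loss. Norm bounds can thus be read off from domination bounds. -/
lemma opNorm_le_of_forall_sesq {A : Matrix n n ℂ} {c : ℝ} (hc : 0 ≤ c)
    (h : ∀ u v, 2 * ‖sesq A u v‖ ≤ c * (nsq u + nsq v)) : ‖A‖ ≤ c := by
  rw [Matrix.cstar_norm_def]
  refine ContinuousLinearMap.opNorm_le_bound _ hc fun x => ?_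
  set v : n → ℂ := WithLp.ofLp x
  have hx : Matrix.toEuclideanCLM (n := n) (𝕜 := ℂ) A x = WithLp.toLp 2 (A *ᵥ v) := rfl
  rw [hx]
  have hv : ‖x‖ ^ 2 = nsq v := (nsq_eq_norm v).symm
  have hr : sesq A (A *ᵥ v) v = (nsq (A *ᵥ v) : ℂ) := star_dotProduct_self _
  have hnn := nsq_nonneg (A *ᵥ v)
  have key : nsq (A *ᵥ v) ≤ c ^ 2 * nsq v := by
    rcases hc.eq_or_lt with h0 | hpos
    · have := h (A *ᵥ v) v
      rw [hr, Complex.norm_real, Real.norm_of_nonneg hnn, ← h0] at this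
      rw [← h0]; linarith
    · have := h (((c⁻¹ : ℝ) : ℂ) • (A *ᵥ v)) v
      rw [sesq_smul_left, hr, norm_mul, Complex.norm_real, Complex.norm_real,
        Real.norm_of_nonneg hnn, Real.norm_of_nonneg (by positivity)] at this
      have e : nsq (((c⁻¹ : ℝ) : ℂ) • (A *ᵥ v)) = c⁻¹ ^ 2 * nsq (A *ᵥ v) := by
        simp [nsq, mul_pow, Finset.mul_sum]
      rw [e] at this
      field_simp at this
      nlinarith
  rw [← sq_le_sq₀ (norm_nonneg _) (by positivity), mul_pow, hv, ← nsq_eq_norm]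
  exact key

lemma nsq_single (i : n) : nsq (Pi.single i 1 : n → ℂ) = 1 := by
  rw [nsq, Finset.sum_eq_single i] <;> simp +contextual

lemma sesq_single (A : Matrix n n ℂ) (i j : n) :
    sesq A (Pi.single i 1) (Pi.single j 1) = A i j := by
  simp [sesq]

lemma norm_entry_le (A : Matrix n n ℂ) (i j : n) : ‖A i j‖ ≤ ‖A‖ := by
  have h := two_norm_sesq_le A (Pi.single i 1) (Pi.single j 1)
  rw [sesq_single, nsq_single, nsq_single] at h
  linarith

lemma sum_sq_col_le (A : Matrix n n ℂ) (j : n) : ∑ i, ‖A i j‖ ^ 2 ≤ ‖A‖ ^ 2 := by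
  have h := nsq_mulVec_le A (Pi.single j 1)
  rw [nsq_single, mul_one] at h
  simpa [nsq] using h

/-! ### Inverses of matrices with definite imaginary part -/

/-- As D sends Gu to u, the form of D at Gu is the conjugate of the form of G at u. -/
lemma imForm_of_mul_eq_one {D G : Matrix n n ℂ} (h : D * G = 1) (u : n → ℂ) :
    imForm G u = -imForm D (G *ᵥ u) := by
  have e : sesq D (G *ᵥ u) (G *ᵥ u) = star (sesq G u u) := by
    simp only [sesq, Matrix.mulVec_mulVec, h, Matrix.one_mulVec]
    rw [Matrix.star_dotProduct]
  simp [imForm, e]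

/-- The counterpart for left test vectors, from G D G* = G*. In the form of a product G Y G′ the
left vector is moved by G* and the right one by G′, so both versions are needed. -/
lemma imForm_of_mul_eq_one_conjTranspose {D G : Matrix n n ℂ} (h : D * G = 1) (u : n → ℂ) :
    imForm G u = -imForm D (Gᴴ *ᵥ u) := by
  have h' : G * D = 1 := mul_eq_one_comm.1 h
  have e : sesq D (Gᴴ *ᵥ u) (Gᴴ *ᵥ u) = star (sesq G u u) := by
    have : sesq (G * D * Gᴴ) u u = sesq D (Gᴴ *ᵥ u) (Gᴴ *ᵥ u) := sesq_mul_mul G D Gᴴ u u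
    rw [← this, h', one_mul, sesq_conjTranspose]
  simp [imForm, e]

lemma isUnit_of_imForm_le {D : Matrix n n ℂ} {w : ℝ} (hw : 0 < w)
    (h : ∀ u, w * nsq u ≤ -imForm D u) : IsUnit D := by
  rw [← Matrix.mulVec_injective_iff_isUnit]
  intro u v huv
  have h0 : D *ᵥ (u - v) = 0 := by rw [Matrix.mulVec_sub]; exact sub_eq_zero.2 huv
  have h1 := h (u - v)
  have h2 : imForm D (u - v) = 0 := by simp [imForm, sesq, h0]
  rw [h2] at h1
  have h3 : nsq (u - v) = 0 := by nlinarith [nsq_nonneg (u - v)]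
  exact sub_eq_zero.1 (nsq_eq_zero h3)

/-- The form bound gives w |Gv|² ≤ Im⟨v, Gv⟩ ≤ |v| |Gv|. The vector w Gv replaces Gv in the
arithmetic-geometric inequality so that no division by |Gv| occurs. -/
lemma norm_le_of_imForm_le {D G : Matrix n n ℂ} {w : ℝ} (hw : 0 < w) (hDG : D * G = 1)
    (h : ∀ u, w * nsq u ≤ -imForm D u) : ‖G‖ ≤ w⁻¹ := by
  refine opNorm_le_of_forall_sesq (by positivity) fun u v => ?_
  have hv : w ^ 2 * nsq (G *ᵥ v) ≤ nsq v := by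
    have h1 := h (G *ᵥ v)
    rw [← imForm_of_mul_eq_one hDG] at h1
    have h2 : imForm G v ≤ ‖sesq G v v‖ :=
      (le_abs_self _).trans (Complex.abs_im_le_norm _)
    have h3 := two_norm_star_dotProduct_le v ((w : ℂ) • (G *ᵥ v))
    have e1 : nsq ((w : ℂ) • (G *ᵥ v)) = w ^ 2 * nsq (G *ᵥ v) := by
      simp [nsq, mul_pow, Finset.mul_sum]
    have e2 : ‖star v ⬝ᵥ ((w : ℂ) • (G *ᵥ v))‖ = w * ‖sesq G v v‖ := by
      simp [sesq, abs_of_pos hw]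
    rw [e1, e2] at h3
    nlinarith
  have h3 := two_norm_star_dotProduct_le u ((w : ℂ) • (G *ᵥ v))
  have e1 : nsq ((w : ℂ) • (G *ᵥ v)) = w ^ 2 * nsq (G *ᵥ v) := by
    simp [nsq, mul_pow, Finset.mul_sum]
  have e2 : ‖star u ⬝ᵥ ((w : ℂ) • (G *ᵥ v))‖ = w * ‖sesq G u v‖ := by
    simp [sesq, abs_of_pos hw]
  rw [e1, e2] at h3
  rw [inv_mul_eq_div, le_div_iff₀ hw]
  linarith

/-- The form of Im G at u is that of −Im D at Gu, and |u| = |D G u| ≤ d |Gu|. -/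
lemma le_imForm_of_mul_eq_one {D G : Matrix n n ℂ} {w d : ℝ} (hw : 0 ≤ w) (hd : 0 < d)
    (hDG : D * G = 1) (hD : ‖D‖ ≤ d) (h : ∀ u, w * nsq u ≤ -imForm D u) (u : n → ℂ) :
    w / d ^ 2 * nsq u ≤ imForm G u := by
  rw [imForm_of_mul_eq_one hDG]
  refine le_trans ?_ (h _)
  have h1 : nsq u ≤ d ^ 2 * nsq (G *ᵥ u) := by
    have := nsq_mulVec_le D (G *ᵥ u)
    rw [Matrix.mulVec_mulVec, hDG, Matrix.one_mulVec] at this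
    refine this.trans (mul_le_mul_of_nonneg_right ?_ (nsq_nonneg _))
    exact pow_le_pow_left₀ (norm_nonneg _) hD 2
  rw [div_mul_eq_mul_div, mul_div_assoc]
  refine mul_le_mul_of_nonneg_left ?_ hw
  rw [div_le_iff₀ (by positivity)]
  linarith

/-- The imaginary part `(A - A*)/(2i)` of a matrix. -/
def imPart (A : Matrix n n ℂ) : Matrix n n ℂ := (2 * Complex.I)⁻¹ • (A - Aᴴ)

lemma sesq_imPart_self (A : Matrix n n ℂ) (u : n → ℂ) : sesq (imPart A) u u = (imForm A u : ℂ) := by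
  rw [imPart, sesq_smul, sesq_sub, sesq_conjTranspose, imForm]
  set w := sesq A u u
  have : w - star w = 2 * Complex.I * (w.im : ℂ) := by
    rw [show star w = (starRingEnd ℂ) w from rfl, Complex.sub_conj]; push_cast; ring
  rw [this, inv_mul_cancel_left₀]
  simp

lemma imPart_conjTranspose (A : Matrix n n ℂ) : (imPart A)ᴴ = imPart A := by
  simp [imPart, Matrix.conjTranspose_smul, ← smul_neg, mul_comm]

/-- The bridge between the order condition in `IsMatrixSolution` and the scalar inequalities for
`imForm` used everywhere else. -/
lemma posDef_imPart_iff (A : Matrix n n ℂ) :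
    (imPart A).PosDef ↔ ∀ u, u ≠ 0 → 0 < imForm A u := by
  rw [Matrix.posDef_iff_dotProduct_mulVec]
  have h : ∀ u, star u ⬝ᵥ (imPart A *ᵥ u) = (imForm A u : ℂ) := sesq_imPart_self A
  simp only [h, Complex.zero_lt_real]
  exact ⟨fun H u hu => H.2 hu, fun H => ⟨imPart_conjTranspose A, fun u hu => H u hu⟩⟩

end Forms

end CorrelatedMatrix

end

noncomputable section

namespace CorrelatedMatrix

open scoped Matrix.Norms.L2Operator

/-! ### Banded matrices and banded tensors -/

section Band

variable {N : ℕ}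

lemma idxDiff_neg (i j : Fin N) : idxDiff j i = -idxDiff i j := by simp [idxDiff]

lemma idxDiff_self (i : Fin N) : idxDiff i i = 0 := by simp [idxDiff]

lemma abs_idxDiff_comm (i j : Fin N) : |idxDiff i j| = |idxDiff j i| := by
  rw [idxDiff_neg j i, abs_neg]

lemma idxDiff_injective (i : Fin N) : Function.Injective (idxDiff i) := by
  intro a b h
  simp only [idxDiff] at h
  exact Fin.ext (by omega)

lemma card_band_le (K : ℕ) (i : Fin N) :
    (Finset.univ.filter fun j : Fin N => |idxDiff i j| ≤ K).card ≤ 2 * K + 1 := by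
  have h : (Finset.univ.filter fun j : Fin N => |idxDiff i j| ≤ K).card ≤
      (Finset.Icc (-(K : ℤ)) K).card := by
    refine Finset.card_le_card_of_injOn (idxDiff i) ?_ (idxDiff_injective i).injOn
    intro j hj
    simp only [Finset.coe_filter, Set.mem_ofPred_eq, Finset.mem_univ, true_and] at hj
    simpa using abs_le.1 hj
  rw [Int.card_Icc] at h
  omega

lemma sum_band_le {K : ℕ} (i : Fin N) {f : Fin N → ℝ} {c : ℝ} (hc : 0 ≤ c)
    (h : ∀ j, |idxDiff i j| ≤ K → f j ≤ c) :
    ∑ j, (if |idxDiff i j| ≤ K then f j else 0) ≤ (2 * K + 1) * c := by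
  rw [← Finset.sum_filter]
  refine (Finset.sum_le_card_nsmul _ _ c fun j hj => h j (Finset.mem_filter.1 hj).2).trans ?_
  rw [nsmul_eq_mul]
  refine mul_le_mul_of_nonneg_right ?_ hc
  exact_mod_cast card_band_le K i

/-- Schur's test: a row or a column meets the band in at most 2K + 1 entries. -/
lemma norm_le_of_banded {K : ℕ} {A : Matrix (Fin N) (Fin N) ℂ} {c : ℝ} (hc : 0 ≤ c)
    (h : ∀ i k, ‖A i k‖ ≤ if |idxDiff i k| ≤ K then c else 0) : ‖A‖ ≤ (2 * K + 1) * c := by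
  refine opNorm_le_of_forall_sesq (by positivity) fun u v => ?_
  rw [sesq_eq_sum]
  have h1 : 2 * ‖∑ i, ∑ j, star (u i) * A i j * v j‖ ≤
      ∑ i, ∑ j, if |idxDiff i j| ≤ K then c * (‖u i‖ ^ 2 + ‖v j‖ ^ 2) else 0 := by
    refine (mul_le_mul_of_nonneg_left ((norm_sum_le _ _).trans (Finset.sum_le_sum fun i _ =>
      norm_sum_le _ _)) zero_le_two).trans ?_
    simp only [Finset.mul_sum]
    refine Finset.sum_le_sum fun i _ => Finset.sum_le_sum fun j _ => ?_
    have := h i j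
    rw [norm_mul, norm_mul, norm_star]
    split_ifs with hij
    · rw [if_pos hij] at this
      have h2 : ‖u i‖ * ‖A i j‖ * ‖v j‖ ≤ c * (‖u i‖ * ‖v j‖) := by
        have := mul_le_mul_of_nonneg_right this (mul_nonneg (norm_nonneg (u i)) (norm_nonneg (v j)))
        linarith
      nlinarith [mul_nonneg hc (sq_nonneg (‖u i‖ - ‖v j‖))]
    · rw [if_neg hij] at this
      have : ‖A i j‖ = 0 := le_antisymm this (norm_nonneg _)
      simp [this]
  refine h1.trans ?_
  have h2 : ∀ i j : Fin N, (if |idxDiff i j| ≤ K then c * (‖u i‖ ^ 2 + ‖v j‖ ^ 2) else 0) =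
      (if |idxDiff i j| ≤ K then c * ‖u i‖ ^ 2 else 0) +
      (if |idxDiff i j| ≤ K then c * ‖v j‖ ^ 2 else 0) := by
    intro i j; split_ifs <;> ring
  simp only [h2, Finset.sum_add_distrib]
  rw [mul_add]
  refine add_le_add ?_ ?_
  · rw [nsq, Finset.mul_sum]
    refine Finset.sum_le_sum fun i _ => ?_
    rw [mul_assoc]
    exact sum_band_le i (by positivity) fun j _ => le_rfl
  · rw [Finset.sum_comm, nsq, Finset.mul_sum]
    refine Finset.sum_le_sum fun j _ => ?_
    rw [mul_assoc]
    simp only [fun i : Fin N => abs_idxDiff_comm i j]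
    exact sum_band_le j (by positivity) fun j _ => le_rfl

/-- The sum of the absolute values of the entries of a matrix within distance `K` of the
diagonal. -/
def bandSum (K : ℕ) (A : Matrix (Fin N) (Fin N) ℂ) : ℝ :=
  ∑ j, ∑ l, if |idxDiff j l| ≤ K then ‖A j l‖ else 0

lemma bandSum_nonneg (K : ℕ) (A : Matrix (Fin N) (Fin N) ℂ) : 0 ≤ bandSum K A :=
  Finset.sum_nonneg fun _ _ => Finset.sum_nonneg fun _ _ => by split_ifs <;> positivity

lemma bandSum_le_norm (K : ℕ) (A : Matrix (Fin N) (Fin N) ℂ) :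
    bandSum K A ≤ N * ((2 * K + 1) * ‖A‖) := by
  refine (Finset.sum_le_card_nsmul _ _ ((2 * K + 1) * ‖A‖) fun j _ => ?_).trans ?_
  · exact sum_band_le j (norm_nonneg _) fun l _ => norm_entry_le A j l
  · simp

lemma bandSum_sq_le (K : ℕ) (A : Matrix (Fin N) (Fin N) ℂ) :
    bandSum K A ^ 2 ≤ N * (2 * K + 1) * ∑ j, ∑ l, ‖A j l‖ ^ 2 := by
  have e : bandSum K A = ∑ p : Fin N × Fin N,
      (if |idxDiff p.1 p.2| ≤ K then (1 : ℝ) else 0) * ‖A p.1 p.2‖ := by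
    rw [Fintype.sum_prod_type]
    simp [bandSum]
  rw [e]
  refine (Finset.sum_mul_sq_le_sq_mul_sq _ _ _).trans ?_
  rw [Fintype.sum_prod_type, Fintype.sum_prod_type]
  refine mul_le_mul_of_nonneg_right ?_ (by positivity)
  refine (Finset.sum_le_card_nsmul _ _ (2 * (K : ℝ) + 1) fun j _ => ?_).trans ?_
  · have := sum_band_le (K := K) j (f := fun _ => 1) zero_le_one fun _ _ => le_rfl
    simpa using this
  · simp [mul_add]

/-- A tensor with entries in `[-1, 1]` supported on index pairs at distance at most `K`. -/
structure BandedTensor (K : ℕ) (ξ : Fin N → Fin N → Fin N → Fin N → ℝ) : Prop where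
  abs_le : ∀ i j k l, |ξ i j k l| ≤ 1
  eq_zero : ∀ i j k l, ξ i j k l ≠ 0 → |idxDiff i k| ≤ K ∧ |idxDiff j l| ≤ K

/-- Both index pairs of ξ are confined to the band: (i, k) determines which entries of Ξ(A) can be
nonzero, and (j, l) which entries of A contribute. -/
lemma BandedTensor.norm_apply_le {K : ℕ} {ξ : Fin N → Fin N → Fin N → Fin N → ℝ}
    (hξ : BandedTensor K ξ) (A : Matrix (Fin N) (Fin N) ℂ) (i k : Fin N) :
    ‖Xi ξ A i k‖ ≤ if |idxDiff i k| ≤ K then (N : ℝ)⁻¹ * bandSum K A else 0 := by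
  have h1 : ‖Xi ξ A i k‖ ≤ (N : ℝ)⁻¹ * ∑ j, ∑ l, |ξ i j k l| * ‖A j l‖ := by
    rw [Xi, Matrix.of_apply, norm_mul, norm_inv, Complex.norm_natCast]
    refine mul_le_mul_of_nonneg_left ?_ (by positivity)
    refine (norm_sum_le _ _).trans (Finset.sum_le_sum fun j _ => (norm_sum_le _ _).trans
      (Finset.sum_le_sum fun l _ => ?_))
    simp
  refine h1.trans ?_
  split_ifs with h
  · refine mul_le_mul_of_nonneg_left ?_ (by positivity)
    refine Finset.sum_le_sum fun j _ => Finset.sum_le_sum fun l _ => ?_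
    by_cases h0 : ξ i j k l = 0
    · rw [h0]; split_ifs <;> simp
    · rw [if_pos (hξ.eq_zero i j k l h0).2]
      nlinarith [hξ.abs_le i j k l, norm_nonneg (A j l)]
  · refine le_of_eq ?_
    rw [mul_eq_zero]
    right
    refine Finset.sum_eq_zero fun j _ => Finset.sum_eq_zero fun l _ => ?_
    by_cases h0 : ξ i j k l = 0
    · simp [h0]
    · exact absurd (hξ.eq_zero i j k l h0).1 h

lemma BandedTensor.norm_Xi_le {K : ℕ} {ξ : Fin N → Fin N → Fin N → Fin N → ℝ}
    (hξ : BandedTensor K ξ) (A : Matrix (Fin N) (Fin N) ℂ) :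
    ‖Xi ξ A‖ ≤ (2 * K + 1) * ((N : ℝ)⁻¹ * bandSum K A) :=
  norm_le_of_banded (mul_nonneg (by positivity) (bandSum_nonneg K A)) (hξ.norm_apply_le A)

lemma inv_natCast_mul_bandSum_le (K : ℕ) (A : Matrix (Fin N) (Fin N) ℂ) :
    (N : ℝ)⁻¹ * bandSum K A ≤ (2 * K + 1) * ‖A‖ := by
  have h := mul_le_mul_of_nonneg_left (bandSum_le_norm K A) (inv_nonneg.2 (Nat.cast_nonneg (α := ℝ) N))
  refine h.trans ?_
  rw [← mul_assoc]
  exact mul_le_of_le_one_left (by positivity) (inv_mul_le_one)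

lemma BandedTensor.norm_Xi_le_norm {K : ℕ} {ξ : Fin N → Fin N → Fin N → Fin N → ℝ}
    (hξ : BandedTensor K ξ) (A : Matrix (Fin N) (Fin N) ℂ) :
    ‖Xi ξ A‖ ≤ (2 * K + 1) ^ 2 * ‖A‖ := by
  refine (hξ.norm_Xi_le A).trans ?_
  rw [sq, mul_assoc]
  exact mul_le_mul_of_nonneg_left (inv_natCast_mul_bandSum_le K A) (by positivity)

/-- A smoothing property: smallness in the normalized Hilbert–Schmidt norm becomes smallness in
operator norm after Ξ. The saturated case of the stability proof has only Hilbert–Schmidt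
information. -/
lemma BandedTensor.norm_Xi_sq_le {K : ℕ} {ξ : Fin N → Fin N → Fin N → Fin N → ℝ}
    (hξ : BandedTensor K ξ) (A : Matrix (Fin N) (Fin N) ℂ) :
    N * ‖Xi ξ A‖ ^ 2 ≤ (2 * K + 1) ^ 3 * ∑ j, ∑ l, ‖A j l‖ ^ 2 := by
  rcases Nat.eq_zero_or_pos N with rfl | hN
  · simp
  have hN' : (0 : ℝ) < N := by exact_mod_cast hN
  have h1 := pow_le_pow_left₀ (norm_nonneg _) (hξ.norm_Xi_le A) 2
  have h2 := bandSum_sq_le K A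
  calc (N : ℝ) * ‖Xi ξ A‖ ^ 2 ≤ N * ((2 * K + 1) * ((N : ℝ)⁻¹ * bandSum K A)) ^ 2 := by gcongr
    _ = (2 * K + 1) ^ 2 * ((N : ℝ)⁻¹ * bandSum K A ^ 2) := by field_simp
    _ ≤ (2 * K + 1) ^ 2 * ((N : ℝ)⁻¹ * (N * (2 * K + 1) * ∑ j, ∑ l, ‖A j l‖ ^ 2)) := by gcongr
    _ = (2 * K + 1) ^ 3 * ∑ j, ∑ l, ‖A j l‖ ^ 2 := by field_simp

end Band

/-! ### Linearity and positivity of `Ξ` -/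

section Kraus

variable {N : ℕ} {ξ : Fin N → Fin N → Fin N → Fin N → ℝ}

lemma Xi_add (A B : Matrix (Fin N) (Fin N) ℂ) : Xi ξ (A + B) = Xi ξ A + Xi ξ B := by
  ext i k
  simp [Xi, mul_add, Finset.sum_add_distrib]

lemma Xi_smul (c : ℂ) (A : Matrix (Fin N) (Fin N) ℂ) : Xi ξ (c • A) = c • Xi ξ A := by
  ext i k
  simp only [Xi, Matrix.of_apply, Matrix.smul_apply, smul_eq_mul, Finset.mul_sum]
  refine Finset.sum_congr rfl fun j _ => Finset.sum_congr rfl fun l _ => ?_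
  ring

lemma Xi_sub (A B : Matrix (Fin N) (Fin N) ℂ) : Xi ξ (A - B) = Xi ξ A - Xi ξ B := by
  ext i k
  simp [Xi, mul_sub, Finset.sum_sub_distrib]

/-- `ξ` is a sum of squares on top of a multiple `c₀` of the identity covariance. -/
def IsSumOfSquares (c₀ : ℝ) (ξ : Fin N → Fin N → Fin N → Fin N → ℝ) : Prop :=
  ∃ (S : Type) (_ : Fintype S) (V : S → Fin N → Fin N → ℝ), ∀ i j k l,
    ξ i j k l = c₀ * (if i = k ∧ j = l then 1 else 0) + ∑ s, V s i j * V s k l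

lemma IsSumOfSquares.symm {c₀ : ℝ} (h : IsSumOfSquares c₀ ξ) (i j k l : Fin N) :
    ξ i j k l = ξ k l i j := by
  obtain ⟨S, _, V, hV⟩ := h
  rw [hV, hV]
  congr 1
  · simp only [eq_comm]
  · exact Finset.sum_congr rfl fun s _ => mul_comm _ _

lemma IsSumOfSquares.Xi_conjTranspose {c₀ : ℝ} (h : IsSumOfSquares c₀ ξ)
    (A : Matrix (Fin N) (Fin N) ℂ) : Xi ξ Aᴴ = (Xi ξ A)ᴴ := by
  ext i k
  simp only [Xi, Matrix.of_apply, Matrix.conjTranspose_apply, star_mul', star_sum, star_inv₀,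
    star_natCast]
  congr 1
  rw [Finset.sum_comm]
  refine Finset.sum_congr rfl fun j _ => Finset.sum_congr rfl fun l _ => ?_
  rw [h.symm k j i l]
  simp

/-- The Kraus form of Ξ: `T s` is the transpose of `V s` acting on vectors, and the identity part of
ξ contributes the normalized trace. A single family `T` serves all A, so forms of different matrices
can be compared term by term. -/
lemma IsSumOfSquares.sesq_Xi {c₀ : ℝ} (h : IsSumOfSquares c₀ ξ) :
    ∃ (S : Type) (_ : Fintype S) (T : S → (Fin N → ℂ) → (Fin N → ℂ)),
      ∀ (A : Matrix (Fin N) (Fin N) ℂ) (u v : Fin N → ℂ),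
        sesq (Xi ξ A) u v = c₀ * ((N : ℂ)⁻¹ * A.trace) * (star u ⬝ᵥ v) +
          (N : ℂ)⁻¹ * ∑ s, sesq A (T s u) (T s v) := by
  obtain ⟨S, _, V, hV⟩ := h
  refine ⟨S, inferInstance, fun s u j => ∑ i, (V s i j : ℂ) * u i, fun A u v => ?_⟩
  have e1 : sesq (Xi ξ A) u v =
      (N : ℂ)⁻¹ * ∑ i, ∑ k, ∑ j, ∑ l, star (u i) * ((ξ i j k l : ℂ) * A j l) * v k := by
    rw [sesq_eq_sum]
    simp only [Xi, Matrix.of_apply, Finset.mul_sum, Finset.sum_mul]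
    refine Finset.sum_congr rfl fun i _ => Finset.sum_congr rfl fun k _ =>
      Finset.sum_congr rfl fun j _ => Finset.sum_congr rfl fun l _ => ?_
    ring
  have e2 : ∑ i, ∑ k, ∑ j, ∑ l, star (u i) *
      (((c₀ * (if i = k ∧ j = l then 1 else 0) : ℝ) : ℂ) * A j l) * v k =
      c₀ * A.trace * (star u ⬝ᵥ v) := by
    have : ∀ i k, ∑ j, ∑ l, star (u i) *
        (((c₀ * (if i = k ∧ j = l then 1 else 0) : ℝ) : ℂ) * A j l) * v k =
        if i = k then star (u i) * v k * c₀ * A.trace else 0 := by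
      intro i k
      split_ifs with hik
      · simp only [hik, true_and, Matrix.trace, Finset.mul_sum, Matrix.diag_apply]
        refine Finset.sum_congr rfl fun j _ => ?_
        rw [Finset.sum_eq_single j]
        · simp; ring
        · intro l _ hl; simp [hl.symm]
        · simp
      · simp [hik]
    simp only [this, Finset.sum_ite_eq, Finset.mem_univ, if_true, dotProduct, Finset.mul_sum,
      Pi.star_apply]
    exact Finset.sum_congr rfl fun i _ => by ring
  have e3 : ∀ s, sesq A (fun j => ∑ i, (V s i j : ℂ) * u i) (fun j => ∑ i, (V s i j : ℂ) * v i) =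
      ∑ i, ∑ k, ∑ j, ∑ l, star (u i) * (((V s i j * V s k l : ℝ) : ℂ) * A j l) * v k := by
    intro s
    rw [sesq_eq_sum]
    simp only [star_sum, star_mul', Finset.mul_sum, Finset.sum_mul]
    have : ∀ (f : Fin N → Fin N → Fin N → Fin N → ℂ), ∑ j, ∑ l, ∑ k, ∑ i, f i j k l =
        ∑ i, ∑ k, ∑ j, ∑ l, f i j k l := by
      intro f
      calc ∑ j, ∑ l, ∑ k, ∑ i, f i j k l = ∑ j, ∑ k, ∑ i, ∑ l, f i j k l := by
            refine Finset.sum_congr rfl fun j _ => ?_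
            rw [Finset.sum_comm]
            exact Finset.sum_congr rfl fun k _ => Finset.sum_comm
        _ = ∑ k, ∑ j, ∑ i, ∑ l, f i j k l := Finset.sum_comm
        _ = ∑ k, ∑ i, ∑ j, ∑ l, f i j k l :=
            Finset.sum_congr rfl fun k _ => Finset.sum_comm
        _ = _ := Finset.sum_comm
    rw [this fun i j k l => star (V s i j : ℂ) * star (u i) * A j l * ((V s k l : ℂ) * v k)]
    refine Finset.sum_congr rfl fun i _ => Finset.sum_congr rfl fun k _ =>
      Finset.sum_congr rfl fun j _ => Finset.sum_congr rfl fun l _ => ?_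
    simp
    ring
  rw [e1]
  simp only [e3]
  rw [show (c₀ : ℂ) * ((N : ℂ)⁻¹ * A.trace) * (star u ⬝ᵥ v) =
    (N : ℂ)⁻¹ * (c₀ * A.trace * (star u ⬝ᵥ v)) by ring, ← e2, ← mul_add]
  congr 1
  have e4 : ∀ f : S → Fin N → Fin N → Fin N → Fin N → ℂ, ∑ s, ∑ i, ∑ k, ∑ j, ∑ l, f s i k j l =
      ∑ i, ∑ k, ∑ j, ∑ l, ∑ s, f s i k j l := by
    intro f
    rw [Finset.sum_comm]
    refine Finset.sum_congr rfl fun i _ => ?_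
    rw [Finset.sum_comm]
    refine Finset.sum_congr rfl fun k _ => ?_
    rw [Finset.sum_comm]
    exact Finset.sum_congr rfl fun j _ => Finset.sum_comm
  rw [e4]
  simp only [← Finset.sum_add_distrib]
  refine Finset.sum_congr rfl fun i _ => Finset.sum_congr rfl fun k _ =>
    Finset.sum_congr rfl fun j _ => Finset.sum_congr rfl fun l _ => ?_
  rw [hV]
  push_cast
  rw [add_mul, mul_add, add_mul, Finset.sum_mul, Finset.mul_sum, Finset.sum_mul]

lemma imForm_Xi_of_sesq_Xi {c₀ : ℝ} {S : Type} [Fintype S] {T : S → (Fin N → ℂ) → (Fin N → ℂ)}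
    {A : Matrix (Fin N) (Fin N) ℂ} (hT : ∀ u v : Fin N → ℂ,
      sesq (Xi ξ A) u v = c₀ * ((N : ℂ)⁻¹ * A.trace) * (star u ⬝ᵥ v) +
        (N : ℂ)⁻¹ * ∑ s, sesq A (T s u) (T s v)) (u : Fin N → ℂ) :
    imForm (Xi ξ A) u = c₀ * ((N : ℝ)⁻¹ * A.trace.im) * nsq u +
      (N : ℝ)⁻¹ * ∑ s, imForm A (T s u) := by
  have e1 : (N : ℂ)⁻¹ = (((N : ℝ)⁻¹ : ℝ) : ℂ) := by push_cast; rfl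
  rw [imForm, hT, star_dotProduct_self, e1, Complex.add_im, Complex.im_mul_ofReal,
    Complex.im_ofReal_mul, Complex.im_ofReal_mul, Complex.im_ofReal_mul, Complex.im_sum]
  rfl

lemma IsSumOfSquares.le_imForm_Xi {c₀ : ℝ} (h : IsSumOfSquares c₀ ξ)
    {A : Matrix (Fin N) (Fin N) ℂ} (hA : ∀ u, 0 ≤ imForm A u) (u : Fin N → ℂ) :
    c₀ * ((N : ℝ)⁻¹ * A.trace.im) * nsq u ≤ imForm (Xi ξ A) u := by
  obtain ⟨S, _, T, hT⟩ := h.sesq_Xi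
  rw [imForm_Xi_of_sesq_Xi (hT A)]
  have : 0 ≤ (N : ℝ)⁻¹ * ∑ s, imForm A (T s u) :=
    mul_nonneg (by positivity) (Finset.sum_nonneg fun s _ => hA _)
  linarith

lemma IsSumOfSquares.imForm_Xi_nonneg (h : IsSumOfSquares 0 ξ)
    {A : Matrix (Fin N) (Fin N) ℂ} (hA : ∀ u, 0 ≤ imForm A u) (u : Fin N → ℂ) :
    0 ≤ imForm (Xi ξ A) u := by
  have := h.le_imForm_Xi hA u
  simpa using this

/-- Domination of forms is preserved by `Ξ`, with a gain controlled by the traces. -/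
lemma IsSumOfSquares.two_norm_sesq_Xi_le {c₀ : ℝ} (hc₀ : 0 ≤ c₀) (h : IsSumOfSquares c₀ ξ)
    {X A B : Matrix (Fin N) (Fin N) ℂ} {δ : ℝ}
    (hX : ∀ u v, 2 * ‖sesq X u v‖ ≤ δ * (imForm A u + imForm B v)) (u v : Fin N → ℂ) :
    2 * ‖sesq (Xi ξ X) u v‖ ≤ δ * (imForm (Xi ξ A) u + imForm (Xi ξ B) v) -
      c₀ * (N : ℝ)⁻¹ * (δ * (A.trace.im * nsq u + B.trace.im * nsq v) -
        ‖X.trace‖ * (nsq u + nsq v)) := by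
  obtain ⟨S, _, T, hT⟩ := h.sesq_Xi
  have h1 : ‖sesq (Xi ξ X) u v‖ ≤ c₀ * ((N : ℝ)⁻¹ * ‖X.trace‖) * ‖star u ⬝ᵥ v‖ +
      (N : ℝ)⁻¹ * ∑ s, ‖sesq X (T s u) (T s v)‖ := by
    rw [hT]
    refine (norm_add_le _ _).trans (add_le_add (le_of_eq ?_) ?_)
    · simp [abs_of_nonneg hc₀]
    · rw [norm_mul, norm_inv, Complex.norm_natCast]
      exact mul_le_mul_of_nonneg_left (norm_sum_le _ _) (by positivity)
  have h2 : (N : ℝ)⁻¹ * (2 * ∑ s, ‖sesq X (T s u) (T s v)‖) ≤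
      (N : ℝ)⁻¹ * (δ * (∑ s, imForm A (T s u) + ∑ s, imForm B (T s v))) := by
    refine mul_le_mul_of_nonneg_left ?_ (by positivity)
    rw [← Finset.sum_add_distrib, Finset.mul_sum, Finset.mul_sum]
    exact Finset.sum_le_sum fun s _ => hX _ _
  have h3 : c₀ * ((N : ℝ)⁻¹ * ‖X.trace‖) * (2 * ‖star u ⬝ᵥ v‖) ≤
      c₀ * ((N : ℝ)⁻¹ * ‖X.trace‖) * (nsq u + nsq v) :=
    mul_le_mul_of_nonneg_left (two_norm_star_dotProduct_le u v) (by positivity)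
  rw [imForm_Xi_of_sesq_Xi (hT A), imForm_Xi_of_sesq_Xi (hT B)]
  linarith

end Kraus

end CorrelatedMatrix

end

noncomputable section

namespace CorrelatedMatrix

open scoped Matrix.Norms.L2Operator

/-! ### Unique solvability of the matrix equation -/

section MatrixEquation

variable {N : ℕ} {ξ : Fin N → Fin N → Fin N → Fin N → ℝ} {z : ℂ}

lemma neg_imForm_denomMatrix (A : Matrix (Fin N) (Fin N) ℂ) (u : Fin N → ℂ) :
    -imForm (denomMatrix ξ z A) u = z.im * nsq u + imForm (Xi ξ A) u := by
  rw [denomMatrix, imForm_sub, imForm_neg, imForm_smul_one]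
  ring

lemma denomMatrix_sub (A B : Matrix (Fin N) (Fin N) ℂ) :
    denomMatrix ξ z B - denomMatrix ξ z A = Xi ξ (A - B) := by
  rw [Xi_sub]
  simp [denomMatrix]

lemma norm_one_le : ‖(1 : Matrix (Fin N) (Fin N) ℂ)‖ ≤ 1 := by
  refine opNorm_le_of_forall_sesq zero_le_one fun u v => ?_
  rw [sesq_one, one_mul]
  exact two_norm_star_dotProduct_le u v

lemma norm_denomMatrix_le {K : ℕ} (hb : BandedTensor K ξ) (A : Matrix (Fin N) (Fin N) ℂ) :
    ‖denomMatrix ξ z A‖ ≤ ‖z‖ + (2 * K + 1) ^ 2 * ‖A‖ := by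
  refine (norm_sub_le _ _).trans (add_le_add ?_ (hb.norm_Xi_le_norm A))
  rw [norm_neg, norm_smul]
  exact mul_le_of_le_one_right (norm_nonneg _) norm_one_le

lemma denomMatrix_mul_F {A : Matrix (Fin N) (Fin N) ℂ} (h : IsUnit (denomMatrix ξ z A)) :
    denomMatrix ξ z A * F ξ z A = 1 :=
  Matrix.mul_nonsing_inv _ ((Matrix.isUnit_iff_isUnit_det _).1 h)

lemma F_mul_denomMatrix {A : Matrix (Fin N) (Fin N) ℂ} (h : IsUnit (denomMatrix ξ z A)) :
    F ξ z A * denomMatrix ξ z A = 1 :=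
  Matrix.nonsing_inv_mul _ ((Matrix.isUnit_iff_isUnit_det _).1 h)

lemma F_sub_F {A B : Matrix (Fin N) (Fin N) ℂ} (hA : IsUnit (denomMatrix ξ z A))
    (hB : IsUnit (denomMatrix ξ z B)) :
    F ξ z A - F ξ z B = F ξ z A * Xi ξ (A - B) * F ξ z B := by
  rw [← denomMatrix_sub (z := z), mul_sub, sub_mul, F_mul_denomMatrix hA, mul_assoc,
    denomMatrix_mul_F hB]
  simp

lemma le_neg_imForm_denomMatrix (hs : IsSumOfSquares 0 ξ) {A : Matrix (Fin N) (Fin N) ℂ}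
    (hA : ∀ u, 0 ≤ imForm A u) (u : Fin N → ℂ) : z.im * nsq u ≤ -imForm (denomMatrix ξ z A) u := by
  rw [neg_imForm_denomMatrix]
  linarith [hs.imForm_Xi_nonneg hA u]

lemma isUnit_denomMatrix (hs : IsSumOfSquares 0 ξ) (hz : 0 < z.im)
    {A : Matrix (Fin N) (Fin N) ℂ} (hA : ∀ u, 0 ≤ imForm A u) :
    IsUnit (denomMatrix ξ z A) :=
  isUnit_of_imForm_le hz (le_neg_imForm_denomMatrix hs hA)

lemma norm_F_le (hs : IsSumOfSquares 0 ξ) (hz : 0 < z.im)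
    {A : Matrix (Fin N) (Fin N) ℂ} (hA : ∀ u, 0 ≤ imForm A u) :
    ‖F ξ z A‖ ≤ z.im⁻¹ :=
  norm_le_of_imForm_le hz (denomMatrix_mul_F (isUnit_denomMatrix hs hz hA))
    (le_neg_imForm_denomMatrix hs hA)

/-- A domination constant between two matrices is finite only if their imaginary parts are bounded
below. The starting value 0 has no such bound, but after one application of F it is available. -/
lemma exists_le_imForm_F (hs : IsSumOfSquares 0 ξ) (hz : 0 < z.im) {K : ℕ} (hb : BandedTensor K ξ) :
    ∃ h : ℝ, 0 < h ∧ ∀ A : Matrix (Fin N) (Fin N) ℂ, (∀ u, 0 ≤ imForm A u) → ‖A‖ ≤ z.im⁻¹ →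
      ∀ u, h * nsq u ≤ imForm (F ξ z A) u := by
  have hd : 0 < ‖z‖ + (2 * K + 1) ^ 2 * z.im⁻¹ := by positivity
  refine ⟨z.im / (‖z‖ + (2 * K + 1) ^ 2 * z.im⁻¹) ^ 2, by positivity, fun A hA hn u => ?_⟩
  refine le_imForm_of_mul_eq_one hz.le hd (denomMatrix_mul_F (isUnit_denomMatrix hs hz hA)) ?_
    (le_neg_imForm_denomMatrix hs hA) u
  refine (norm_denomMatrix_le hb A).trans ?_
  gcongr

lemma imForm_F_nonneg (hs : IsSumOfSquares 0 ξ) (hz : 0 < z.im)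
    {A : Matrix (Fin N) (Fin N) ℂ} (hA : ∀ u, 0 ≤ imForm A u) (u : Fin N → ℂ) :
    0 ≤ imForm (F ξ z A) u := by
  rw [imForm_of_mul_eq_one (denomMatrix_mul_F (isUnit_denomMatrix hs hz hA))]
  exact le_trans (mul_nonneg hz.le (nsq_nonneg _)) (le_neg_imForm_denomMatrix hs hA _)

/-- Contraction. In F(A) Ξ(A − B) F(B) the domination bound passes through Ξ, and the moved test
vectors turn Im z + Im Ξ(A) into Im F(A). The factor below 1 arises because Im Ξ(A) is at most
(2K+1)²/Im z, hence only a fixed fraction of Im z + Im Ξ(A). -/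
lemma two_norm_sesq_F_sub_F_le (hs : IsSumOfSquares 0 ξ) (hz : 0 < z.im)
    {K : ℕ} (hb : BandedTensor K ξ) {A B : Matrix (Fin N) (Fin N) ℂ}
    (hA : ∀ u, 0 ≤ imForm A u) (hB : ∀ u, 0 ≤ imForm B u) (hAn : ‖A‖ ≤ z.im⁻¹)
    (hBn : ‖B‖ ≤ z.im⁻¹) {δ : ℝ} (hδ : 0 ≤ δ)
    (h : ∀ u v, 2 * ‖sesq (A - B) u v‖ ≤ δ * (imForm A u + imForm B v)) (u v : Fin N → ℂ) :
    2 * ‖sesq (F ξ z A - F ξ z B) u v‖ ≤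
      ((2 * K + 1) ^ 2 / (z.im ^ 2 + (2 * K + 1) ^ 2) * δ) *
        (imForm (F ξ z A) u + imForm (F ξ z B) v) := by
  have uA := isUnit_denomMatrix hs hz hA
  have uB := isUnit_denomMatrix hs hz hB
  rw [F_sub_F uA uB, sesq_mul_mul,
    imForm_of_mul_eq_one_conjTranspose (denomMatrix_mul_F uA),
    imForm_of_mul_eq_one (denomMatrix_mul_F uB), neg_imForm_denomMatrix, neg_imForm_denomMatrix]
  set u' := (F ξ z A)ᴴ *ᵥ u
  set v' := F ξ z B *ᵥ v
  set S : ℝ := (2 * K + 1) ^ 2 with hS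
  have hSpos : 0 < S := by positivity
  have key : ∀ {C : Matrix (Fin N) (Fin N) ℂ}, ‖C‖ ≤ z.im⁻¹ → ∀ w,
      imForm (Xi ξ C) w ≤ S / (z.im ^ 2 + S) * (z.im * nsq w + imForm (Xi ξ C) w) := by
    intro C hC w
    have h1 : imForm (Xi ξ C) w ≤ S * z.im⁻¹ * nsq w := by
      refine (imForm_le _ _).trans (mul_le_mul_of_nonneg_right ?_ (nsq_nonneg _))
      exact (hb.norm_Xi_le_norm C).trans (mul_le_mul_of_nonneg_left hC hSpos.le)
    rw [div_mul_eq_mul_div, le_div_iff₀ (by positivity)]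
    have h2 : imForm (Xi ξ C) w * z.im ^ 2 ≤ S * z.im⁻¹ * nsq w * z.im ^ 2 :=
      mul_le_mul_of_nonneg_right h1 (by positivity)
    have h3 : S * z.im⁻¹ * nsq w * z.im ^ 2 = S * z.im * nsq w := by field_simp
    linarith
  have h1 := hs.two_norm_sesq_Xi_le le_rfl h u' v'
  simp only [zero_mul, sub_zero] at h1
  have h2 := mul_le_mul_of_nonneg_left (add_le_add (key hAn u') (key hBn v')) hδ
  linarith

lemma isMatrixSolution_iff (hs : IsSumOfSquares 0 ξ) (hz : 0 < z.im)
    {M : Matrix (Fin N) (Fin N) ℂ} :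
    IsMatrixSolution ξ z M ↔ (∀ u, 0 ≤ imForm M u) ∧ F ξ z M = M := by
  have e : IsMatrixSolution ξ z M ↔ (imPart M).PosDef ∧ M * denomMatrix ξ z M = 1 := Iff.rfl
  rw [e, posDef_imPart_iff]
  constructor
  · rintro ⟨h1, h2⟩
    refine ⟨fun u => ?_, Matrix.inv_eq_left_inv h2⟩
    by_cases hu : u = 0
    · simp [hu, imForm, sesq]
    · exact (h1 u hu).le
  · rintro ⟨h1, h2⟩
    have hu := isUnit_denomMatrix (z := z) hs hz h1
    have h3 := F_mul_denomMatrix hu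
    rw [h2] at h3
    refine ⟨fun u hu0 => ?_, h3⟩
    rw [imForm_of_mul_eq_one (mul_eq_one_comm.1 h3)]
    refine lt_of_lt_of_le ?_ (le_neg_imForm_denomMatrix hs h1 _)
    refine mul_pos hz (nsq_pos fun h0 => hu0 ?_)
    have : (denomMatrix ξ z M * M) *ᵥ u = 0 := by rw [← Matrix.mulVec_mulVec, h0, Matrix.mulVec_zero]
    rwa [mul_eq_one_comm.1 h3, Matrix.one_mulVec] at this

lemma continuous_sesq (u v : Fin N → ℂ) : Continuous fun A : Matrix (Fin N) (Fin N) ℂ => sesq A u v := by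
  have : Continuous fun A : Matrix (Fin N) (Fin N) ℂ => star u ⬝ᵥ (A *ᵥ v) := by fun_prop
  exact this

lemma continuous_denomMatrix : Continuous (denomMatrix ξ z) := by
  unfold denomMatrix
  refine continuous_const.sub (continuous_pi fun i => continuous_pi fun k => ?_)
  simp only [Xi, Matrix.of_apply]
  fun_prop

lemma isMatrixSolution_of_tendsto (hs : IsSumOfSquares 0 ξ) (hz : 0 < z.im)
    {A : ℕ → Matrix (Fin N) (Fin N) ℂ} {M : Matrix (Fin N) (Fin N) ℂ}
    (hA : ∀ n u, 0 ≤ imForm (A n) u) (hAF : ∀ n, A (n + 1) = F ξ z (A n))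
    (hM : Filter.Tendsto A Filter.atTop (nhds M)) : IsMatrixSolution ξ z M := by
  have hM0 : ∀ u, 0 ≤ imForm M u := fun u => by
    have hc : Continuous fun A : Matrix (Fin N) (Fin N) ℂ => imForm A u :=
      Complex.continuous_im.comp (continuous_sesq u u)
    exact ge_of_tendsto' ((hc.tendsto M).comp hM) fun n => hA n u
  have hM1 : Filter.Tendsto (fun n => A (n + 1)) Filter.atTop (nhds M) :=
    hM.comp (Filter.tendsto_add_atTop_nat 1)
  have hM2 : Filter.Tendsto (fun n => A (n + 1) * denomMatrix ξ z (A n))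
      Filter.atTop (nhds (M * denomMatrix ξ z M)) :=
    hM1.mul ((continuous_denomMatrix.tendsto M).comp hM)
  have hM3 : M * denomMatrix ξ z M = 1 := by
    refine tendsto_nhds_unique hM2 (tendsto_const_nhds.congr fun n => ?_)
    rw [hAF]
    exact (F_mul_denomMatrix (isUnit_denomMatrix hs hz (hA n))).symm
  exact (isMatrixSolution_iff hs hz).2 ⟨hM0, Matrix.inv_eq_left_inv hM3⟩

theorem existsUnique_isMatrixSolution (hs : IsSumOfSquares 0 ξ) (hz : 0 < z.im) {K : ℕ} (hb : BandedTensor K ξ) :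
    ∃! M : Matrix (Fin N) (Fin N) ℂ, IsMatrixSolution ξ z M := by
  obtain ⟨h, hh, hlow⟩ := exists_le_imForm_F hs hz hb
  set q : ℝ := (2 * K + 1) ^ 2 / (z.im ^ 2 + (2 * K + 1) ^ 2) with hqdef
  have hq0 : 0 ≤ q := by positivity
  have hq1 : q < 1 := by
    rw [hqdef, div_lt_one (by positivity)]
    have : 0 < z.im ^ 2 := by positivity
    linarith
  have start : ∀ A B : Matrix (Fin N) (Fin N) ℂ, (∀ u, h * nsq u ≤ imForm A u) →
      (∀ u, h * nsq u ≤ imForm B u) → ∀ u v, 2 * ‖sesq (A - B) u v‖ ≤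
        (‖A - B‖ / h) * (imForm A u + imForm B v) := by
    intro A B hA hB u v
    refine (two_norm_sesq_le _ _ _).trans ?_
    rw [div_mul_eq_mul_div, le_div_iff₀ hh]
    have := mul_le_mul_of_nonneg_left (add_le_add (hA u) (hB v)) (norm_nonneg (A - B))
    linarith
  -- The power of q lags one behind the iterate because the first application of F only serves to
  -- make the domination constant finite.
  have step : ∀ A B : Matrix (Fin N) (Fin N) ℂ, (∀ u, 0 ≤ imForm A u) → (∀ u, 0 ≤ imForm B u) →
      ‖A‖ ≤ z.im⁻¹ → ‖B‖ ≤ z.im⁻¹ → ∀ u v (n : ℕ),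
      2 * ‖sesq ((F ξ z)^[n + 1] A - (F ξ z)^[n + 1] B) u v‖ ≤
        (q ^ n * (‖F ξ z A - F ξ z B‖ / h)) *
          (imForm ((F ξ z)^[n + 1] A) u + imForm ((F ξ z)^[n + 1] B) v) := by
    intro A B hA hB hAn hBn u v n
    have inv : ∀ A : Matrix (Fin N) (Fin N) ℂ, (∀ u, 0 ≤ imForm A u) → ‖A‖ ≤ z.im⁻¹ → ∀ n,
        (∀ u, 0 ≤ imForm ((F ξ z)^[n] A) u) ∧ ‖(F ξ z)^[n] A‖ ≤ z.im⁻¹ := by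
      intro A hA hAn n
      induction n with
      | zero => exact ⟨hA, hAn⟩
      | succ n ih =>
        rw [Function.iterate_succ_apply']
        exact ⟨imForm_F_nonneg hs hz ih.1, norm_F_le hs hz ih.1⟩
    induction n generalizing u v with
    | zero =>
      rw [pow_zero, one_mul]
      exact start _ _ (hlow A hA hAn) (hlow B hB hBn) u v
    | succ n ih =>
      rw [Function.iterate_succ_apply', Function.iterate_succ_apply' _ _ B, pow_succ', mul_assoc q]
      exact two_norm_sesq_F_sub_F_le hs hz hb (inv A hA hAn _).1 (inv B hB hBn _).1
        (inv A hA hAn _).2 (inv B hB hBn _).2 (by positivity) ih u v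
  have inv0 : ∀ n, (∀ u, 0 ≤ imForm ((F ξ z)^[n] 0) u) ∧ ‖(F ξ z)^[n] 0‖ ≤ z.im⁻¹ := by
    intro n
    induction n with
    | zero => exact ⟨fun u => by simp [imForm, sesq], by simp [hz.le]⟩
    | succ n ih =>
      rw [Function.iterate_succ_apply']
      exact ⟨imForm_F_nonneg hs hz ih.1, norm_F_le hs hz ih.1⟩
  have cauchy : CauchySeq fun n => (F ξ z)^[n + 1] 0 := by
    refine cauchySeq_of_le_geometric q (‖F ξ z 0 - F ξ z (F ξ z 0)‖ / h * z.im⁻¹) hq1 fun n => ?_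
    rw [dist_eq_norm]
    refine opNorm_le_of_forall_sesq (by positivity) fun u v => ?_
    have h1 := step 0 (F ξ z 0) (inv0 0).1 (inv0 1).1 (inv0 0).2 (inv0 1).2 u v n
    rw [← Function.iterate_succ_apply (F ξ z) (n + 1) 0] at h1
    refine h1.trans ?_
    have hu := (imForm_le ((F ξ z)^[n + 1] 0) u).trans
      (mul_le_mul_of_nonneg_right (inv0 (n + 1)).2 (nsq_nonneg u))
    have hv := (imForm_le ((F ξ z)^[n + 1 + 1] 0) v).trans
      (mul_le_mul_of_nonneg_right (inv0 (n + 1 + 1)).2 (nsq_nonneg v))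
    have hc : 0 ≤ q ^ n * (‖F ξ z 0 - F ξ z (F ξ z 0)‖ / h) := by positivity
    have := mul_le_mul_of_nonneg_left (add_le_add hu hv) hc
    refine this.trans (le_of_eq ?_)
    ring
  obtain ⟨M, hM⟩ := cauchySeq_tendsto_of_complete cauchy
  refine ⟨M, ?_, ?_⟩
  · refine isMatrixSolution_of_tendsto hs hz (fun n => (inv0 (n + 1)).1) (fun n => ?_) hM
    exact Function.iterate_succ_apply' _ _ _
  · intro M' hM'
    have hMs : ∀ B : Matrix (Fin N) (Fin N) ℂ, IsMatrixSolution ξ z B → (∀ u, 0 ≤ imForm B u) ∧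
        F ξ z B = B ∧ ‖B‖ ≤ z.im⁻¹ := by
      intro B hB
      have := (isMatrixSolution_iff hs hz).1 hB
      refine ⟨this.1, this.2, ?_⟩
      conv_lhs => rw [← this.2]
      exact norm_F_le hs hz this.1
    obtain ⟨a1, a2, a3⟩ := hMs M' hM'
    have fix : ∀ n, (F ξ z)^[n] M' = M' := fun n => Function.iterate_fixed a2 n
    -- Another solution is a fixed orbit of F, so the same contraction estimate draws the iterates
    -- of 0 towards it.
    have lim : Filter.Tendsto (fun n => (F ξ z)^[n + 1] 0) Filter.atTop (nhds M') := by
      rw [tendsto_iff_norm_sub_tendsto_zero]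
      have hb' : ∀ n : ℕ, ‖(F ξ z)^[n + 1] 0 - M'‖ ≤
          q ^ n * (‖F ξ z 0 - M'‖ / h * z.im⁻¹) := by
        intro n
        refine opNorm_le_of_forall_sesq (by positivity) fun u v => ?_
        have h1 := step 0 M' (inv0 0).1 a1 (inv0 0).2 a3 u v n
        rw [fix, a2] at h1
        refine h1.trans ?_
        have hu := (imForm_le ((F ξ z)^[n + 1] 0) u).trans
          (mul_le_mul_of_nonneg_right (inv0 (n + 1)).2 (nsq_nonneg u))
        have hv := (imForm_le M' v).trans (mul_le_mul_of_nonneg_right a3 (nsq_nonneg v))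
        have hc : 0 ≤ q ^ n * (‖F ξ z 0 - M'‖ / h) := by positivity
        refine (mul_le_mul_of_nonneg_left (add_le_add hu hv) hc).trans (le_of_eq ?_)
        ring
      have h0 := (tendsto_pow_atTop_nhds_zero_of_lt_one hq0 hq1).mul_const
        (‖F ξ z 0 - M'‖ / h * z.im⁻¹)
      rw [zero_mul] at h0
      exact squeeze_zero (fun n => norm_nonneg _) hb' h0
    exact tendsto_nhds_unique lim hM

end MatrixEquation

end CorrelatedMatrix

end

noncomputable section

namespace CorrelatedMatrix

open scoped Matrix.Norms.L2Operator

/-! ### The linearized equation -/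

section SesqVectors

variable {n : Type*} [Fintype n] [DecidableEq n]

lemma sesq_sub_left (A : Matrix n n ℂ) (u u' v : n → ℂ) :
    sesq A (u - u') v = sesq A u v - sesq A u' v := by
  simp [sesq, sub_dotProduct]

lemma sesq_sub_right (A : Matrix n n ℂ) (u v v' : n → ℂ) :
    sesq A u (v - v') = sesq A u v - sesq A u v' := by
  simp [sesq, Matrix.mulVec_sub, dotProduct_sub]

lemma sesq_smul_left' (A : Matrix n n ℂ) (c : ℂ) (u v : n → ℂ) :
    sesq A (c • u) v = star c * sesq A u v := by
  simp [sesq]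

lemma sesq_smul_right (A : Matrix n n ℂ) (c : ℂ) (u v : n → ℂ) :
    sesq A u (c • v) = c * sesq A u v := by
  simp [sesq, Matrix.mulVec_smul]

lemma norm_imPart_le (A : Matrix n n ℂ) : ‖imPart A‖ ≤ ‖A‖ := by
  rw [imPart, norm_smul]
  have h := norm_sub_le A Aᴴ
  rw [Matrix.l2_opNorm_conjTranspose] at h
  simp only [norm_inv, norm_mul, Complex.norm_ofNat, Complex.norm_I, mul_one]
  linarith

lemma imForm_smul_vec (A : Matrix n n ℂ) (t : ℝ) (u : n → ℂ) :
    imForm A ((t : ℂ) • u) = t ^ 2 * imForm A u := by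
  rw [imForm, imForm, sesq_smul_left', sesq_smul_right]
  have : star (t : ℂ) = t := Complex.conj_ofReal t
  rw [this, ← mul_assoc, ← Complex.ofReal_mul, Complex.im_ofReal_mul, sq]

lemma trace_im_eq_sum (A : Matrix n n ℂ) :
    A.trace.im = ∑ i, imForm A (Pi.single i 1) := by
  simp [Matrix.trace, imForm, sesq_single, Complex.im_sum]

/-- For 0 ≤ H ≤ g one has H² ≤ gH. Expanding the nonnegative form of H at w − g⁻¹Hw proves this
without a square root of H. -/
lemma nsq_imPart_mulVec_le {G : Matrix n n ℂ} {g : ℝ} (hg : 0 < g) (hG : ‖G‖ ≤ g)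
    (h0 : ∀ u, 0 ≤ imForm G u) (w : n → ℂ) : nsq (imPart G *ᵥ w) ≤ g * imForm G w := by
  set H := imPart G with hH
  have hHs : Hᴴ = H := imPart_conjTranspose G
  have e : (imForm G (w - ((g⁻¹ : ℝ) : ℂ) • (H *ᵥ w)) : ℂ) =
      ((imForm G w - 2 * g⁻¹ * nsq (H *ᵥ w) + g⁻¹ ^ 2 * imForm G (H *ᵥ w) : ℝ) : ℂ) := by
    rw [← sesq_imPart_self, ← hH, sesq_sub_left, sesq_sub_right, sesq_sub_right, sesq_smul_left',
      sesq_smul_left', sesq_smul_right, sesq_smul_right]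
    have e1 : sesq H w (H *ᵥ w) = nsq (H *ᵥ w) := by
      rw [← star_dotProduct_self, sesq, star_mulVec_dotProduct, hHs]
    have e2 : sesq H (H *ᵥ w) w = nsq (H *ᵥ w) := by
      rw [← star_dotProduct_self, sesq]
    have e3 : sesq H w w = imForm G w := sesq_imPart_self G w
    have e4 : sesq H (H *ᵥ w) (H *ᵥ w) = imForm G (H *ᵥ w) := sesq_imPart_self G _
    have e5 : star ((g⁻¹ : ℝ) : ℂ) = ((g⁻¹ : ℝ) : ℂ) := Complex.conj_ofReal _
    rw [e1, e2, e3, e4, e5]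
    push_cast
    ring
  have h1 := h0 (w - ((g⁻¹ : ℝ) : ℂ) • (H *ᵥ w))
  rw [Complex.ofReal_inj.1 e] at h1
  have h2 : imForm G (H *ᵥ w) ≤ g * nsq (H *ᵥ w) :=
    (imForm_le _ _).trans (mul_le_mul_of_nonneg_right hG (nsq_nonneg _))
  have h3 : g⁻¹ ^ 2 * imForm G (H *ᵥ w) ≤ g⁻¹ ^ 2 * (g * nsq (H *ᵥ w)) :=
    mul_le_mul_of_nonneg_left h2 (by positivity)
  have h4 : g⁻¹ ^ 2 * (g * nsq (H *ᵥ w)) = g⁻¹ * nsq (H *ᵥ w) := by field_simp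
  have h5 : g⁻¹ * nsq (H *ᵥ w) ≤ imForm G w := by linarith
  rw [inv_mul_le_iff₀ hg] at h5
  exact h5

end SesqVectors

section Stability

variable {N K : ℕ} {ξ : Fin N → Fin N → Fin N → Fin N → ℝ} {z : ℂ} {c₀ : ℝ}
  {A G X R : Matrix (Fin N) (Fin N) ℂ}

/-- The form of `X` is dominated by `δ` times the imaginary part of `G`. -/
def Dominated (G X : Matrix (Fin N) (Fin N) ℂ) (δ : ℝ) : Prop :=
  ∀ u v, 2 * ‖sesq X u v‖ ≤ δ * (imForm G u + imForm G v)

lemma Dominated.mono {δ δ' : ℝ} (h : Dominated G X δ) (h0 : ∀ u, 0 ≤ imForm G u) (hδ : δ ≤ δ') :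
    Dominated G X δ' := fun u v =>
  (h u v).trans (mul_le_mul_of_nonneg_right hδ (add_nonneg (h0 u) (h0 v)))

lemma dominated_of_le {h : ℝ} (hh : 0 < h) (hG : ∀ u, h * nsq u ≤ imForm G u) {r : ℝ}
    (hX : ‖X‖ ≤ r) : Dominated G X (r / h) := by
  intro u v
  refine (two_norm_sesq_le _ _ _).trans ?_
  have h1 := mul_le_mul_of_nonneg_left (add_le_add (hG u) (hG v)) ((norm_nonneg X).trans hX)
  have h2 := mul_le_mul_of_nonneg_right hX (add_nonneg (nsq_nonneg u) (nsq_nonneg v))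
  rw [div_mul_eq_mul_div, le_div_iff₀ hh]
  nlinarith

lemma Dominated.norm_le {δ g : ℝ} (h : Dominated G X δ) (hδ : 0 ≤ δ) (hg : ‖G‖ ≤ g) :
    ‖X‖ ≤ δ * g := by
  have hg0 : 0 ≤ g := (norm_nonneg G).trans hg
  refine opNorm_le_of_forall_sesq (by positivity) fun u v => (h u v).trans ?_
  have hu := (imForm_le G u).trans (mul_le_mul_of_nonneg_right hg (nsq_nonneg u))
  have hv := (imForm_le G v).trans (mul_le_mul_of_nonneg_right hg (nsq_nonneg v))
  have := mul_le_mul_of_nonneg_left (add_le_add hu hv) hδ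
  linarith

lemma Dominated.norm_trace_le {δ : ℝ} (h : Dominated G X δ) : ‖X.trace‖ ≤ δ * G.trace.im := by
  rw [trace_im_eq_sum, Matrix.trace, Finset.mul_sum]
  refine (norm_sum_le _ _).trans (Finset.sum_le_sum fun i _ => ?_)
  have := h (Pi.single i 1) (Pi.single i 1)
  rw [sesq_single] at this
  rw [Matrix.diag_apply]
  linarith

/-- The affine map δ ↦ (1 − κ)δ + e contracts to its fixed point e/κ, whatever finite constant one
starts from. -/
lemma Dominated.of_forall_improve {κ e : ℝ} (hκ : 0 < κ) (hκ1 : κ ≤ 1) (he : 0 ≤ e)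
    (himp : ∀ δ, 0 ≤ δ → Dominated G X δ → Dominated G X ((1 - κ) * δ + e))
    {δ₀ : ℝ} (hδ₀ : 0 ≤ δ₀) (h : Dominated G X δ₀) (h0 : ∀ u, 0 ≤ imForm G u) :
    Dominated G X (e / κ) := by
  have hk : 0 ≤ 1 - κ := by linarith
  have key : ∀ n : ℕ, Dominated G X ((1 - κ) ^ n * δ₀ + e / κ) := by
    intro n
    induction n with
    | zero => exact h.mono h0 (by simp; positivity)
    | succ n ih =>
      have := himp _ (by positivity) ih
      convert this using 1
      field_simp
      ring
  intro u v
  have h1 : Filter.Tendsto (fun n : ℕ => ((1 - κ) ^ n * δ₀ + e / κ) * (imForm G u + imForm G v))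
      Filter.atTop (nhds ((0 * δ₀ + e / κ) * (imForm G u + imForm G v))) :=
    (((tendsto_pow_atTop_nhds_zero_of_lt_one hk (by linarith)).mul_const δ₀).add_const _).mul_const _
  rw [zero_mul, zero_add] at h1
  exact ge_of_tendsto' h1 fun n => key n u v

/-- One step of the linearized equation improves a domination bound. -/
lemma Dominated.improve (hc₀ : 0 ≤ c₀) (hs : IsSumOfSquares c₀ ξ)
    (hDG : denomMatrix ξ z A * G = 1) {d h ε r κ δ : ℝ} (hh : 0 < h)
    (hD : ‖denomMatrix ξ z A‖ ≤ d) (hG : ∀ u, h * nsq u ≤ imForm G u)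
    (hε : ‖Xi ξ (G - A)‖ ≤ ε) (hX : X = G * Xi ξ X * G + R) (hR : ‖R‖ ≤ r) (hκ : 0 ≤ κ)
    (hδ : 0 ≤ δ) (hdom : Dominated G X δ)
    (hgain : κ * d * δ ≤ δ * (z.im - ε) + c₀ * (N : ℝ)⁻¹ * (δ * G.trace.im - ‖X.trace‖)) :
    Dominated G X ((1 - κ) * δ + r / h) := by
  intro u v
  have hR' := dominated_of_le hh hG hR u v
  have h1 : ‖sesq X u v‖ ≤ ‖sesq (Xi ξ X) (Gᴴ *ᵥ u) (G *ᵥ v)‖ + ‖sesq R u v‖ := by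
    conv_lhs => rw [hX]
    rw [sesq_add, sesq_mul_mul]
    exact norm_add_le _ _
  have h2 := hs.two_norm_sesq_Xi_le hc₀ hdom (Gᴴ *ᵥ u) (G *ᵥ v)
  have eu := imForm_of_mul_eq_one_conjTranspose hDG u
  have ev := imForm_of_mul_eq_one hDG v
  set u' := Gᴴ *ᵥ u
  set v' := G *ᵥ v
  -- The denominator relation expresses Im Ξ(G) by −Im D minus Im z. This missing Im z is a gain; ε
  -- is lost because D is formed with A instead of G.
  have hw : ∀ w, imForm (Xi ξ G) w ≤ -imForm (denomMatrix ξ z A) w - (z.im - ε) * nsq w := by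
    intro w
    rw [neg_imForm_denomMatrix]
    have e1 : imForm (Xi ξ G) w = imForm (Xi ξ A) w + imForm (Xi ξ (G - A)) w := by
      rw [Xi_sub, imForm_sub]; ring
    have := (imForm_le (Xi ξ (G - A)) w).trans (mul_le_mul_of_nonneg_right hε (nsq_nonneg w))
    linarith
  -- The gain is a multiple of the squared norm. The upper bound d on D converts it into a fraction
  -- κ of the form of −Im D, that is, of Im G at the original vectors.
  have hd : ∀ w, -imForm (denomMatrix ξ z A) w ≤ d * nsq w := by
    intro w
    have h1 := neg_le_of_abs_le (abs_imForm_le (denomMatrix ξ z A) w)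
    have h2 := mul_le_mul_of_nonneg_right hD (nsq_nonneg w)
    linarith
  have h3 := mul_le_mul_of_nonneg_left (add_le_add (hw u') (hw v')) hδ
  have h4 := mul_le_mul_of_nonneg_right hgain (add_nonneg (nsq_nonneg u') (nsq_nonneg v'))
  have h5 := mul_le_mul_of_nonneg_left (add_le_add (hd u') (hd v')) (mul_nonneg hκ hδ)
  rw [eu, ev] at hR' ⊢
  nlinarith

/-- With G* in place of one factor G the product would be exactly Im G. Replacing G by G* + 2i Im G
leaves the extra term, which keeps Im G from being a fixed point of the linearized map when Im z is
small. -/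
lemma mul_neg_imPart_mul {D : Matrix (Fin N) (Fin N) ℂ} (hDG : D * G = 1) :
    G * (-imPart D) * G = imPart G + (2 * Complex.I) • (imPart G * Dᴴ * imPart G) := by
  have hGD : G * D = 1 := mul_eq_one_comm.1 hDG
  have h1 : Dᴴ * Gᴴ = 1 := by rw [← Matrix.conjTranspose_mul, hGD, Matrix.conjTranspose_one]
  have h2 : Gᴴ * Dᴴ = 1 := by rw [← Matrix.conjTranspose_mul, hDG, Matrix.conjTranspose_one]
  have e1 : (G - Gᴴ) * Dᴴ * (G - Gᴴ) = G * Dᴴ * G - G - G + Gᴴ := by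
    simp only [sub_mul, mul_sub, h2, one_mul]
    rw [mul_assoc G Dᴴ Gᴴ, h1, mul_one]
    abel
  have e2 : G * (D - Dᴴ) * G = G - G * Dᴴ * G := by
    simp only [sub_mul, mul_sub, hGD, one_mul]
  simp only [imPart, Matrix.smul_mul, Matrix.mul_smul, mul_neg, neg_mul, e1, e2, smul_smul]
  rw [show (2 * Complex.I) * ((2 * Complex.I)⁻¹ * (2 * Complex.I)⁻¹) = (2 * Complex.I)⁻¹ by
    rw [mul_inv_cancel_left₀ (by simp)], ← smul_add, ← smul_neg]
  congr 1
  abel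

end Stability

end CorrelatedMatrix

end

noncomputable section

namespace CorrelatedMatrix

open scoped Matrix.Norms.L2Operator

/-! ### Almost saturated domination bounds -/

section Saturation

variable {N K : ℕ} {ξ : Fin N → Fin N → Fin N → Fin N → ℝ} {z : ℂ} {c₀ : ℝ}
  {A G X R : Matrix (Fin N) (Fin N) ℂ}

lemma posDef_imPart_of_le {h : ℝ} (hh : 0 < h) (hG : ∀ u, h * nsq u ≤ imForm G u) :
    (imPart G).PosDef :=
  (posDef_imPart_iff G).2 fun u hu => lt_of_lt_of_le (mul_pos hh (nsq_pos hu)) (hG u)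

/-- If `X` is dominated by `δ Im G`, then its part orthogonal to `Im G` is controlled by the defect
in the trace inequality `|tr X| ≤ δ tr Im G`. -/
lemma Dominated.sum_nsq_sub_le {δ g h : ℝ} (hdom : Dominated G X δ) (hδ : 0 < δ) (hg : 0 < g)
    (hGn : ‖G‖ ≤ g) (hh : 0 < h) (hG : ∀ u, h * nsq u ≤ imForm G u) (ht : 0 < G.trace.im) :
    ∑ l, nsq ((X - (X.trace / G.trace.im) • imPart G) *ᵥ Pi.single l 1) ≤
      g * (δ ^ 2 * G.trace.im - ‖X.trace‖ ^ 2 / G.trace.im) := by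
  set H := imPart G with hH
  set t := G.trace.im with htdef
  set c : ℂ := X.trace / t with hc
  have h0 : ∀ u, 0 ≤ imForm G u := fun u => (mul_nonneg hh.le (nsq_nonneg u)).trans (hG u)
  have hunit : IsUnit H := (posDef_imPart_of_le hh hG).isUnit
  set J := H⁻¹ with hJ
  have hHJ : H * J = 1 := Matrix.mul_nonsing_inv _ ((Matrix.isUnit_iff_isUnit_det _).1 hunit)
  have hJH : J * H = 1 := Matrix.nonsing_inv_mul _ ((Matrix.isUnit_iff_isUnit_det _).1 hunit)
  have hHs : Hᴴ = H := imPart_conjTranspose G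
  have hJs : Jᴴ = J := by rw [hJ, Matrix.conjTranspose_nonsing_inv, hHs]
  -- the quadratic form of `Xᴴ H⁻¹ X`
  have hρ : ∀ v, imForm G (J *ᵥ (X *ᵥ v)) ≤ δ ^ 2 * imForm G v := by
    intro v
    have e1 : sesq X (J *ᵥ (X *ᵥ v)) v = (imForm G (J *ᵥ (X *ᵥ v)) : ℂ) := by
      rw [← sesq_imPart_self, ← hH, sesq, sesq, Matrix.mulVec_mulVec _ H J, hHJ, Matrix.one_mulVec]
    -- The factor δ⁻¹ balances the two terms of the domination bound, which then reads X* H⁻¹ X ≤ δ²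
    -- H.
    have h1 := hdom (((δ⁻¹ : ℝ) : ℂ) • (J *ᵥ (X *ᵥ v))) v
    rw [sesq_smul_left, e1, imForm_smul_vec, norm_mul, Complex.norm_real, Complex.norm_real,
      Real.norm_of_nonneg (h0 _), Real.norm_of_nonneg (by positivity)] at h1
    field_simp at h1
    nlinarith
  have hZ : ∀ v, (imForm G (J *ᵥ ((X - c • H) *ᵥ v)) : ℂ) =
      imForm G (J *ᵥ (X *ᵥ v)) - c * star (sesq X v v) - star c * sesq X v v +
        c * star c * imForm G v := by
    intro v
    have e0 : J *ᵥ ((X - c • H) *ᵥ v) = J *ᵥ (X *ᵥ v) - c • v := by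
      rw [Matrix.sub_mulVec, Matrix.mulVec_sub, Matrix.smul_mulVec, Matrix.mulVec_smul,
        Matrix.mulVec_mulVec _ J H, hJH, Matrix.one_mulVec]
    have e1 : sesq H (J *ᵥ (X *ᵥ v)) v = star (sesq X v v) := by
      rw [sesq, star_mulVec_dotProduct, hJs, Matrix.mulVec_mulVec, hJH, Matrix.one_mulVec, sesq,
        ← Matrix.star_dotProduct]
    have e2 : sesq H v (J *ᵥ (X *ᵥ v)) = sesq X v v := by
      rw [sesq, Matrix.mulVec_mulVec, hHJ, Matrix.one_mulVec, sesq]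
    rw [e0, ← sesq_imPart_self, ← hH, sesq_sub_left, sesq_sub_right, sesq_sub_right,
      sesq_smul_left', sesq_smul_left', sesq_smul_right, sesq_smul_right, e1, e2]
    have e3 : sesq H v v = imForm G v := sesq_imPart_self G v
    have e4 : sesq H (J *ᵥ (X *ᵥ v)) (J *ᵥ (X *ᵥ v)) = imForm G (J *ᵥ (X *ᵥ v)) :=
      sesq_imPart_self G _
    rw [e3, e4]
    ring
  -- Pythagoras for the inner product tr(X* H⁻¹ Y): there ⟨H, X⟩ = tr X and ⟨H, H⟩ = tr H = t, so c
  -- H with c = tr X / t is the projection of X onto H.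
  have hsum : ∑ l, imForm G (J *ᵥ ((X - c • H) *ᵥ Pi.single l 1)) =
      ∑ l, imForm G (J *ᵥ (X *ᵥ Pi.single l 1)) - ‖X.trace‖ ^ 2 / t := by
    have e : ((∑ l, imForm G (J *ᵥ ((X - c • H) *ᵥ Pi.single l 1)) : ℝ) : ℂ) =
        ((∑ l, imForm G (J *ᵥ (X *ᵥ Pi.single l 1)) - ‖X.trace‖ ^ 2 / t : ℝ) : ℂ) := by
      push_cast
      simp only [hZ]
      rw [Finset.sum_add_distrib, Finset.sum_sub_distrib, Finset.sum_sub_distrib,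
        ← Finset.mul_sum, ← Finset.mul_sum, ← Finset.mul_sum, ← star_sum]
      have e1 : ∑ l, sesq X (Pi.single l 1) (Pi.single l 1) = X.trace := by
        simp [sesq_single, Matrix.trace]
      have e2 : ∑ l, (imForm G (Pi.single l 1) : ℂ) = t := by
        rw [htdef, trace_im_eq_sum]; push_cast; rfl
      rw [e1, e2]
      have hcs : star c = star X.trace / t := by
        rw [hc, star_div₀]
        congr 1
        exact Complex.conj_ofReal t
      have hn : X.trace * star X.trace = (‖X.trace‖ : ℂ) ^ 2 := by
        exact_mod_cast Complex.mul_conj' X.trace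
      have ht' : (t : ℂ) ≠ 0 := by exact_mod_cast ht.ne'
      rw [hcs, hc, ← hn]
      field_simp
      ring
    exact_mod_cast e
  have hle : ∀ v, nsq ((X - c • H) *ᵥ v) ≤ g * imForm G (J *ᵥ ((X - c • H) *ᵥ v)) := by
    intro v
    have := nsq_imPart_mulVec_le hg hGn h0 (J *ᵥ ((X - c • H) *ᵥ v))
    rwa [← hH, Matrix.mulVec_mulVec, hHJ, Matrix.one_mulVec] at this
  calc ∑ l, nsq ((X - c • H) *ᵥ Pi.single l 1)
      ≤ ∑ l, g * imForm G (J *ᵥ ((X - c • H) *ᵥ Pi.single l 1)) :=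
        Finset.sum_le_sum fun l _ => hle _
    _ = g * (∑ l, imForm G (J *ᵥ (X *ᵥ Pi.single l 1)) - ‖X.trace‖ ^ 2 / t) := by
        rw [← Finset.mul_sum, hsum]
    _ ≤ g * (δ ^ 2 * t - ‖X.trace‖ ^ 2 / t) := by
        refine mul_le_mul_of_nonneg_left (sub_le_sub_right ?_ _) hg.le
        rw [htdef, trace_im_eq_sum, Finset.mul_sum]
        exact Finset.sum_le_sum fun l _ => hρ _

lemma mul_norm_le_norm_imPart_mulVec {h : ℝ} (hG : ∀ u, h * nsq u ≤ imForm G u)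
    (v : Fin N → ℂ) : h * ‖WithLp.toLp 2 v‖ ≤ ‖WithLp.toLp 2 (imPart G *ᵥ v)‖ := by
  have h1 := hG v
  have h2 : imForm G v ≤ ‖sesq (imPart G) v v‖ := by
    rw [sesq_imPart_self, Complex.norm_real]; exact le_abs_self _
  have h3 := norm_star_dotProduct_le v (imPart G *ᵥ v)
  rw [nsq_eq_norm] at h1
  have h4 : h * ‖WithLp.toLp 2 v‖ ^ 2 ≤
      ‖WithLp.toLp 2 v‖ * ‖WithLp.toLp 2 (imPart G *ᵥ v)‖ := (h1.trans h2).trans h3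
  rcases (norm_nonneg (WithLp.toLp 2 v)).eq_or_lt with h0 | h0
  · rw [← h0]; simp
  · nlinarith

lemma IsSumOfSquares.Xi_imPart (hs : IsSumOfSquares c₀ ξ) (B : Matrix (Fin N) (Fin N) ℂ) :
    Xi ξ (imPart B) = imPart (Xi ξ B) := by
  rw [imPart, Xi_smul, Xi_sub, hs.Xi_conjTranspose, imPart]

lemma imPart_denomMatrix : imPart (denomMatrix ξ z A) = -((z.im : ℂ) • 1) - imPart (Xi ξ A) := by
  rw [denomMatrix, imPart, imPart, Matrix.conjTranspose_sub, Matrix.conjTranspose_neg,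
    Matrix.conjTranspose_smul, Matrix.conjTranspose_one]
  have e3 : (-(z • (1 : Matrix (Fin N) (Fin N) ℂ)) - Xi ξ A - (-(star z • 1) - (Xi ξ A)ᴴ)) =
      -((2 * Complex.I * z.im) • (1 : Matrix (Fin N) (Fin N) ℂ)) - (Xi ξ A - (Xi ξ A)ᴴ) := by
    have : z - star z = 2 * Complex.I * z.im := by
      rw [show star z = (starRingEnd ℂ) z from rfl, Complex.sub_conj]; push_cast; ring
    rw [← this, sub_smul]
    abel
  rw [e3, smul_sub, smul_neg, smul_smul, inv_mul_cancel_left₀ (by simp)]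

/-- The linearized equation with X split into c Im G and a remainder. The amount by which Im G fails
to be fixed must be balanced by the remainder, by Im z, by the error of the approximate solution and
by R. -/
lemma smul_imPart_mul_conjTranspose_mul_imPart (hs : IsSumOfSquares c₀ ξ)
    (hDG : denomMatrix ξ z A * G = 1) (hX : X = G * Xi ξ X * G + R) (c : ℂ) :
    (2 * Complex.I * c) • (imPart G * (denomMatrix ξ z A)ᴴ * imPart G) =
      (X - c • imPart G) + c • (G * ((z.im : ℂ) • 1 + imPart (Xi ξ (A - G))) * G) -
        G * Xi ξ (X - c • imPart G) * G - R := by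
  have e1 := mul_neg_imPart_mul hDG
  have e2 : -imPart (denomMatrix ξ z A) =
      ((z.im : ℂ) • 1 + imPart (Xi ξ (A - G))) + Xi ξ (imPart G) := by
    rw [imPart_denomMatrix, hs.Xi_imPart, Xi_sub]
    simp only [imPart, Matrix.conjTranspose_sub, smul_sub]
    abel
  have e3 : G * Xi ξ X * G = X - R := by conv_rhs => rw [hX]; simp
  rw [Xi_sub X, Xi_smul, mul_sub, sub_mul, e3, Matrix.mul_smul, Matrix.smul_mul]
  rw [e2, mul_add, add_mul] at e1
  have e4 : G * Xi ξ (imPart G) * G = imPart G +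
      (2 * Complex.I) • (imPart G * (denomMatrix ξ z A)ᴴ * imPart G) -
        G * ((z.im : ℂ) • 1 + imPart (Xi ξ (A - G))) * G := by
    rw [← e1]; abel
  rw [e4, smul_sub, smul_add, smul_smul, mul_comm c]
  abel

/-- The identity is applied to one basis vector on which Z is small. The left side cannot be small
there, because Im G is bounded below by h and D* by 1/g. -/
lemma two_mul_norm_mul_le {D Y Z E : Matrix (Fin N) (Fin N) ℂ} {c : ℂ} {g h y ε b r a : ℝ}
    {l : Fin N} (hDG : D * G = 1) (hh : 0 < h) (hg : 0 < g) (hGn : ‖G‖ ≤ g)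
    (hG : ∀ u, h * nsq u ≤ imForm G u) (hy : 0 ≤ y)
    (hident : (2 * Complex.I * c) • (imPart G * Dᴴ * imPart G) =
      Z + c • (G * ((y : ℂ) • 1 + E) * G) - G * Y * G - R)
    (hEn : ‖E‖ ≤ ε) (hY : ‖Y‖ ≤ b) (hR : ‖R‖ ≤ r) (ha : 0 ≤ a)
    (hl : nsq (Z *ᵥ Pi.single l 1) ≤ a ^ 2) :
    2 * ‖c‖ * (h ^ 2 / g) ≤ a + ‖c‖ * (g ^ 2 * (y + ε)) + g ^ 2 * b + r := by
  set H := imPart G with hH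
  set e : Fin N → ℂ := Pi.single l 1 with he
  have hen : ‖WithLp.toLp 2 e‖ = 1 := by
    have := nsq_eq_norm e
    rw [he, nsq_single, ← he] at this
    nlinarith [norm_nonneg (WithLp.toLp 2 e)]
  have hlow : h ^ 2 / g ≤ ‖WithLp.toLp 2 ((H * Dᴴ * H) *ᵥ e)‖ := by
    rw [mul_assoc, ← Matrix.mulVec_mulVec, ← Matrix.mulVec_mulVec]
    have h1 := mul_norm_le_norm_imPart_mulVec hG e
    have h2 := mul_norm_le_norm_imPart_mulVec hG (Dᴴ *ᵥ (H *ᵥ e))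
    have h3 : ‖WithLp.toLp 2 (H *ᵥ e)‖ ≤ g * ‖WithLp.toLp 2 (Dᴴ *ᵥ (H *ᵥ e))‖ := by
      have h4 := norm_mulVec_le Gᴴ (Dᴴ *ᵥ (H *ᵥ e))
      rw [Matrix.mulVec_mulVec _ Gᴴ, ← Matrix.conjTranspose_mul, hDG, Matrix.conjTranspose_one,
        Matrix.one_mulVec, Matrix.l2_opNorm_conjTranspose] at h4
      exact h4.trans (mul_le_mul_of_nonneg_right hGn (norm_nonneg _))
    rw [hen, mul_one] at h1
    refine le_trans ?_ h2
    rw [div_le_iff₀ hg]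
    have := mul_le_mul_of_nonneg_left (h1.trans h3) hh.le
    nlinarith
  have hmul : ∀ B : Matrix (Fin N) (Fin N) ℂ, ‖WithLp.toLp 2 (B *ᵥ e)‖ ≤ ‖B‖ := fun B => by
    simpa [hen] using norm_mulVec_le B e
  have hGBG : ∀ (B : Matrix (Fin N) (Fin N) ℂ) (b : ℝ), ‖B‖ ≤ b → ‖G * B * G‖ ≤ g ^ 2 * b := by
    intro B b hB
    have hb0 := (norm_nonneg B).trans hB
    calc ‖G * B * G‖ ≤ ‖G * B‖ * ‖G‖ := norm_mul_le _ _
      _ ≤ ‖G‖ * ‖B‖ * ‖G‖ := by gcongr; exact norm_mul_le _ _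
      _ ≤ g * b * g := by gcongr
      _ = g ^ 2 * b := by ring
  have hZe : ‖WithLp.toLp 2 (Z *ᵥ e)‖ ≤ a := by
    rw [nsq_eq_norm] at hl
    exact le_of_sq_le_sq hl ha
  have e1 : ‖WithLp.toLp 2 (((2 * Complex.I * c) • (H * Dᴴ * H)) *ᵥ e)‖ =
      2 * ‖c‖ * ‖WithLp.toLp 2 ((H * Dᴴ * H) *ᵥ e)‖ := by
    rw [Matrix.smul_mulVec, WithLp.toLp_smul, norm_smul]
    simp
  have h1 : 2 * ‖c‖ * (h ^ 2 / g) ≤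
      ‖WithLp.toLp 2 (((2 * Complex.I * c) • (H * Dᴴ * H)) *ᵥ e)‖ := by
    rw [e1]; exact mul_le_mul_of_nonneg_left hlow (by positivity)
  refine h1.trans ?_
  rw [hident, Matrix.sub_mulVec, Matrix.sub_mulVec, Matrix.add_mulVec, WithLp.toLp_sub,
    WithLp.toLp_sub, WithLp.toLp_add]
  refine (norm_sub_le _ _).trans (add_le_add ?_ ((hmul R).trans hR))
  refine (norm_sub_le _ _).trans (add_le_add ?_ ((hmul _).trans (hGBG _ _ hY)))
  refine (norm_add_le _ _).trans (add_le_add hZe ((hmul _).trans ?_))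
  rw [norm_smul]
  refine mul_le_mul_of_nonneg_left (hGBG _ _ ?_) (norm_nonneg _)
  refine (norm_add_le _ _).trans (add_le_add ?_ hEn)
  rw [norm_smul, Complex.norm_real, Real.norm_of_nonneg hy]
  exact mul_le_of_le_one_right hy norm_one_le

/-- A nearly saturated domination bound is impossible for approximate solutions of the linearized
equation. -/
lemma Dominated.le_of_saturated (hs : IsSumOfSquares c₀ ξ) (hb : BandedTensor K ξ) (hN : 0 < N)
    (hDG : denomMatrix ξ z A * G = 1) (hz : 0 < z.im) {g h ε r δ σ : ℝ} (hh : 0 < h) (hg : 0 < g)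
    (hGn : ‖G‖ ≤ g) (hG : ∀ u, h * nsq u ≤ imForm G u) (hε : ‖Xi ξ (G - A)‖ ≤ ε)
    (hX : X = G * Xi ξ X * G + R) (hR : ‖R‖ ≤ r) (hδ : 0 < δ) (hdom : Dominated G X δ)
    (hσ0 : 0 ≤ σ) (hσ1 : σ ≤ 1) (htr : (1 - σ ^ 2 / 2) * (δ * G.trace.im) ≤ ‖X.trace‖) :
    δ * (h ^ 2 / g) ≤ δ * (σ * (g + g ^ 3 * (2 * K + 1) ^ 2) + g ^ 2 * (z.im + ε)) + r := by
  have hN' : (0 : ℝ) < N := by exact_mod_cast hN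
  have htN : h * N ≤ G.trace.im := by
    rw [trace_im_eq_sum]
    have : ∑ _i : Fin N, h ≤ ∑ i, imForm G (Pi.single i 1) :=
      Finset.sum_le_sum fun i _ => by simpa [nsq_single] using hG (Pi.single i 1)
    simpa [mul_comm] using this
  have htN' : G.trace.im ≤ g * N := by
    rw [trace_im_eq_sum]
    have : ∑ i, imForm G (Pi.single i 1) ≤ ∑ _i : Fin N, g :=
      Finset.sum_le_sum fun i _ => by
        have := imForm_le G (Pi.single i 1)
        rw [nsq_single, mul_one] at this
        exact this.trans hGn
    simpa [mul_comm] using this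
  have ht : 0 < G.trace.im := lt_of_lt_of_le (by positivity) htN
  have hsum := hdom.sum_nsq_sub_le hδ hg hGn hh hG ht
  have htr2 := hdom.norm_trace_le
  set t := G.trace.im
  set c : ℂ := X.trace / t with hc
  set H := imPart G with hH
  set D := denomMatrix ξ z A with hD
  set Z := X - c • H with hZ
  have hcn : ‖c‖ = ‖X.trace‖ / t := by
    rw [hc, norm_div, Complex.norm_real, Real.norm_of_nonneg ht.le]
  have hc1 : ‖c‖ ≤ δ := by rw [hcn, div_le_iff₀ ht]; exact htr2
  have hc2 : δ / 2 ≤ ‖c‖ := by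
    rw [hcn, le_div_iff₀ ht]
    have hσ2 : σ ^ 2 ≤ 1 := pow_le_one₀ hσ0 hσ1
    have : 1 / 2 * (δ * t) ≤ (1 - σ ^ 2 / 2) * (δ * t) :=
      mul_le_mul_of_nonneg_right (by linarith) (by positivity)
    linarith
  -- Near saturation the projection defect is at most δ² t (1 − (1 − σ²/2)²) ≤ σ² δ² t, and t ≤ g N.
  have hsum2 : ∑ l, nsq (Z *ᵥ Pi.single l 1) ≤ (σ * δ * g) ^ 2 * N := by
    refine hsum.trans ?_
    have h1 : δ ^ 2 * t - ‖X.trace‖ ^ 2 / t ≤ σ ^ 2 * δ ^ 2 * t := by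
      have h2 : ((1 - σ ^ 2 / 2) * (δ * t)) ^ 2 ≤ ‖X.trace‖ ^ 2 :=
        pow_le_pow_left₀ (mul_nonneg (by nlinarith) (by positivity)) htr 2
      have h3 : ((1 - σ ^ 2 / 2) * (δ * t)) ^ 2 / t ≤ ‖X.trace‖ ^ 2 / t :=
        div_le_div_of_nonneg_right h2 ht.le
      have h4 : ((1 - σ ^ 2 / 2) * (δ * t)) ^ 2 / t = (1 - σ ^ 2 / 2) ^ 2 * δ ^ 2 * t := by
        field_simp
      rw [h4] at h3
      nlinarith [mul_nonneg (sq_nonneg (σ ^ 2 / 2)) (mul_nonneg (sq_nonneg δ) ht.le)]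
    calc g * (δ ^ 2 * t - ‖X.trace‖ ^ 2 / t) ≤ g * (σ ^ 2 * δ ^ 2 * (g * N)) := by
          refine mul_le_mul_of_nonneg_left (h1.trans ?_) hg.le
          exact mul_le_mul_of_nonneg_left htN' (by positivity)
      _ = (σ * δ * g) ^ 2 * N := by ring
  -- The Hilbert–Schmidt bound on Z suffices here thanks to the smoothing property of Ξ. The power 3
  -- of 2K + 1 is rounded up to 4 to extract a square root.
  have hXiZ : ‖Xi ξ Z‖ ≤ (2 * K + 1) ^ 2 * (σ * δ * g) := by
    have h1 := hb.norm_Xi_sq_le Z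
    have e : ∑ j, ∑ l, ‖Z j l‖ ^ 2 = ∑ l, nsq (Z *ᵥ Pi.single l 1) := by
      rw [Finset.sum_comm]; simp [nsq]
    rw [e] at h1
    have h2 : N * ‖Xi ξ Z‖ ^ 2 ≤ (2 * K + 1) ^ 3 * ((σ * δ * g) ^ 2 * N) :=
      h1.trans (mul_le_mul_of_nonneg_left hsum2 (by positivity))
    have h3 : ‖Xi ξ Z‖ ^ 2 ≤ (2 * K + 1) ^ 3 * (σ * δ * g) ^ 2 := by
      rw [← mul_le_mul_iff_right₀ hN']; linarith
    have h4 : ((2 * K + 1 : ℝ)) ^ 3 ≤ ((2 * K + 1) ^ 2) ^ 2 := by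
      rw [← pow_mul]
      exact pow_le_pow_right₀ (by linarith [(Nat.cast_nonneg K : (0 : ℝ) ≤ K)]) (by norm_num)
    refine le_of_sq_le_sq ?_ (by positivity)
    rw [mul_pow]
    exact h3.trans (mul_le_mul_of_nonneg_right h4 (sq_nonneg _))
  -- Z itself is small only on average over its columns, so a column not above the average is
  -- selected.
  obtain ⟨l, hl⟩ : ∃ l, nsq (Z *ᵥ Pi.single l 1) ≤ (σ * δ * g) ^ 2 := by
    by_contra! hcon
    have : ∑ _l : Fin N, (σ * δ * g) ^ 2 < ∑ l, nsq (Z *ᵥ Pi.single l 1) := by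
      have : Nonempty (Fin N) := ⟨⟨0, hN⟩⟩
      exact Finset.sum_lt_sum_of_nonempty Finset.univ_nonempty fun l _ => hcon l
    rw [Finset.sum_const, Finset.card_univ, Fintype.card_fin, nsmul_eq_mul] at this
    linarith
  set E := imPart (Xi ξ (A - G)) with hE
  have hEn : ‖E‖ ≤ ε := by
    refine (norm_imPart_le _).trans ?_
    rw [show A - G = -(G - A) by abel, show Xi ξ (-(G - A)) = -Xi ξ (G - A) by
      have := Xi_smul (ξ := ξ) (-1) (G - A); simpa using this, norm_neg]
    exact hε
  have hident : (2 * Complex.I * c) • (H * Dᴴ * H) =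
      Z + c • (G * ((z.im : ℂ) • 1 + E) * G) - G * Xi ξ Z * G - R :=
    smul_imPart_mul_conjTranspose_mul_imPart hs hDG hX c
  have hmain := two_mul_norm_mul_le hDG hh hg hGn hG hz.le hident hEn hXiZ hR
    (by positivity : 0 ≤ σ * δ * g) hl
  have hε0 : 0 ≤ ε := (norm_nonneg _).trans hε
  have h1 : δ * (h ^ 2 / g) ≤ 2 * ‖c‖ * (h ^ 2 / g) :=
    mul_le_mul_of_nonneg_right (by linarith) (by positivity)
  have h2 : ‖c‖ * (g ^ 2 * (z.im + ε)) ≤ δ * (g ^ 2 * (z.im + ε)) :=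
    mul_le_mul_of_nonneg_right hc1 (by positivity)
  linarith

end Saturation

end CorrelatedMatrix

end

noncomputable section

namespace CorrelatedMatrix

open scoped Matrix.Norms.L2Operator

/-! ### Linear stability and passage to the exact solution -/

section Newton

variable {N K : ℕ} {ξ : Fin N → Fin N → Fin N → Fin N → ℝ} {z : ℂ} {c₀ : ℝ}
  {A G : Matrix (Fin N) (Fin N) ℂ}

/-- `G = F(A)` is close to a fixed point of `F`, with bounds on `G`, its inverse and its imaginary
part. -/
structure ApproxSolution (ξ : Fin N → Fin N → Fin N → Fin N → ℝ) (z : ℂ)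
    (A G : Matrix (Fin N) (Fin N) ℂ) (d g h ε : ℝ) : Prop where
  mul_eq_one : denomMatrix ξ z A * G = 1
  norm_denom_le : ‖denomMatrix ξ z A‖ ≤ d
  norm_le : ‖G‖ ≤ g
  le_imForm : ∀ u, h * nsq u ≤ imForm G u
  norm_Xi_le : ‖Xi ξ (G - A)‖ ≤ ε

lemma ApproxSolution.mono {d g h ε ε' : ℝ} (H : ApproxSolution ξ z A G d g h ε) (hε : ε ≤ ε') :
    ApproxSolution ξ z A G d g h ε' :=
  { H with norm_Xi_le := H.norm_Xi_le.trans hε }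

/-- The linearized equation is stable, with constant `C`. -/
def LinearlyStable (ξ : Fin N → Fin N → Fin N → Fin N → ℝ) (G : Matrix (Fin N) (Fin N) ℂ)
    (C : ℝ) : Prop := ∀ X, ‖X‖ ≤ C * ‖X - G * Xi ξ X * G‖

lemma imForm_nonneg_of_le {h : ℝ} (hh : 0 < h) (hG : ∀ u, h * nsq u ≤ imForm G u)
    (u : Fin N → ℂ) : 0 ≤ imForm G u := (mul_nonneg hh.le (nsq_nonneg u)).trans (hG u)

/-- Here Im z alone supplies the gain in `Dominated.improve`, with c₀ = 0. Half of η is reserved for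
the error ε₀, the other half covers κd. -/
theorem exists_linearlyStable_of_im {η d g h : ℝ} (hη : 0 < η) (hd : 0 < d) (hg : 0 < g)
    (hh : 0 < h) : ∃ ε₀ C : ℝ, 0 < ε₀ ∧ 0 < C ∧
      ∀ (N : ℕ) (ξ : Fin N → Fin N → Fin N → Fin N → ℝ) (z : ℂ) (A G : Matrix (Fin N) (Fin N) ℂ),
        IsSumOfSquares 0 ξ → η ≤ z.im → ApproxSolution ξ z A G d g h ε₀ →
          LinearlyStable ξ G C := by
  set κ : ℝ := η / (2 * (d + η)) with hκdef
  have hκ : 0 < κ := by positivity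
  have hκ1 : κ ≤ 1 := by rw [hκdef, div_le_one (by positivity)]; linarith
  have hκd : κ * d ≤ η / 2 := by
    rw [hκdef, div_mul_eq_mul_div, div_le_div_iff₀ (by positivity) (by positivity)]
    nlinarith
  refine ⟨η / 2, 1 / h / κ * g, by positivity, by positivity, fun N ξ z A G hs hz H X => ?_⟩
  have h0 := imForm_nonneg_of_le hh H.le_imForm
  set R := X - G * Xi ξ X * G with hR
  have hX : X = G * Xi ξ X * G + R := by rw [hR]; abel
  have hdom : Dominated G X (‖R‖ / h / κ) := by
    refine Dominated.of_forall_improve hκ hκ1 (by positivity) (fun δ hδ hδX => ?_)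
      (by positivity : 0 ≤ ‖X‖ / h) (dominated_of_le hh H.le_imForm le_rfl) h0
    refine Dominated.improve le_rfl hs H.mul_eq_one hh H.norm_denom_le H.le_imForm H.norm_Xi_le
      hX le_rfl hκ.le hδ hδX ?_
    rw [zero_mul, zero_mul, add_zero, mul_comm]
    exact mul_le_mul_of_nonneg_left (by linarith) hδ
  refine (hdom.norm_le (by positivity) H.norm_le).trans (le_of_eq ?_)
  ring

/-- The constants do not depend on a lower bound for Im z. If Im z ≥ η, it gives the gain; if |tr X|
stays away from δ tr Im G, the c₀-term gives it; in the remaining case `Dominated.le_of_saturated`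
bounds δ by the residual outright. The threshold η is a constant of the proof depending on g and h.
-/
theorem exists_linearlyStable_of_flat (K : ℕ) {c₀ d g h : ℝ} (hc₀ : 0 < c₀) (hd : 0 < d)
    (hg : 0 < g) (hh : 0 < h) : ∃ ε₀ C : ℝ, 0 < ε₀ ∧ 0 < C ∧
      ∀ (N : ℕ) (ξ : Fin N → Fin N → Fin N → Fin N → ℝ) (z : ℂ) (A G : Matrix (Fin N) (Fin N) ℂ),
        0 < N → BandedTensor K ξ → IsSumOfSquares c₀ ξ → 0 < z.im →
          ApproxSolution ξ z A G d g h ε₀ → LinearlyStable ξ G C := by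
  -- B is the coefficient of σ in the saturated estimate. With σB and 2ηg² each at most h²/(4g), the
  -- terms proportional to δ absorb at most half of the lower bound δh²/g.
  set B : ℝ := g + g ^ 3 * (2 * K + 1) ^ 2 with hB
  have hBpos : 0 < B := by positivity
  set σ : ℝ := min 1 (h ^ 2 / (4 * g * B)) with hσdef
  have hσ0 : 0 < σ := lt_min one_pos (by positivity)
  have hσ1 : σ ≤ 1 := min_le_left _ _
  have hσB : σ * B ≤ h ^ 2 / (4 * g) := by
    have : σ ≤ h ^ 2 / (4 * g * B) := min_le_right _ _
    rw [le_div_iff₀ (by positivity)] at this ⊢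
    linarith
  set η : ℝ := h ^ 2 / (8 * g ^ 3) with hηdef
  have hη : 0 < η := by positivity
  have hη2 : g ^ 2 * (2 * η) = h ^ 2 / (4 * g) := by rw [hηdef]; field_simp; ring
  set s : ℝ := σ ^ 2 / 2 with hs
  have hspos : 0 < s := by positivity
  -- μ is at once the admissible error and the guaranteed gain. The first entry serves large Im z.
  -- The second leaves a gain μ from the trace term even after the error μ is subtracted.
  set μ : ℝ := min (η / 2) (c₀ * s * h / 2) with hμdef
  have hμ : 0 < μ := lt_min (by positivity) (by positivity)
  have hμ1 : μ ≤ η / 2 := min_le_left _ _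
  have hμ2 : μ ≤ c₀ * s * h / 2 := min_le_right _ _
  set κ : ℝ := μ / (d + μ) with hκdef
  have hκ : 0 < κ := by positivity
  have hκ1 : κ ≤ 1 := by rw [hκdef, div_le_one (by positivity)]; linarith
  have hκd : κ * d ≤ μ := by
    rw [hκdef, div_mul_eq_mul_div, div_le_iff₀ (by positivity)]
    nlinarith
  -- The sum of the coefficients of ‖R‖ in the improvement step, 1/h, and in the saturated case,
  -- 2g/h², so that one inequality covers all cases.
  set e : ℝ := 1 / h + 2 * g / h ^ 2 with he
  have hepos : 0 < e := by positivity
  refine ⟨μ, e / κ * g, hμ, by positivity, fun N ξ z A G hN hb hss hz H X => ?_⟩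
  have hN' : (0 : ℝ) < N := by exact_mod_cast hN
  have h0 := imForm_nonneg_of_le hh H.le_imForm
  set R := X - G * Xi ξ X * G with hR
  have hX : X = G * Xi ξ X * G + R := by rw [hR]; abel
  have htr : h * N ≤ G.trace.im := by
    rw [trace_im_eq_sum]
    have : ∑ _i : Fin N, h ≤ ∑ i, imForm G (Pi.single i 1) :=
      Finset.sum_le_sum fun i _ => by simpa [nsq_single] using H.le_imForm (Pi.single i 1)
    simpa [mul_comm] using this
  have hle1 : ‖R‖ / h ≤ ‖R‖ * e := by
    rw [he, mul_add, mul_one_div]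
    have : 0 ≤ ‖R‖ * (2 * g / h ^ 2) := by positivity
    linarith
  have hle2 : 2 * g / h ^ 2 * ‖R‖ ≤ ‖R‖ * e := by
    rw [he, mul_add]
    have : 0 ≤ ‖R‖ * (1 / h) := by positivity
    linarith
  have hdom : Dominated G X (‖R‖ * e / κ) := by
    refine Dominated.of_forall_improve hκ hκ1 (by positivity) (fun δ hδ hδX => ?_)
      (by positivity : 0 ≤ ‖X‖ / h) (dominated_of_le hh H.le_imForm le_rfl) h0
    have himprove : κ * d * δ ≤ δ * (z.im - μ) +
        c₀ * (N : ℝ)⁻¹ * (δ * G.trace.im - ‖X.trace‖) →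
        Dominated G X ((1 - κ) * δ + ‖R‖ * e) := fun hgain =>
      (Dominated.improve hc₀.le hss H.mul_eq_one hh H.norm_denom_le H.le_imForm H.norm_Xi_le
        hX le_rfl hκ.le hδ hδX hgain).mono h0 (by linarith)
    have htrX := hδX.norm_trace_le
    have hκδ : κ * d * δ ≤ μ * δ := mul_le_mul_of_nonneg_right hκd hδ
    have hcN : 0 ≤ c₀ * (N : ℝ)⁻¹ := by positivity
    rcases le_or_gt η z.im with hzη | hzη
    · refine himprove ?_
      have h1 : 0 ≤ c₀ * (N : ℝ)⁻¹ * (δ * G.trace.im - ‖X.trace‖) :=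
        mul_nonneg hcN (by linarith)
      have h2 : μ * δ ≤ δ * (z.im - μ) := by
        rw [mul_comm]; exact mul_le_mul_of_nonneg_left (by linarith) hδ
      linarith
    · rcases le_or_gt ‖X.trace‖ ((1 - s) * (δ * G.trace.im)) with hcase | hcase
      · refine himprove ?_
        have h1 : s * (δ * (h * N)) ≤ δ * G.trace.im - ‖X.trace‖ := by
          have : s * (δ * (h * N)) ≤ s * (δ * G.trace.im) := by gcongr
          linarith
        have h2 := mul_le_mul_of_nonneg_left h1 hcN
        have h3 : c₀ * (N : ℝ)⁻¹ * (s * (δ * (h * N))) = δ * (c₀ * s * h) := by field_simp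
        have h4 : μ * δ ≤ δ * (z.im - μ) + δ * (c₀ * s * h) := by
          rw [mul_comm, ← mul_add]; exact mul_le_mul_of_nonneg_left (by linarith) hδ
        linarith
      · rcases hδ.eq_or_lt with hδ0 | hδpos
        · rw [← hδ0] at hδX ⊢
          exact hδX.mono h0 (by simp; positivity)
        have hsat := Dominated.le_of_saturated hss hb hN H.mul_eq_one hz hh hg H.norm_le
          H.le_imForm H.norm_Xi_le hX le_rfl hδpos hδX hσ0.le hσ1 hcase.le
        have h1 : σ * B + g ^ 2 * (z.im + μ) ≤ h ^ 2 / (2 * g) := by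
          have h2 : g ^ 2 * (z.im + μ) ≤ g ^ 2 * (2 * η) := by gcongr; linarith
          have h3 : h ^ 2 / (4 * g) + h ^ 2 / (4 * g) = h ^ 2 / (2 * g) := by field_simp; ring
          linarith
        have h2 : δ * (σ * B + g ^ 2 * (z.im + μ)) ≤ δ * (h ^ 2 / (2 * g)) :=
          mul_le_mul_of_nonneg_left h1 hδ
        have h3 : δ * (h ^ 2 / g) = δ * (h ^ 2 / (2 * g)) + δ * (h ^ 2 / (2 * g)) := by
          field_simp; ring
        have h4 : δ * (h ^ 2 / (2 * g)) ≤ ‖R‖ := by linarith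
        have h5 : δ ≤ 2 * g / h ^ 2 * ‖R‖ := by
          have e1 : δ = 2 * g / h ^ 2 * (δ * (h ^ 2 / (2 * g))) := by field_simp
          rw [e1]
          exact mul_le_mul_of_nonneg_left h4 (by positivity)
        refine hδX.mono h0 ?_
        have h6 : 0 ≤ (1 - κ) * δ := mul_nonneg (by linarith) hδ
        linarith
  refine (hdom.norm_le (by positivity) H.norm_le).trans (le_of_eq ?_)
  ring

/-- Newton's method: a stable approximate solution is close to the exact solution. -/
theorem norm_sub_le_of_linearlyStable {d g h ε C : ℝ} (hb : BandedTensor K ξ)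
    (hs : IsSumOfSquares 0 ξ) (hz : 0 < z.im) (hC : 0 < C)
    (H : ApproxSolution ξ z A G d g h ε) (hT : LinearlyStable ξ G C)
    (hsmall : C * (g * ε) * (1 + 4 * (2 * K + 1) ^ 2 * C * g ^ 2) ≤ 1 / 2)
    (hsmall' : 2 * C * g ^ 2 * ε ≤ h) {M : Matrix (Fin N) (Fin N) ℂ}
    (hM : IsMatrixSolution ξ z M) : ‖M - G‖ ≤ 2 * C * g ^ 2 * ε := by
  have hg : 0 ≤ g := (norm_nonneg _).trans H.norm_le
  have hε : 0 ≤ ε := (norm_nonneg _).trans H.norm_Xi_le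
  -- Twice the bound C g² ε for the first correction, the solution of X − GΞ(X)G = GρG.
  set r : ℝ := 2 * C * g ^ 2 * ε with hr
  have hr0 : 0 ≤ r := by positivity
  set S : ℝ := (2 * K + 1) ^ 2 with hS
  set ρ := Xi ξ (G - A) with hρ
  have hρn : ‖ρ‖ ≤ ε := H.norm_Xi_le
  let T : Matrix (Fin N) (Fin N) ℂ →ₗ[ℂ] Matrix (Fin N) (Fin N) ℂ :=
    { toFun := fun X => X - G * Xi ξ X * G
      map_add' := fun X Y => by rw [Xi_add, mul_add, add_mul]; abel
      map_smul' := fun c X => by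
        simp only [Xi_smul, Matrix.mul_smul, Matrix.smul_mul, smul_sub, RingHom.id_apply] }
  have hTinj : Function.Injective T := by
    rw [← LinearMap.ker_eq_bot, LinearMap.ker_eq_bot']
    intro X hX
    have h1 := hT X
    have h2 : X - G * Xi ξ X * G = 0 := hX
    rw [h2, norm_zero, mul_zero] at h1
    exact norm_le_zero_iff.1 h1
  -- Stability yields injectivity only; finite dimension supplies the inverse.
  have hTsurj : Function.Surjective T := LinearMap.injective_iff_surjective.1 hTinj
  obtain ⟨Tinv, hTinv⟩ := hTsurj.hasRightInverse
  have hbound : ∀ X Y, ‖Tinv X - Tinv Y‖ ≤ C * ‖X - Y‖ := by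
    intro X Y
    refine (hT _).trans (le_of_eq ?_)
    congr 2
    have : T (Tinv X - Tinv Y) = X - Y := by rw [map_sub, hTinv, hTinv]
    exact this
  -- G + X solves the matrix equation exactly when X − G Ξ(X) G = Φ(X). Φ is a constant of size ε,
  -- plus a linear term of size ε, plus a quadratic term.
  let Φ : Matrix (Fin N) (Fin N) ℂ → Matrix (Fin N) (Fin N) ℂ := fun X =>
    G * ρ * G + X * ρ * G + X * Xi ξ X * G
  have hcontr : C * (ε * g + 2 * S * r * g) ≤ 1 / 2 := by
    refine le_trans (le_of_eq ?_) hsmall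
    rw [hr]; ring
  have hXi : ∀ X : Matrix (Fin N) (Fin N) ℂ, ‖Xi ξ X‖ ≤ S * ‖X‖ := hb.norm_Xi_le_norm
  have hΦ : ∀ X Y : Matrix (Fin N) (Fin N) ℂ, ‖X‖ ≤ r → ‖Y‖ ≤ r →
      ‖Φ X - Φ Y‖ ≤ (ε * g + 2 * S * r * g) * ‖X - Y‖ := by
    intro X Y hX hY
    have e : Φ X - Φ Y = ((X - Y) * ρ + (X - Y) * Xi ξ X + Y * Xi ξ (X - Y)) * G := by
      simp only [Φ, Xi_sub, mul_sub, sub_mul, add_mul]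
      abel
    rw [e]
    refine (norm_mul_le _ _).trans ?_
    have h1 : ‖(X - Y) * ρ + (X - Y) * Xi ξ X + Y * Xi ξ (X - Y)‖ ≤
        ‖X - Y‖ * ε + ‖X - Y‖ * (S * r) + r * (S * ‖X - Y‖) := by
      refine (norm_add_le _ _).trans (add_le_add ((norm_add_le _ _).trans (add_le_add ?_ ?_)) ?_)
      · exact (norm_mul_le _ _).trans (mul_le_mul_of_nonneg_left hρn (norm_nonneg _))
      · refine (norm_mul_le _ _).trans (mul_le_mul_of_nonneg_left ((hXi X).trans ?_) (norm_nonneg _))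
        exact mul_le_mul_of_nonneg_left hX (by positivity)
      · exact (norm_mul_le _ _).trans (mul_le_mul hY (hXi _) (norm_nonneg _) hr0)
    calc ‖(X - Y) * ρ + (X - Y) * Xi ξ X + Y * Xi ξ (X - Y)‖ * ‖G‖
        ≤ (‖X - Y‖ * ε + ‖X - Y‖ * (S * r) + r * (S * ‖X - Y‖)) * g :=
          mul_le_mul h1 H.norm_le (norm_nonneg _) (by positivity)
      _ = (ε * g + 2 * S * r * g) * ‖X - Y‖ := by ring
  have hlip : ∀ X Y : Matrix (Fin N) (Fin N) ℂ, ‖X‖ ≤ r → ‖Y‖ ≤ r →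
      ‖Tinv (Φ X) - Tinv (Φ Y)‖ ≤ 1 / 2 * ‖X - Y‖ := by
    intro X Y hX hY
    refine (hbound _ _).trans ((mul_le_mul_of_nonneg_left (hΦ X Y hX hY) hC.le).trans ?_)
    rw [← mul_assoc]
    exact mul_le_mul_of_nonneg_right hcontr (norm_nonneg _)
  have hzero : ‖Tinv (Φ 0)‖ ≤ r / 2 := by
    have h1 : T 0 = 0 := map_zero T
    have h2 : Tinv 0 = 0 := hTinj (by rw [hTinv, h1])
    have h3 := hbound (Φ 0) 0
    rw [h2, sub_zero, sub_zero] at h3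
    refine h3.trans ?_
    have h4 : ‖Φ 0‖ ≤ g * ε * g := by
      simp only [Φ, zero_mul, add_zero]
      calc ‖G * ρ * G‖ ≤ ‖G‖ * ‖ρ‖ * ‖G‖ := (norm_mul_le _ _).trans
            (mul_le_mul_of_nonneg_right (norm_mul_le _ _) (norm_nonneg _))
        _ ≤ g * ε * g := by gcongr <;> exact H.norm_le
    refine (mul_le_mul_of_nonneg_left h4 hC.le).trans (le_of_eq ?_)
    rw [hr]; ring
  have hmaps : Set.MapsTo (fun X => Tinv (Φ X)) (Metric.closedBall 0 r) (Metric.closedBall 0 r) := by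
    intro X hX
    rw [mem_closedBall_zero_iff] at hX ⊢
    have h1 := hlip X 0 hX (by simpa using hr0)
    rw [sub_zero] at h1
    calc ‖Tinv (Φ X)‖ ≤ ‖Tinv (Φ X) - Tinv (Φ 0)‖ + ‖Tinv (Φ 0)‖ := by
          simpa using norm_add_le (Tinv (Φ X) - Tinv (Φ 0)) (Tinv (Φ 0))
      _ ≤ 1 / 2 * r + r / 2 := by gcongr; exact h1.trans (by gcongr)
      _ = r := by ring
  have hcw : ContractingWith (1 / 2) (hmaps.restrict _ _ _) := by
    refine ⟨by norm_num, LipschitzWith.of_dist_le_mul fun X Y => ?_⟩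
    have hX := X.2
    have hY := Y.2
    rw [mem_closedBall_zero_iff] at hX hY
    rw [Subtype.dist_eq, Subtype.dist_eq, dist_eq_norm, dist_eq_norm]
    simpa using hlip X Y hX hY
  obtain ⟨X, hXmem, hXfix, -⟩ := ContractingWith.exists_fixedPoint'
    (Metric.isClosed_closedBall.isComplete) hmaps hcw
    (Metric.mem_closedBall_self hr0) (edist_ne_top _ _)
  rw [mem_closedBall_zero_iff] at hXmem
  have hXeq : X - G * Xi ξ X * G = Φ X := by
    have h1 : Tinv (Φ X) = X := hXfix
    have h2 : T (Tinv (Φ X)) = Φ X := hTinv _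
    rw [h1] at h2
    exact h2
  have hGD : G * denomMatrix ξ z A = 1 := mul_eq_one_comm.1 H.mul_eq_one
  -- The condition r ≤ h keeps the imaginary part of G + X nonnegative, so that uniqueness
  -- identifies G + X with M.
  have hsol : IsMatrixSolution ξ z (G + X) := by
    refine (isMatrixSolution_iff hs hz).2 ⟨fun u => ?_, Matrix.inv_eq_left_inv ?_⟩
    · rw [imForm_add]
      have h1 := H.le_imForm u
      have h2 := neg_le_of_abs_le (abs_imForm_le X u)
      have h3 := mul_le_mul_of_nonneg_right (hXmem.trans hsmall') (nsq_nonneg u)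
      linarith
    · have e1 : denomMatrix ξ z (G + X) = denomMatrix ξ z A - ρ - Xi ξ X := by
        have := denomMatrix_sub (ξ := ξ) (z := z) (G + X) A
        rw [show G + X - A = (G - A) + X by abel, Xi_add, ← hρ] at this
        rw [sub_sub, ← this]; abel
      have e2 : (G + X) * denomMatrix ξ z (G + X) * G = G := by
        rw [e1, mul_assoc, sub_mul, sub_mul, H.mul_eq_one]
        simp only [Φ] at hXeq
        have e3 : (G + X) * (1 - ρ * G - Xi ξ X * G) = G + (X - G * Xi ξ X * G) -
            (G * ρ * G + X * ρ * G + X * Xi ξ X * G) := by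
          simp only [add_mul, mul_sub, mul_one, mul_assoc]
          abel
        rw [e3, hXeq]
        abel
      calc (G + X) * denomMatrix ξ z (G + X)
          = (G + X) * denomMatrix ξ z (G + X) * (G * denomMatrix ξ z A) := by rw [hGD, mul_one]
        _ = 1 := by rw [← mul_assoc, e2, hGD]
  have huniq := (existsUnique_isMatrixSolution hs hz hb).unique hM hsol
  rw [huniq]
  simpa using hXmem

end Newton

end CorrelatedMatrix

end

noncomputable section

namespace CorrelatedMatrix

/-! ### The covariance tensor -/

section Model

variable {N K : ℕ} {Ω : Type*} [MeasurableSpace Ω] {P : Measure Ω} [IsProbabilityMeasure P]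
  {x : UpperIdx N → Ω → ℝ}

lemma posSemidef_covMatrix (hL2 : ∀ a, MemLp (x a) 2 P) : (covMatrix P x).PosSemidef := by
  refine Matrix.PosSemidef.of_dotProduct_mulVec_nonneg ?_ fun v => ?_
  · ext a b
    simp [covMatrix, mul_comm]
  · have hInt : ∀ a b, Integrable (fun ω => x a ω * x b ω) P := fun a b =>
      (hL2 a).integrable_mul (hL2 b)
    have e : star v ⬝ᵥ (covMatrix P x *ᵥ v) = ∫ ω, (∑ a, v a * x a ω) ^ 2 ∂P := by
      have e1 : ∀ ω, (∑ a, v a * x a ω) ^ 2 = ∑ a, ∑ b, v a * (v b * (x a ω * x b ω)) := by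
        intro ω
        rw [sq, Finset.sum_mul_sum]
        exact Finset.sum_congr rfl fun a _ => Finset.sum_congr rfl fun b _ => by ring
      simp only [e1]
      rw [integral_finsetSum _ fun a _ => integrable_finsetSum _ fun b _ =>
        ((hInt a b).const_mul _).const_mul _]
      simp only [dotProduct, Matrix.mulVec, Finset.mul_sum, star_trivial]
      refine Finset.sum_congr rfl fun a _ => ?_
      rw [integral_finsetSum _ fun b _ => ((hInt a b).const_mul _).const_mul _]
      refine Finset.sum_congr rfl fun b _ => ?_
      rw [integral_const_mul, integral_const_mul, covMatrix, Matrix.of_apply]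
      ring
    rw [e]
    exact integral_nonneg fun ω => sq_nonneg _

/-- Rank-one decomposition of Σ − c₀. Each vector is used twice, once on the upper triangle and once
transposed, strictly below the diagonal. Keeping the two copies as separate summands produces the
zeros of ξ in the mixed cases. -/
lemma isSumOfSquares_xi {c₀ : ℝ} (h : (covMatrix P x - c₀ • 1).PosSemidef) :
    IsSumOfSquares c₀ (xi P x) := by
  obtain ⟨m, B, hB⟩ := Matrix.posSemidef_iff_eq_sum_vecMulVec.1 h
  have hcov : ∀ a b, covMatrix P x a b = c₀ * (if a = b then 1 else 0) + ∑ s, B s a * B s b := by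
    intro a b
    have := congrFun (congrFun hB a) b
    rw [Matrix.sub_apply, Matrix.smul_apply, Matrix.one_apply, Matrix.sum_apply] at this
    simp only [Matrix.vecMulVec_apply, star_trivial, smul_eq_mul] at this
    linarith
  refine ⟨Fin m ⊕ Fin m, inferInstance, fun s i j => match s with
    | Sum.inl s => if h : i ≤ j then B s ⟨(i, j), h⟩ else 0
    | Sum.inr s => if h : j < i then B s ⟨(j, i), h.le⟩ else 0, fun i j k l => ?_⟩
  rw [Fintype.sum_sum_type, xi]
  by_cases h1 : i ≤ j <;> by_cases h2 : k ≤ l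
  · simp [h1, h2, not_lt.2 h1, hcov]
  · have : ¬ (i = k ∧ j = l) := fun h => h2 (h.1 ▸ h.2 ▸ h1)
    simp [h1, h2, not_lt.2 h1, this]
  · have : ¬ (i = k ∧ j = l) := fun h => h1 (h.1 ▸ h.2 ▸ h2)
    simp [h1, h2, not_lt.2 h2, this]
  · have e : (j = l ∧ i = k) ↔ (i = k ∧ j = l) := and_comm
    simp [h1, h2, not_le.1 h1, not_le.1 h2, hcov, e]

lemma covMatrix_eq_zero_of_farApart (hL2 : ∀ a, MemLp (x a) 2 P) (hc : ∀ a, ∫ ω, x a ω ∂P = 0)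
    (hdep : KDependent P K x) {a b : UpperIdx N} (h : FarApart K a b) : covMatrix P x a b = 0 := by
  have h1 : IndepFun (x a) (x b) P :=
    (hdep a).comp (φ := id) (ψ := fun f : {b : UpperIdx N // FarApart K a b} → ℝ => f ⟨b, h⟩)
      measurable_id (measurable_pi_apply (⟨b, h⟩ : {b : UpperIdx N // FarApart K a b}))
  rw [covMatrix, Matrix.of_apply]
  have := h1.integral_fun_mul_eq_mul_integral (hL2 a).aestronglyMeasurable
    (hL2 b).aestronglyMeasurable
  rw [this, hc a, zero_mul]

lemma abs_covMatrix_le (hL2 : ∀ a, MemLp (x a) 2 P) (hvar : ∀ a, ∫ ω, (x a ω) ^ 2 ∂P ≤ 1)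
    (a b : UpperIdx N) : |covMatrix P x a b| ≤ 1 := by
  have hInt : Integrable (fun ω => x a ω * x b ω) P := (hL2 a).integrable_mul (hL2 b)
  have ha : Integrable (fun ω => x a ω ^ 2) P := (hL2 a).integrable_sq
  have hb : Integrable (fun ω => x b ω ^ 2) P := (hL2 b).integrable_sq
  rw [covMatrix, Matrix.of_apply]
  calc |∫ ω, x a ω * x b ω ∂P| ≤ ∫ ω, |x a ω * x b ω| ∂P := abs_integral_le_integral_abs
    _ ≤ ∫ ω, (x a ω ^ 2 / 2 + x b ω ^ 2 / 2) ∂P := by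
        refine integral_mono hInt.abs ((ha.div_const 2).add (hb.div_const 2)) fun ω => ?_
        simp only
        rw [abs_mul]
        nlinarith [sq_nonneg (|x a ω| - |x b ω|), sq_abs (x a ω), sq_abs (x b ω)]
    _ = (∫ ω, x a ω ^ 2 ∂P) / 2 + (∫ ω, x b ω ^ 2 ∂P) / 2 := by
        rw [integral_add (ha.div_const 2) (hb.div_const 2), integral_div, integral_div]
    _ ≤ 1 := by linarith [hvar a, hvar b]

lemma bandedTensor_xi (hL2 : ∀ a, MemLp (x a) 2 P) (hc : ∀ a, ∫ ω, x a ω ∂P = 0)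
    (hvar : ∀ a, ∫ ω, (x a ω) ^ 2 ∂P ≤ 1) (hdep : KDependent P K x) :
    BandedTensor K (xi P x) where
  abs_le i j k l := by
    unfold xi
    split_ifs
    · exact abs_covMatrix_le hL2 hvar _ _
    · exact abs_covMatrix_le hL2 hvar _ _
    · simp
  eq_zero i j k l h := by
    unfold xi at h
    split_ifs at h with h1 h2
    · by_contra hcon
      refine h (covMatrix_eq_zero_of_farApart hL2 hc hdep ?_)
      rw [FarApart, lt_max_iff]
      rw [not_and_or, not_le, not_le, abs_idxDiff_comm i k, abs_idxDiff_comm j l] at hcon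
      exact hcon
    · by_contra hcon
      refine h (covMatrix_eq_zero_of_farApart hL2 hc hdep ?_)
      rw [FarApart, lt_max_iff]
      rw [not_and_or, not_le, not_le, abs_idxDiff_comm i k, abs_idxDiff_comm j l] at hcon
      exact hcon.symm
    · exact absurd rfl h

end Model

end CorrelatedMatrix

end

noncomputable section

namespace CorrelatedMatrix

/-! ### Pieces of continuity -/

section Pieces

/-- `[0, 1)` is covered by nondegenerate intervals `I α`, and `ψ` is Lipschitz on the products. -/
structure IsPieces (ψ : UnitIco → UnitIco → ℤ → ℤ → ℝ) {n : ℕ} (I : Fin n → Set UnitIco) : Prop where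
  conn : ∀ α, (I α).OrdConnected
  nontrivial : ∀ α, (I α).Nontrivial
  cover : ∀ θ, ∃ α, θ ∈ I α
  lip : ∀ (α β : Fin n) (k l : ℤ), ∃ L : NNReal,
    LipschitzOnWith L (fun p : UnitIco × UnitIco => ψ p.1 p.2 k l) (I α ×ˢ I β)

lemma PiecewiseLipschitz.exists_isPieces {ψ : UnitIco → UnitIco → ℤ → ℤ → ℝ}
    (h : PiecewiseLipschitz ψ) : ∃ (n : ℕ) (I : Fin n → Set UnitIco), IsPieces ψ I := by
  obtain ⟨n, I, h1, -, h3, h4⟩ := h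
  exact ⟨n, I, fun α => (h1 α).1, fun α => (h1 α).2, fun θ => by
    simpa using (h3.symm ▸ Set.mem_univ θ : θ ∈ ⋃ α, I α), h4⟩

variable {ψ : UnitIco → UnitIco → ℤ → ℤ → ℝ} {n : ℕ} {I : Fin n → Set UnitIco}

/-- All points of `[0, 1)` within `ρ` of `c` belong to `s`. -/
def Inside (s : Set UnitIco) (c ρ : ℝ) : Prop := ∀ y : UnitIco, |(y : ℝ) - c| ≤ ρ → y ∈ s

/-- The margin ρ − r leaves a ball around the supposed discontinuity inside one product of pieces,
where ψ is Lipschitz. -/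
lemma not_nearDiscontinuity (hI : IsPieces ψ I) {α β : Fin n} {θ φ : UnitIco} {r ρ : ℝ}
    (hr : r < ρ) (hθ : Inside (I α) θ ρ) (hφ : Inside (I β) φ ρ) (k l : ℤ) :
    ¬ NearDiscontinuity ψ k l r (θ, φ) := by
  rintro ⟨p', hp', hd⟩
  obtain ⟨L, hL⟩ := hI.lip α β k l
  refine hp' (hL.continuousOn.continuousAt ?_)
  have hball : Metric.ball p' (ρ - r) ⊆ I α ×ˢ I β := by
    intro q hq
    have h1 : dist (θ, φ) q ≤ ρ := by
      have := dist_triangle (θ, φ) p' q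
      have h2 : dist q p' < ρ - r := hq
      rw [dist_comm q p'] at h2
      linarith
    rw [Prod.dist_eq, max_le_iff] at h1
    refine ⟨hθ q.1 ?_, hφ q.2 ?_⟩
    · have := h1.1
      rwa [dist_comm, Subtype.dist_eq, Real.dist_eq] at this
    · have := h1.2
      rwa [dist_comm, Subtype.dist_eq, Real.dist_eq] at this
  exact Filter.mem_of_superset (Metric.ball_mem_nhds p' (by linarith)) hball

/-- This is where nondegeneracy enters: θ may be an end of its piece, but the piece contains an
interval adjoining θ on one side. -/
lemma exists_open_interval_subset (hI : IsPieces ψ I) {α : Fin n} {θ : UnitIco} (hθ : θ ∈ I α)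
    {η : ℝ} (hη : 0 < η) : ∃ a b : ℝ, a < b ∧ 0 ≤ a ∧ b < 1 ∧ |a - θ| < η ∧ |b - θ| < η ∧
      ∀ y : UnitIco, a < y → (y : ℝ) < b → y ∈ I α := by
  obtain ⟨y, hy, hne⟩ := (hI.nontrivial α).exists_ne θ
  have h0 := θ.2.1
  have h1 := θ.2.2
  have h2 := y.2.1
  have h3 := y.2.2
  rcases lt_or_gt_of_ne hne with hlt | hgt
  · have hlt' : (y : ℝ) < θ := hlt
    refine ⟨max y (θ - η / 2), θ, max_lt hlt' (by linarith), le_max_of_le_left h2, h1, ?_,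
      by simpa using hη, fun w hw1 hw2 => ?_⟩
    · rw [abs_lt]
      constructor
      · have := le_max_right (y : ℝ) (θ - η / 2); linarith
      · have : max (y : ℝ) (θ - η / 2) < θ := max_lt hlt' (by linarith)
        linarith
    · refine (hI.conn α).out hy hθ ⟨?_, ?_⟩
      · exact ((le_max_left _ _).trans hw1.le : (y : ℝ) ≤ w)
      · exact (hw2.le : (w : ℝ) ≤ θ)
  · have hgt' : (θ : ℝ) < y := hgt
    refine ⟨θ, min y (θ + η / 2), lt_min hgt' (by linarith), h0, (min_le_left _ _).trans_lt h3,
      by simpa using hη, ?_, fun w hw1 hw2 => ?_⟩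
    · rw [abs_lt]
      constructor
      · have : (θ : ℝ) < min (y : ℝ) (θ + η / 2) := lt_min hgt' (by linarith)
        linarith
      · have := min_le_right (y : ℝ) (θ + η / 2); linarith
    · refine (hI.conn α).out hθ hy ⟨?_, ?_⟩
      · exact (hw1.le : (θ : ℝ) ≤ w)
      · exact (hw2.le.trans (min_le_left _ _) : (w : ℝ) ≤ y)

/-- Any point `(θ, φ)` with `θ ≤ φ` is approximated, from within its piece, by interior points
`θ' < φ'`. -/
lemma exists_inside_near (hI : IsPieces ψ I) {θ φ : UnitIco} (h : θ ≤ φ) {η : ℝ} (hη : 0 < η) :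
    ∃ (α β : Fin n) (θ' φ' ρ : ℝ), θ ∈ I α ∧ φ ∈ I β ∧ 0 < ρ ∧ 0 ≤ θ' ∧ θ' < φ' ∧ φ' < 1 ∧
      |θ' - θ| < η ∧ |φ' - φ| < η ∧ Inside (I α) θ' ρ ∧ Inside (I β) φ' ρ := by
  rcases h.eq_or_lt with rfl | hlt
  · obtain ⟨α, hα⟩ := hI.cover θ
    obtain ⟨a, b, hab, ha0, hb1, haη, hbη, hsub⟩ := exists_open_interval_subset hI hα hη
    rw [abs_lt] at haη hbη
    -- On the diagonal both points must come from the same interval: its trisection points are in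
    -- the right order, and a sixth of its length is left as a margin.
    refine ⟨α, α, (2 * a + b) / 3, (a + 2 * b) / 3, (b - a) / 6, hα, hα, by linarith, by linarith,
      by linarith, by linarith, ?_, ?_, fun y hy => ?_, fun y hy => ?_⟩
    · rw [abs_lt]; constructor <;> linarith
    · rw [abs_lt]; constructor <;> linarith
    · rw [abs_le] at hy; exact hsub y (by linarith) (by linarith)
    · rw [abs_le] at hy; exact hsub y (by linarith) (by linarith)
  · have hlt' : (θ : ℝ) < φ := hlt
    obtain ⟨α, hα⟩ := hI.cover θ
    obtain ⟨β, hβ⟩ := hI.cover φ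
    -- Half the gap between θ and φ keeps the two approximating points in order.
    set η' : ℝ := min η ((φ - θ) / 2) with hη'def
    have hη' : 0 < η' := lt_min hη (by linarith)
    have h1 : η' ≤ η := min_le_left _ _
    have h2 : η' ≤ (φ - θ) / 2 := min_le_right _ _
    obtain ⟨a, b, hab, ha0, hb1, haη, hbη, hsub⟩ := exists_open_interval_subset hI hα hη'
    obtain ⟨a', b', hab', ha0', hb1', haη', hbη', hsub'⟩ := exists_open_interval_subset hI hβ hη'
    rw [abs_lt] at haη hbη haη' hbη'
    set ρ : ℝ := min ((b - a) / 4) ((b' - a') / 4) with hρ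
    have hρ1 : ρ ≤ (b - a) / 4 := min_le_left _ _
    have hρ2 : ρ ≤ (b' - a') / 4 := min_le_right _ _
    refine ⟨α, β, (a + b) / 2, (a' + b') / 2, ρ, hα, hβ,
      lt_min (by linarith) (by linarith), by linarith,
      by linarith, by linarith, ?_, ?_, fun y hy => ?_, fun y hy => ?_⟩
    · rw [abs_lt]; constructor <;> linarith
    · rw [abs_lt]; constructor <;> linarith
    · rw [abs_le] at hy; exact hsub y (by linarith) (by linarith)
    · rw [abs_le] at hy; exact hsub' y (by linarith) (by linarith)

lemma exists_lip_of_finset (hI : IsPieces ψ I) (s : Finset ℤ) : ∃ L : ℝ, 0 < L ∧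
    ∀ α β, ∀ k ∈ s, ∀ l ∈ s, ∀ θ ∈ I α, ∀ φ ∈ I β, ∀ θ' ∈ I α, ∀ φ' ∈ I β,
      |ψ θ φ k l - ψ θ' φ' k l| ≤ L * max |(θ : ℝ) - θ'| |(φ : ℝ) - φ'| := by
  choose L hL using hI.lip
  refine ⟨1 + ∑ α, ∑ β, ∑ k ∈ s, ∑ l ∈ s, (L α β k l : ℝ), by positivity,
    fun α β k hk l hl θ hθ φ hφ θ' hθ' φ' hφ' => ?_⟩
  have h1 := (hL α β k l).dist_le_mul (θ, φ) ⟨hθ, hφ⟩ (θ', φ') ⟨hθ', hφ'⟩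
  rw [Real.dist_eq, Prod.dist_eq] at h1
  refine h1.trans (mul_le_mul_of_nonneg_right ?_ (le_max_of_le_left (abs_nonneg _)))
  have h2 : (L α β k l : ℝ) ≤ ∑ l ∈ s, (L α β k l : ℝ) :=
    Finset.single_le_sum (f := fun l => (L α β k l : ℝ)) (fun _ _ => NNReal.coe_nonneg _) hl
  have h3 : ∑ l ∈ s, (L α β k l : ℝ) ≤ ∑ k ∈ s, ∑ l ∈ s, (L α β k l : ℝ) :=
    Finset.single_le_sum (f := fun k => ∑ l ∈ s, (L α β k l : ℝ)) (fun _ _ => by positivity) hk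
  have h4 : ∑ k ∈ s, ∑ l ∈ s, (L α β k l : ℝ) ≤ ∑ β, ∑ k ∈ s, ∑ l ∈ s, (L α β k l : ℝ) :=
    Finset.single_le_sum (f := fun β => ∑ k ∈ s, ∑ l ∈ s, (L α β k l : ℝ))
      (fun _ _ => by positivity) (Finset.mem_univ β)
  have h5 : ∑ β, ∑ k ∈ s, ∑ l ∈ s, (L α β k l : ℝ) ≤
      ∑ α, ∑ β, ∑ k ∈ s, ∑ l ∈ s, (L α β k l : ℝ) :=
    Finset.single_le_sum (f := fun α => ∑ β, ∑ k ∈ s, ∑ l ∈ s, (L α β k l : ℝ))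
      (fun _ _ => by positivity) (Finset.mem_univ α)
  linarith

variable {K : ℕ} {ξ : ∀ N : ℕ, Fin N → Fin N → Fin N → Fin N → ℝ}

/-- Near a point `(θ, φ)` with `θ ≤ φ` there are blocks of indices on which `ξ` is almost the
translation-invariant tensor given by `ψ(θ, φ, ·, ·)`. -/
lemma exists_block_approx (hI : IsPieces ψ I) (hξ : IsDiscretization K ψ ξ) {θ φ : UnitIco}
    (h : θ ≤ φ) (m : ℕ) {ε : ℝ} (hε : 0 < ε) :
    ∃ (N : ℕ) (i j : Fin m → Fin N), Function.Injective i ∧ Function.Injective j ∧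
      (∀ a a', idxDiff (i a) (i a') = idxDiff a a') ∧ (∀ b b', idxDiff (j b) (j b') = idxDiff b b') ∧
      ∀ a b a' b', |ξ N (i a) (j b) (i a') (j b') - ψ θ φ (idxDiff a a') (idxDiff b b')| ≤ ε := by
  obtain ⟨C, hC⟩ := hξ
  obtain ⟨L, hL0, hL⟩ := exists_lip_of_finset hI (Finset.Icc (-(m : ℤ)) m)
  set η : ℝ := ε / (4 * L) with hηdef
  have hη : 0 < η := by positivity
  obtain ⟨α, β, θ', φ', ρ, hα, hβ, hρ, hθ0, hθφ, hφ1, hθη, hφη, hinθ, hinφ⟩ :=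
    exists_inside_near hI h hη
  -- Within τ of θ′ and φ′ the indices keep a margin ρ/2 inside the pieces, the Lipschitz error
  -- stays small, the first block precedes the second, and the second stays below 1.
  set τ : ℝ := min (min (ρ / 2) η) (min ((φ' - θ') / 2) ((1 - φ') / 2)) with hτdef
  have hτ : 0 < τ := lt_min (lt_min (by linarith) hη) (lt_min (by linarith) (by linarith))
  have hτ1 : τ ≤ ρ / 2 := (min_le_left _ _).trans (min_le_left _ _)
  have hτ2 : τ ≤ η := (min_le_left _ _).trans (min_le_right _ _)
  have hτ3 : τ ≤ (φ' - θ') / 2 := (min_le_right _ _).trans (min_le_left _ _)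
  have hτ4 : τ ≤ (1 - φ') / 2 := (min_le_right _ _).trans (min_le_right _ _)
  -- The first bound makes a block of m grid points shorter than τ and K/N smaller than the
  -- remaining margin; the second makes the discretization error at most ε/2.
  obtain ⟨N, hN⟩ := exists_nat_gt (max ((m + K + 2) / τ) (|C| / (ε / 2)))
  have hN1 : (m + K + 2) / τ < N := (le_max_left _ _).trans_lt hN
  have hN2 : |C| / (ε / 2) < N := (le_max_right _ _).trans_lt hN
  have hNpos : (0 : ℝ) < N := lt_of_le_of_lt (by positivity) hN1
  rw [div_lt_iff₀ hτ] at hN1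
  rw [div_lt_iff₀ (by positivity)] at hN2
  have hφ0 : 0 ≤ φ' := by linarith
  have hfl : ∀ c : ℝ, 0 ≤ c → ((⌊c * N⌋₊ : ℕ) : ℝ) ≤ c * N ∧ c * N < (⌊c * N⌋₊ : ℕ) + 1 :=
    fun c hc => ⟨Nat.floor_le (by positivity), Nat.lt_floor_add_one _⟩
  have hθf := hfl θ' hθ0
  have hφf := hfl φ' hφ0
  set i₀ := ⌊θ' * N⌋₊
  set j₀ := ⌊φ' * N⌋₊
  have hK0 : (0 : ℝ) ≤ K := Nat.cast_nonneg K
  have hm0 : (0 : ℝ) ≤ m := Nat.cast_nonneg m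
  have h1 : φ' * N + (m + K + 2) ≤ N := by nlinarith
  have h2 : θ' * N + (m + K + 2) ≤ φ' * N := by nlinarith
  have hj₀ : j₀ + m < N := by
    have : ((j₀ + m : ℕ) : ℝ) < N := by push_cast; linarith
    exact_mod_cast this
  have hij : i₀ + m ≤ j₀ := by
    have : ((i₀ + m : ℕ) : ℝ) < (j₀ : ℕ) + 1 := by push_cast; linarith
    have : i₀ + m < j₀ + 1 := by exact_mod_cast this
    omega
  have hda : ∀ (c : ℝ) (c₀ : ℕ), (c₀ : ℝ) ≤ c * N → c * N < c₀ + 1 → ∀ a : Fin m,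
      |((c₀ + a : ℕ) : ℝ) / N - c| ≤ τ ∧ ((c₀ + a : ℕ) : ℝ) / N - c ≤ τ := by
    intro c c₀ hc1 hc2 a
    have ha : ((a : ℕ) : ℝ) ≤ m := by exact_mod_cast a.2.le
    have ha0 : (0 : ℝ) ≤ (a : ℕ) := Nat.cast_nonneg _
    have : |((c₀ + a : ℕ) : ℝ) / N - c| ≤ τ := by
      rw [abs_le]
      constructor
      · have : (c - τ) ≤ ((c₀ + a : ℕ) : ℝ) / N := by
          rw [le_div_iff₀ hNpos]; push_cast; nlinarith
        linarith
      · have : ((c₀ + a : ℕ) : ℝ) / N ≤ c + τ := by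
          rw [div_le_iff₀ hNpos]; push_cast; nlinarith
        linarith
    exact ⟨this, (le_abs_self _).trans this⟩
  refine ⟨N, fun a => ⟨i₀ + a, by omega⟩, fun b => ⟨j₀ + b, by omega⟩, ?_, ?_, ?_, ?_, ?_⟩
  · intro a a' haa; simp only [Fin.mk.injEq] at haa; exact Fin.ext (by omega)
  · intro a a' haa; simp only [Fin.mk.injEq] at haa; exact Fin.ext (by omega)
  · intro a a'; simp [idxDiff]
  · intro a a'; simp [idxDiff]
  intro a b a' b'
  set ia : Fin N := ⟨i₀ + a, by omega⟩
  set jb : Fin N := ⟨j₀ + b, by omega⟩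
  set ia' : Fin N := ⟨i₀ + a', by omega⟩
  set jb' : Fin N := ⟨j₀ + b', by omega⟩
  have hdi : idxDiff ia ia' = idxDiff a a' := by simp [idxDiff, ia, ia']
  have hdj : idxDiff jb jb' = idxDiff b b' := by simp [idxDiff, jb, jb']
  have hia : |(gridPt ia : ℝ) - θ'| ≤ τ := (hda θ' i₀ hθf.1 hθf.2 a).1
  have hjb : |(gridPt jb : ℝ) - φ'| ≤ τ := (hda φ' j₀ hφf.1 hφf.2 b).1
  have hin1 : Inside (I α) (gridPt ia) (ρ / 2) := fun y hy => hinθ y (by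
    have := abs_sub_le (y : ℝ) (gridPt ia) θ'; linarith)
  have hin2 : Inside (I β) (gridPt jb) (ρ / 2) := fun y hy => hinφ y (by
    have := abs_sub_le (y : ℝ) (gridPt jb) φ'; linarith)
  have hKN : (K : ℝ) / N < ρ / 2 := by
    rw [div_lt_iff₀ hNpos]
    have : τ * N ≤ ρ / 2 * N := mul_le_mul_of_nonneg_right hτ1 hNpos.le
    linarith
  have hCN : C / N ≤ ε / 2 := by
    rw [div_le_iff₀ hNpos]
    have := le_abs_self C
    linarith
  have hξ1 := hC N ia jb ia' jb' (by simp only [ia, jb, Fin.mk_le_mk]; omega)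
    (by simp only [ia', jb', Fin.mk_le_mk]; omega) (not_nearDiscontinuity hI hKN hin1 hin2 _ _)
  rw [hdi, hdj] at hξ1
  have hmem : ∀ a a' : Fin m, idxDiff a a' ∈ Finset.Icc (-(m : ℤ)) m := by
    intro a a'
    simp only [idxDiff, Finset.mem_Icc]
    omega
  have hψ1 := hL α β _ (hmem a a') _ (hmem b b') (gridPt ia) (hin1 _ (by simp; linarith))
    (gridPt jb) (hin2 _ (by simp; linarith)) θ hα φ hβ
  have hmax : max |(gridPt ia : ℝ) - θ| |(gridPt jb : ℝ) - φ| ≤ 2 * η := by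
    refine max_le ?_ ?_
    · have := abs_sub_le (gridPt ia : ℝ) θ' θ; linarith
    · have := abs_sub_le (gridPt jb : ℝ) φ' φ; linarith
  have hψ2 : L * max |(gridPt ia : ℝ) - θ| |(gridPt jb : ℝ) - φ| ≤ ε / 2 := by
    refine (mul_le_mul_of_nonneg_left hmax hL0.le).trans (le_of_eq ?_)
    rw [hηdef]; field_simp; ring
  have := abs_sub_le (ξ N ia jb ia' jb') (ψ (gridPt ia) (gridPt jb) (idxDiff a a') (idxDiff b b'))
    (ψ θ φ (idxDiff a a') (idxDiff b b'))
  linarith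

end Pieces

end CorrelatedMatrix

end

noncomputable section

namespace CorrelatedMatrix

/-! ### Properties of `ψ` inherited from the discretization -/

section Kernel

variable {ψ : UnitIco → UnitIco → ℤ → ℤ → ℝ} {n : ℕ} {I : Fin n → Set UnitIco}
  {K : ℕ} {ξ : ∀ N : ℕ, Fin N → Fin N → Fin N → Fin N → ℝ}

lemma exists_idxDiff_eq (k l : ℤ) : ∃ (m : ℕ) (a a' b b' : Fin m),
    idxDiff a a' = k ∧ idxDiff b b' = l := by
  refine ⟨k.natAbs + l.natAbs + 1, ⟨(-k).toNat, by omega⟩, ⟨k.toNat, by omega⟩,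
    ⟨(-l).toNat, by omega⟩, ⟨l.toNat, by omega⟩, ?_, ?_⟩ <;>
  · simp only [idxDiff]; omega

/-- Every point is a limit from within its own pieces, so the band structure of ξ passes to ψ even
at discontinuities. Points with θ > φ need the symmetry, as the discretization only concerns the
upper triangle. -/
lemma eq_zero_of_discretization (hI : IsPieces ψ I) (hξ : IsDiscretization K ψ ξ)
    (hb : ∀ N, BandedTensor K (ξ N)) (hswap : ∀ θ φ k l, ψ θ φ k l = ψ φ θ l k)
    (θ φ : UnitIco) {k l : ℤ} (hkl : ¬ (|k| ≤ K ∧ |l| ≤ K)) : ψ θ φ k l = 0 := by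
  have key : ∀ (θ φ : UnitIco) (k l : ℤ), ¬ (|k| ≤ K ∧ |l| ≤ K) → θ ≤ φ → ψ θ φ k l = 0 := by
    intro θ φ k l hkl h
    obtain ⟨m, a, a', b, b', hk, hl⟩ := exists_idxDiff_eq k l
    rw [← abs_nonpos_iff]
    refine le_of_forall_pos_le_add fun ε hε => ?_
    obtain ⟨N, i, j, -, -, hi, hj, happ⟩ := exists_block_approx hI hξ h m hε
    have h1 := happ a b a' b'
    have h2 : ξ N (i a) (j b) (i a') (j b') = 0 := by
      by_contra h0
      have := (hb N).eq_zero _ _ _ _ h0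
      rw [hi, hj, hk, hl] at this
      exact hkl this
    rw [h2, hk, hl, zero_sub, abs_neg] at h1
    linarith
  rcases le_total θ φ with h | h
  · exact key θ φ k l hkl h
  · rw [hswap]
    exact key φ θ l k (fun h' => hkl h'.symm) h

lemma abs_le_one_of_discretization (hI : IsPieces ψ I) (hξ : IsDiscretization K ψ ξ)
    (hb : ∀ N, BandedTensor K (ξ N)) (hswap : ∀ θ φ k l, ψ θ φ k l = ψ φ θ l k)
    (θ φ : UnitIco) (k l : ℤ) : |ψ θ φ k l| ≤ 1 := by
  have key : ∀ (θ φ : UnitIco) (k l : ℤ), θ ≤ φ → |ψ θ φ k l| ≤ 1 := by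
    intro θ φ k l h
    obtain ⟨m, a, a', b, b', hk, hl⟩ := exists_idxDiff_eq k l
    refine le_of_forall_pos_le_add fun ε hε => ?_
    obtain ⟨N, i, j, -, -, hi, hj, happ⟩ := exists_block_approx hI hξ h m hε
    have h1 := happ a b a' b'
    have h2 := (hb N).abs_le (i a) (j b) (i a') (j b')
    rw [hk, hl, abs_sub_comm] at h1
    have h3 := abs_sub_abs_le_abs_sub (ψ θ φ k l) (ξ N (i a) (j b) (i a') (j b'))
    linarith
  rcases le_total θ φ with h | h
  · exact key θ φ k l h
  · rw [hswap]
    exact key φ θ l k h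

/-- The kernel of the operator `Ψ` in Fourier space. -/
def fourierKernel (ψ : UnitIco → UnitIco → ℤ → ℤ → ℝ) (K : ℕ) (θ φ : UnitIco)
    (ζ ζ' : AddCircle (1 : ℝ)) : ℂ :=
  ∑ k ∈ Finset.Icc (-(K : ℤ)) K, ∑ l ∈ Finset.Icc (-(K : ℤ)) K,
    (ψ θ φ k l : ℂ) * (fourier k ζ * fourier (-l) ζ')

lemma sum_Icc_neg (K : ℕ) (f : ℤ → ℂ) :
    ∑ k ∈ Finset.Icc (-(K : ℤ)) K, f (-k) = ∑ k ∈ Finset.Icc (-(K : ℤ)) K, f k :=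
  Finset.sum_nbij' (fun k => -k) (fun k => -k)
    (by intro k hk; simp only [Finset.mem_Icc] at hk ⊢; omega)
    (by intro k hk; simp only [Finset.mem_Icc] at hk ⊢; omega)
    (by simp) (by simp) (by simp)

/-- Conjugation reverses both frequencies, and ψ is invariant under (k, l) ↦ (−k, −l). -/
lemma fourierKernel_im (hneg : ∀ θ φ k l, ψ θ φ k l = ψ θ φ (-k) (-l)) (θ φ : UnitIco)
    (ζ ζ' : AddCircle (1 : ℝ)) : (fourierKernel ψ K θ φ ζ ζ').im = 0 := by
  rw [← Complex.conj_eq_iff_im, fourierKernel, map_sum]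
  rw [← sum_Icc_neg K (fun k => ∑ l ∈ Finset.Icc (-(K : ℤ)) K,
    (ψ θ φ k l : ℂ) * (fourier k ζ * fourier (-l) ζ'))]
  refine Finset.sum_congr rfl fun k _ => ?_
  rw [map_sum, ← sum_Icc_neg K (fun l => (ψ θ φ (-k) l : ℂ) * (fourier (-k) ζ * fourier (-l) ζ'))]
  refine Finset.sum_congr rfl fun l _ => ?_
  rw [map_mul, map_mul, Complex.conj_ofReal, ← fourier_neg, ← fourier_neg, hneg θ φ k l]

lemma fourierKernel_swap (hswap : ∀ θ φ k l, ψ θ φ k l = ψ φ θ l k) (θ φ : UnitIco)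
    (ζ ζ' : AddCircle (1 : ℝ)) :
    fourierKernel ψ K θ φ ζ ζ' = fourierKernel ψ K φ θ (-ζ') (-ζ) := by
  have hf : ∀ (k : ℤ) (x : AddCircle (1 : ℝ)), fourier k (-x) = fourier (-k) x := by
    intro k x
    simp [fourier_apply]
  rw [fourierKernel, fourierKernel, Finset.sum_comm]
  refine Finset.sum_congr rfl fun l _ => Finset.sum_congr rfl fun k _ => ?_
  rw [hswap θ φ, hf, hf, neg_neg, mul_comm (fourier k ζ)]

/-- The number of pairs of elements of `Fin m` with difference `k`. -/
def diffCount (m : ℕ) (k : ℤ) : ℝ := ∑ a : Fin m, ∑ a' : Fin m, if idxDiff a a' = k then 1 else 0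

lemma diffCount_le (m : ℕ) (k : ℤ) : diffCount m k ≤ m := by
  have : ∀ a : Fin m, ∑ a' : Fin m, (if idxDiff a a' = k then (1 : ℝ) else 0) ≤ 1 := by
    intro a
    rw [Finset.sum_boole]
    have : (Finset.univ.filter fun a' : Fin m => idxDiff a a' = k).card ≤ 1 := by
      refine Finset.card_le_one.2 fun b hb c hc => idxDiff_injective a ?_
      rw [(Finset.mem_filter.1 hb).2, (Finset.mem_filter.1 hc).2]
    exact_mod_cast this
  refine (Finset.sum_le_sum fun a _ => this a).trans ?_
  simp

lemma le_diffCount {m : ℕ} {k : ℤ} (hk : |k| ≤ K) : (m : ℝ) - 2 * K ≤ diffCount m k := by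
  have h1 : ∀ a : Fin m, (if K ≤ (a : ℕ) ∧ (a : ℕ) + K < m then (1 : ℝ) else 0) ≤
      ∑ a' : Fin m, if idxDiff a a' = k then 1 else 0 := by
    intro a
    split_ifs with ha
    · rw [abs_le] at hk
      have hmem : ((a : ℕ) + k).toNat < m := by omega
      have : (if idxDiff a ⟨((a : ℕ) + k).toNat, hmem⟩ = k then (1 : ℝ) else 0) ≤
          ∑ a' : Fin m, if idxDiff a a' = k then 1 else 0 :=
        Finset.single_le_sum (f := fun a' => if idxDiff a a' = k then (1 : ℝ) else 0)
          (fun _ _ => by split_ifs <;> norm_num) (Finset.mem_univ _)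
      refine le_trans (le_of_eq ?_) this
      rw [if_pos]
      simp only [idxDiff]
      omega
    · exact Finset.sum_nonneg fun _ _ => by split_ifs <;> norm_num
  refine le_trans ?_ (Finset.sum_le_sum fun a _ => h1 a)
  rw [Finset.sum_boole]
  have h2 : (Finset.Ico K (m - K)).card ≤
      (Finset.univ.filter fun a : Fin m => K ≤ (a : ℕ) ∧ (a : ℕ) + K < m).card := by
    refine Finset.card_le_card_of_surjOn (fun a : Fin m => (a : ℕ)) ?_
    intro b hb
    simp only [Finset.coe_Ico, Set.mem_Ico] at hb
    refine ⟨⟨b, by omega⟩, ?_, rfl⟩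
    simp only [Finset.coe_filter, Finset.mem_univ, true_and, Set.mem_ofPred_eq]
    omega
  rw [Nat.card_Ico] at h2
  have h3 : m ≤ (Finset.univ.filter fun a : Fin m => K ≤ (a : ℕ) ∧ (a : ℕ) + K < m).card + 2 * K := by
    omega
  have h4 : (m : ℝ) ≤ (Finset.univ.filter fun a : Fin m => K ≤ (a : ℕ) ∧ (a : ℕ) + K < m).card +
      2 * K := by exact_mod_cast h3
  linarith

lemma tendsto_diffCount {k : ℤ} (hk : |k| ≤ K) :
    Filter.Tendsto (fun m : ℕ => diffCount m k / m) Filter.atTop (nhds 1) := by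
  have h1 : Filter.Tendsto (fun m : ℕ => 1 - 2 * K * (m : ℝ)⁻¹) Filter.atTop (nhds (1 - 2 * K * 0)) :=
    tendsto_const_nhds.sub (tendsto_const_nhds.mul tendsto_inv_atTop_nhds_zero_nat)
  rw [mul_zero, sub_zero] at h1
  refine tendsto_of_tendsto_of_tendsto_of_le_of_le' h1 tendsto_const_nhds ?_ ?_
  · filter_upwards [Filter.eventually_gt_atTop 0] with m hm
    have hm' : (0 : ℝ) < m := by exact_mod_cast hm
    rw [le_div_iff₀ hm', sub_mul, mul_assoc, inv_mul_cancel₀ hm'.ne']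
    have := le_diffCount (m := m) hk
    linarith
  · filter_upwards [Filter.eventually_gt_atTop 0] with m hm
    have hm' : (0 : ℝ) < m := by exact_mod_cast hm
    rw [div_le_one hm']
    exact diffCount_le m k

lemma sum_idxDiff_eq (m : ℕ) {f : ℤ → ℂ} (hf : ∀ k : ℤ, ¬ |k| ≤ K → f k = 0) :
    ∑ a : Fin m, ∑ a' : Fin m, f (idxDiff a a') =
      ∑ k ∈ Finset.Icc (-(K : ℤ)) K, (diffCount m k : ℂ) * f k := by
  have h1 : ∀ d : ℤ, f d = ∑ k ∈ Finset.Icc (-(K : ℤ)) K, if d = k then f k else 0 := by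
    intro d
    rw [Finset.sum_ite_eq]
    split_ifs with hd
    · rfl
    · refine hf d fun h => hd ?_
      rw [Finset.mem_Icc]; exact abs_le.1 h
  have h2 : ∀ k, (diffCount m k : ℂ) * f k =
      ∑ a : Fin m, ∑ a' : Fin m, if idxDiff a a' = k then f k else 0 := by
    intro k
    rw [diffCount]
    push_cast
    simp only [Finset.sum_mul]
    refine Finset.sum_congr rfl fun a _ => Finset.sum_congr rfl fun a' _ => ?_
    split_ifs <;> simp
  simp only [h2]
  conv_rhs => rw [Finset.sum_comm]
  refine Finset.sum_congr rfl fun a _ => ?_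
  conv_rhs => rw [Finset.sum_comm]
  exact Finset.sum_congr rfl fun a' _ => h1 _

/-- Injectivity of the index maps makes the identity part contribute exactly c₀ ∑ |w|²; the other
summands are squares. -/
lemma IsSumOfSquares.le_re_sum {N m : ℕ} {c₀ : ℝ} {ξ : Fin N → Fin N → Fin N → Fin N → ℝ}
    (h : IsSumOfSquares c₀ ξ) {i j : Fin m → Fin N} (hi : Function.Injective i)
    (hj : Function.Injective j) (w : Fin m → Fin m → ℂ) :
    c₀ * ∑ a, ∑ b, ‖w a b‖ ^ 2 ≤
      (∑ a, ∑ b, ∑ a', ∑ b', (ξ (i a) (j b) (i a') (j b') : ℂ) * (star (w a b) * w a' b')).re := by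
  obtain ⟨S, _, V, hV⟩ := h
  have e1 : ∀ a b, ∑ a', ∑ b', (ξ (i a) (j b) (i a') (j b') : ℂ) * (star (w a b) * w a' b') =
      c₀ * (‖w a b‖ ^ 2 : ℝ) + ∑ s, star ((V s (i a) (j b) : ℂ) * w a b) *
        ∑ a', ∑ b', (V s (i a') (j b') : ℂ) * w a' b' := by
    intro a b
    have e2 : ∀ a' b', (ξ (i a) (j b) (i a') (j b') : ℂ) * (star (w a b) * w a' b') =
        (if a = a' then (if b = b' then c₀ * (star (w a b) * w a' b') else 0) else 0) +
        ∑ s, star ((V s (i a) (j b) : ℂ) * w a b) * ((V s (i a') (j b') : ℂ) * w a' b') := by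
      intro a' b'
      rw [hV]
      push_cast
      rw [add_mul, Finset.sum_mul]
      congr 1
      · simp only [hi.eq_iff, hj.eq_iff]
        split_ifs with h1 h2 h3 h4 <;> first | (exfalso; tauto) | simp_all
      · refine Finset.sum_congr rfl fun s _ => ?_
        simp only [star_mul', RCLike.star_def, Complex.conj_ofReal]
        ring
    simp only [e2, Finset.sum_add_distrib]
    congr 1
    · simp [Complex.conj_mul']
    · have : ∀ a', ∑ b', ∑ s, star ((V s (i a) (j b) : ℂ) * w a b) *
          ((V s (i a') (j b') : ℂ) * w a' b') = ∑ s, ∑ b', star ((V s (i a) (j b) : ℂ) * w a b) *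
          ((V s (i a') (j b') : ℂ) * w a' b') := fun a' => Finset.sum_comm
      simp only [this]
      rw [Finset.sum_comm]
      simp only [Finset.mul_sum]
  simp only [e1, Finset.sum_add_distrib]
  have e3 : ∑ a, ∑ b, ∑ s, star ((V s (i a) (j b) : ℂ) * w a b) *
      ∑ a', ∑ b', (V s (i a') (j b') : ℂ) * w a' b' =
      ((∑ s, ‖∑ a, ∑ b, (V s (i a) (j b) : ℂ) * w a b‖ ^ 2 : ℝ) : ℂ) := by
    have : ∀ a, ∑ b, ∑ s, star ((V s (i a) (j b) : ℂ) * w a b) *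
        ∑ a', ∑ b', (V s (i a') (j b') : ℂ) * w a' b' = ∑ s, ∑ b, star ((V s (i a) (j b) : ℂ) * w a b) *
        ∑ a', ∑ b', (V s (i a') (j b') : ℂ) * w a' b' := fun a => Finset.sum_comm
    simp only [this]
    rw [Finset.sum_comm]
    push_cast
    refine Finset.sum_congr rfl fun s _ => ?_
    simp only [← Finset.sum_mul, ← star_sum]
    exact Complex.conj_mul' _
  rw [e3, Complex.add_re, Complex.ofReal_re]
  have e4 : (∑ a, ∑ b, (c₀ : ℂ) * ((‖w a b‖ ^ 2 : ℝ) : ℂ)) = ((c₀ * ∑ a, ∑ b, ‖w a b‖ ^ 2 : ℝ) : ℂ) := by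
    push_cast
    simp only [Finset.mul_sum]
  rw [e4, Complex.ofReal_re]
  have : 0 ≤ ∑ s, ‖∑ a, ∑ b, (V s (i a) (j b) : ℂ) * w a b‖ ^ 2 := by positivity
  linarith

lemma norm_fourier_apply (k : ℤ) (ζ : AddCircle (1 : ℝ)) : ‖fourier k ζ‖ = 1 := by
  rw [fourier_apply]; exact Circle.norm_coe _

/-- The covariance is tested with plane waves of frequencies ζ and −ζ′ on an m × m block where ξ is
almost translation invariant. The form then approaches the Fourier sum of ψ with Fejér weights, and
is at least c₀ m². Dividing by m² and letting m grow turns the weights into 1, the sum being finite.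
-/
lemma le_fourierKernel_re {c₀ : ℝ} (hI : IsPieces ψ I) (hξ : IsDiscretization K ψ ξ)
    (hb : ∀ N, BandedTensor K (ξ N)) (hs : ∀ N, IsSumOfSquares c₀ (ξ N))
    (hswap : ∀ θ φ k l, ψ θ φ k l = ψ φ θ l k) (θ φ : UnitIco) (ζ ζ' : AddCircle (1 : ℝ)) :
    c₀ ≤ (fourierKernel ψ K θ φ ζ ζ').re := by
  have key : ∀ (θ φ : UnitIco) (ζ ζ' : AddCircle (1 : ℝ)), θ ≤ φ →
      c₀ ≤ (fourierKernel ψ K θ φ ζ ζ').re := by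
    intro θ φ ζ ζ' hle
    set f : ℤ → ℤ → ℂ := fun k l => (ψ θ φ k l : ℂ) * (fourier k ζ * fourier (-l) ζ') with hf
    have hf0 : ∀ k l : ℤ, ¬ (|k| ≤ K ∧ |l| ≤ K) → f k l = 0 := by
      intro k l hkl
      simp [hf, eq_zero_of_discretization hI hξ hb hswap θ φ hkl]
    -- averaging over blocks of size `m`
    have hblock : ∀ m : ℕ, c₀ * (m * m) ≤
        (∑ a : Fin m, ∑ b : Fin m, ∑ a' : Fin m, ∑ b' : Fin m,
          f (idxDiff a a') (idxDiff b b')).re := by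
      intro m
      refine le_of_forall_pos_le_add fun ε hε => ?_
      have hε' : 0 < ε / ((m : ℝ) ^ 4 + 1) := by positivity
      obtain ⟨N, i, j, hi, hj, hdi, hdj, happ⟩ := exists_block_approx hI hξ hle m hε'
      set w : Fin m → Fin m → ℂ := fun a b => fourier (a : ℕ) ζ * fourier (-((b : ℕ) : ℤ)) ζ' with hw
      have h1 := (hs N).le_re_sum hi hj w
      have hwn : ∀ a b, ‖w a b‖ = 1 := fun a b => by
        simp only [hw, norm_mul, norm_fourier_apply, mul_one]
      have hww : ∀ a b a' b', star (w a b) * w a' b' =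
          fourier (idxDiff a a') ζ * fourier (-idxDiff b b') ζ' := by
        intro a b a' b'
        simp only [hw, star_mul', RCLike.star_def, ← fourier_neg, idxDiff]
        rw [show ((a' : ℕ) : ℤ) - ((a : ℕ) : ℤ) = -((a : ℕ) : ℤ) + ((a' : ℕ) : ℤ) by ring,
          show -(((b' : ℕ) : ℤ) - ((b : ℕ) : ℤ)) = - -((b : ℕ) : ℤ) + -((b' : ℕ) : ℤ) by ring,
          fourier_add, fourier_add]
        ring
      have hcard : ∑ a : Fin m, ∑ b : Fin m, ‖w a b‖ ^ 2 = m * m := by simp [hwn]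
      rw [hcard] at h1
      have h2 : ‖(∑ a, ∑ b, ∑ a', ∑ b', (ξ N (i a) (j b) (i a') (j b') : ℂ) *
          (star (w a b) * w a' b')) - ∑ a : Fin m, ∑ b : Fin m, ∑ a' : Fin m, ∑ b' : Fin m,
          f (idxDiff a a') (idxDiff b b')‖ ≤ m ^ 4 * (ε / ((m : ℝ) ^ 4 + 1)) := by
        simp only [← Finset.sum_sub_distrib]
        have h3 : ∀ a b a' b', ‖(ξ N (i a) (j b) (i a') (j b') : ℂ) *
            (star (w a b) * w a' b') - f (idxDiff a a') (idxDiff b b')‖ ≤ ε / ((m : ℝ) ^ 4 + 1) := by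
          intro a b a' b'
          simp only [hf, hww]
          rw [← sub_mul, norm_mul, norm_mul, norm_fourier_apply, norm_fourier_apply, mul_one,
            mul_one, ← Complex.ofReal_sub, Complex.norm_real]
          exact happ a b a' b'
        refine (norm_sum_le_of_le _ fun a _ => norm_sum_le_of_le _ fun b _ =>
          norm_sum_le_of_le _ fun a' _ => norm_sum_le_of_le _ fun b' _ => h3 a b a' b').trans
          (le_of_eq ?_)
        simp
        ring
      have h3 := (Complex.abs_re_le_norm _).trans h2
      rw [Complex.sub_re] at h3
      have h4 := le_of_abs_le h3
      have h5 : (m : ℝ) ^ 4 * (ε / ((m : ℝ) ^ 4 + 1)) ≤ ε := by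
        rw [← mul_div_assoc, div_le_iff₀ (by positivity)]
        nlinarith
      linarith
    have hsum : ∀ m : ℕ, (∑ a : Fin m, ∑ b : Fin m, ∑ a' : Fin m, ∑ b' : Fin m,
        f (idxDiff a a') (idxDiff b b')) = ∑ k ∈ Finset.Icc (-(K : ℤ)) K,
          ∑ l ∈ Finset.Icc (-(K : ℤ)) K, (diffCount m k : ℂ) * ((diffCount m l : ℂ) * f k l) := by
      intro m
      have e1 : ∀ a : Fin m, ∑ b : Fin m, ∑ a' : Fin m, ∑ b' : Fin m,
          f (idxDiff a a') (idxDiff b b') = ∑ a' : Fin m, ∑ l ∈ Finset.Icc (-(K : ℤ)) K,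
            (diffCount m l : ℂ) * f (idxDiff a a') l := by
        intro a
        rw [Finset.sum_comm]
        refine Finset.sum_congr rfl fun a' _ => ?_
        exact sum_idxDiff_eq m fun l hl => hf0 _ _ fun h => hl h.2
      simp only [e1]
      rw [sum_idxDiff_eq (K := K) m (f := fun k => ∑ l ∈ Finset.Icc (-(K : ℤ)) K,
        (diffCount m l : ℂ) * f k l)]
      · simp only [Finset.mul_sum]
      · intro k hk
        exact Finset.sum_eq_zero fun l _ => by rw [hf0 k l fun h => hk h.1, mul_zero]
    have hlim : Filter.Tendsto (fun m : ℕ => (∑ k ∈ Finset.Icc (-(K : ℤ)) K,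
        ∑ l ∈ Finset.Icc (-(K : ℤ)) K,
          ((diffCount m k / m : ℝ) : ℂ) * (((diffCount m l / m : ℝ) : ℂ) * f k l)).re)
        Filter.atTop (nhds (fourierKernel ψ K θ φ ζ ζ').re) := by
      refine (Complex.continuous_re.tendsto _).comp ?_
      have e : fourierKernel ψ K θ φ ζ ζ' = ∑ k ∈ Finset.Icc (-(K : ℤ)) K,
        ∑ l ∈ Finset.Icc (-(K : ℤ)) K, f k l := rfl
      rw [e]
      refine tendsto_finsetSum _ fun k hk => tendsto_finsetSum _ fun l hl => ?_
      have hk' := tendsto_diffCount (abs_le.2 (Finset.mem_Icc.1 hk))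
      have hl' := tendsto_diffCount (abs_le.2 (Finset.mem_Icc.1 hl))
      have hc := Complex.continuous_ofReal.tendsto (1 : ℝ)
      have := (hc.comp hk').mul ((hc.comp hl').mul_const (f k l))
      simpa using this
    refine ge_of_tendsto hlim ?_
    filter_upwards [Filter.eventually_gt_atTop 0] with m hm
    have hm' : (0 : ℝ) < m := by exact_mod_cast hm
    have h1 := hblock m
    rw [hsum] at h1
    have e : (∑ k ∈ Finset.Icc (-(K : ℤ)) K, ∑ l ∈ Finset.Icc (-(K : ℤ)) K,
        ((diffCount m k / m : ℝ) : ℂ) * (((diffCount m l / m : ℝ) : ℂ) * f k l)) =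
        (((m : ℝ) * m)⁻¹ : ℝ) * ∑ k ∈ Finset.Icc (-(K : ℤ)) K, ∑ l ∈ Finset.Icc (-(K : ℤ)) K,
          (diffCount m k : ℂ) * ((diffCount m l : ℂ) * f k l) := by
      simp only [Finset.mul_sum]
      refine Finset.sum_congr rfl fun k _ => Finset.sum_congr rfl fun l _ => ?_
      push_cast
      field_simp
    rw [e, Complex.re_ofReal_mul, inv_mul_eq_div, le_div_iff₀ (by positivity)]
    exact h1
  rcases le_total θ φ with h | h
  · exact key θ φ ζ ζ' h
  · rw [fourierKernel_swap hswap]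
    exact key φ θ _ _ h

end Kernel

end CorrelatedMatrix

end

noncomputable section

namespace CorrelatedMatrix

/-! ### Fourier series on the circle -/

section Fourier

local notation "haar" => (AddCircle.haarAddCircle : Measure (AddCircle (1 : ℝ)))

variable {g : AddCircle (1 : ℝ) → ℂ} {C : ℝ}

lemma Continuous.integrable_haar {E : Type*} [NormedAddCommGroup E] {g : AddCircle (1 : ℝ) → E}
    (hg : Continuous g) : Integrable g haar :=
  hg.integrable_of_hasCompactSupport (HasCompactSupport.of_compactSpace g)

lemma Continuous.memLp_haar (hg : Continuous g) : MemLp g 2 haar :=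
  hg.memLp_of_hasCompactSupport (HasCompactSupport.of_compactSpace g)

lemma norm_fourierCoeff_le (hC : ∀ ζ, ‖g ζ‖ ≤ C) (k : ℤ) : ‖fourierCoeff g k‖ ≤ C := by
  have h := norm_integral_le_of_norm_le_const (μ := haar) (f := fun t => fourier (-k) t • g t)
    (C := C) (Filter.Eventually.of_forall fun t => by
      rw [norm_smul, norm_fourier_apply, one_mul]; exact hC t)
  rw [probReal_univ, mul_one] at h
  exact h

lemma fourierCoeff_sub {f g : AddCircle (1 : ℝ) → ℂ} (hf : Continuous f) (hg : Continuous g)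
    (k : ℤ) : fourierCoeff (fun t => f t - g t) k = fourierCoeff f k - fourierCoeff g k := by
  rw [fourierCoeff, fourierCoeff, fourierCoeff, ← integral_sub]
  · simp only [smul_eq_mul, mul_sub]
  · exact Continuous.integrable_haar (by fun_prop)
  · exact Continuous.integrable_haar (by fun_prop)

lemma sum_sq_fourierCoeff_le (hg : Continuous g) (hC : ∀ ζ, ‖g ζ‖ ≤ C) (s : Finset ℤ) :
    ∑ k ∈ s, ‖fourierCoeff g k‖ ^ 2 ≤ C ^ 2 := by
  set G : Lp ℂ 2 haar := (Continuous.memLp_haar hg).toLp with hG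
  have hae : (G : AddCircle (1 : ℝ) → ℂ) =ᵐ[haar] g := MemLp.coeFn_toLp _
  have h1 := hasSum_sq_fourierCoeff G
  rw [fourierCoeff_congr_ae hae] at h1
  refine (sum_le_hasSum s (fun _ _ => by positivity) h1).trans ?_
  have h2 : ∫ t, ‖G t‖ ^ 2 ∂haar = ∫ t, ‖g t‖ ^ 2 ∂haar :=
    integral_congr_ae (hae.mono fun t ht => by simp only [ht])
  rw [h2]
  have hi : Integrable (fun t => ‖g t‖ ^ 2) haar := Continuous.integrable_haar (by fun_prop)
  refine (integral_mono hi (integrable_const (C ^ 2)) fun t =>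
    pow_le_pow_left₀ (norm_nonneg _) (hC t) 2).trans ?_
  simp

/-- Fourier coefficients turn products into convolutions. -/
lemma fourierCoeff_mul (hg : Continuous g) (f : Lp ℂ 2 haar) (n : ℤ) :
    fourierCoeff (fun t => g t * f t) n = conv (fourierCoeff g) (fourierCoeff f) n := by
  set G : Lp ℂ 2 haar := (Continuous.memLp_haar hg).toLp with hG
  have hGae : (G : AddCircle (1 : ℝ) → ℂ) =ᵐ[haar] g := MemLp.coeFn_toLp _
  -- Parseval is applied to conj(f e₋ₙ) and g: the inner product is the coefficient of the product,
  -- and its expansion in the Fourier basis is the convolution.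
  have hXm : MemLp (fun t => star (f t * fourier (-n) t)) 2 haar := by
    refine MemLp.star ?_
    refine (Lp.memLp f).of_le_mul (c := 1) ?_ ?_
    · exact (Lp.aestronglyMeasurable f).mul (by fun_prop : Continuous _).aestronglyMeasurable
    · exact Filter.Eventually.of_forall fun t => by
        rw [norm_mul, norm_fourier_apply, mul_one, one_mul]
  set X : Lp ℂ 2 haar := hXm.toLp with hX
  have hXae : (X : AddCircle (1 : ℝ) → ℂ) =ᵐ[haar] fun t => star (f t * fourier (-n) t) :=
    MemLp.coeFn_toLp _
  have h := (fourierBasis (T := (1 : ℝ))).tsum_inner_mul_inner X G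
  have e1 : inner ℂ X G = fourierCoeff (fun t => g t * f t) n := by
    rw [L2.inner_def, fourierCoeff]
    refine integral_congr_ae ?_
    filter_upwards [hXae, hGae] with t h1 h2
    rw [h1, h2, RCLike.inner_apply, RCLike.star_def, Complex.conj_conj, smul_eq_mul]
    ring
  have e2 : ∀ k, inner ℂ (fourierBasis (T := (1 : ℝ)) k) G = fourierCoeff g k := by
    intro k
    rw [← HilbertBasis.repr_apply_apply, fourierBasis_repr, fourierCoeff_congr_ae hGae]
  have e3 : ∀ k, inner ℂ X (fourierBasis (T := (1 : ℝ)) k) = fourierCoeff f (n - k) := by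
    intro k
    rw [L2.inner_def, fourierCoeff, coe_fourierBasis]
    refine integral_congr_ae ?_
    filter_upwards [hXae, coeFn_fourierLp (T := (1 : ℝ)) 2 k] with t h1 h2
    rw [h1, h2, RCLike.inner_apply, RCLike.star_def, Complex.conj_conj, smul_eq_mul,
      show -(n - k) = k + -n by ring, fourier_add]
    ring
  rw [← e1, ← h, conv]
  exact tsum_congr fun k => by rw [e2, e3, mul_comm]

/-- On the Fourier side the convolution is multiplication by g, whose norm on L² is at most sup |g|.
-/
lemma convBoundedBy_fourierCoeff (hg : Continuous g) (hC : ∀ ζ, ‖g ζ‖ ≤ C) :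
    ConvBoundedBy (fourierCoeff g) C := by
  intro f
  set b := fourierBasis (T := (1 : ℝ))
  set φ : Lp ℂ 2 haar := b.repr.symm f with hφ
  have hm : MemLp (fun t => g t * φ t) 2 haar := by
    refine (Lp.memLp φ).of_le_mul (c := C) ?_ ?_
    · exact hg.aestronglyMeasurable.mul (Lp.aestronglyMeasurable φ)
    · exact Filter.Eventually.of_forall fun t => by
        rw [norm_mul]; exact mul_le_mul_of_nonneg_right (hC t) (norm_nonneg _)
  have hae : (hm.toLp : AddCircle (1 : ℝ) → ℂ) =ᵐ[haar] fun t => g t * φ t := MemLp.coeFn_toLp _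
  refine ⟨b.repr hm.toLp, ?_, ?_⟩
  · funext n
    rw [fourierBasis_repr, fourierCoeff_congr_ae hae, fourierCoeff_mul hg]
    congr 1
    funext k
    rw [← fourierBasis_repr, hφ, LinearIsometryEquiv.apply_symm_apply]
  · rw [LinearIsometryEquiv.norm_map]
    have : ‖f‖ = ‖φ‖ := by rw [hφ, LinearIsometryEquiv.norm_map]
    rw [this]
    refine Lp.norm_le_mul_norm_of_ae_le_mul ?_
    filter_upwards [hae] with t ht
    rw [ht, norm_mul]
    exact mul_le_mul_of_nonneg_right (hC t) (norm_nonneg _)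

lemma ConvBoundedBy.memK {a : ℤ → ℂ} (h : ConvBoundedBy a C) : MemK a := by
  intro f hf
  obtain ⟨g, hg, -⟩ := h ⟨f, hf⟩
  have := lp.memℓp g
  rw [hg] at this
  exact this

lemma memK_fourierCoeff (hg : Continuous g) : MemK (fourierCoeff g) := by
  obtain ⟨C, hC⟩ := (isCompact_range hg).isBounded.exists_norm_le
  exact (convBoundedBy_fourierCoeff (C := C) hg fun ζ => hC _ ⟨ζ, rfl⟩).memK

lemma invFourier_fourierCoeff (hg : Continuous g) :
    (invFourier (fourierCoeff g) : AddCircle (1 : ℝ) → ℂ) =ᵐ[haar] g := by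
  set G : Lp ℂ 2 haar := (Continuous.memLp_haar hg).toLp with hG
  have hae : (G : AddCircle (1 : ℝ) → ℂ) =ᵐ[haar] g := MemLp.coeFn_toLp _
  have h1 : ((fourierBasis (T := (1 : ℝ))).repr G : ℤ → ℂ) = fourierCoeff g := by
    funext k
    rw [fourierBasis_repr, fourierCoeff_congr_ae hae]
  have h2 : Memℓp (fourierCoeff g) 2 := h1 ▸ lp.memℓp _
  rw [invFourier, dif_pos h2]
  have h3 : (⟨fourierCoeff g, h2⟩ : lp (fun _ : ℤ => ℂ) 2) = (fourierBasis (T := (1 : ℝ))).repr G :=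
    Subtype.ext h1.symm
  rw [h3, LinearIsometryEquiv.symm_apply_apply]
  exact hae

lemma fourierCoeff_invFourier {a : ℤ → ℂ} (ha : Memℓp a 2) : fourierCoeff (invFourier a) = a := by
  funext k
  rw [← fourierBasis_repr, invFourier, dif_pos ha, LinearIsometryEquiv.apply_symm_apply]

lemma fourierCoeff_injective_ae {f : Lp ℂ 2 haar} (hg : Continuous g)
    (h : fourierCoeff f = fourierCoeff g) : (f : AddCircle (1 : ℝ) → ℂ) =ᵐ[haar] g := by
  set G : Lp ℂ 2 haar := (Continuous.memLp_haar hg).toLp with hG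
  have hae : (G : AddCircle (1 : ℝ) → ℂ) =ᵐ[haar] g := MemLp.coeFn_toLp _
  have : f = G := by
    apply (fourierBasis (T := (1 : ℝ))).repr.injective
    ext k
    rw [fourierBasis_repr, fourierBasis_repr, fourierCoeff_congr_ae hae, h]
  rw [this]; exact hae

lemma conv_convOne (a : ℤ → ℂ) : conv a convOne = a := by
  funext n
  rw [conv, tsum_eq_single n]
  · simp [convOne]
  · intro k hk
    rw [convOne, Pi.single_eq_of_ne (sub_ne_zero.2 (Ne.symm hk)), mul_zero]

lemma memℓp_convOne : Memℓp convOne 2 := by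
  have := lp.memℓp (lp.single (E := fun _ : ℤ => ℂ) 2 0 (1 : ℂ))
  rw [lp.coeFn_single] at this
  exact this

lemma norm_convOne : ‖(⟨convOne, memℓp_convOne⟩ : lp (fun _ : ℤ => ℂ) 2)‖ = 1 := by
  have h : (⟨convOne, memℓp_convOne⟩ : lp (fun _ : ℤ => ℂ) 2) = lp.single 2 0 (1 : ℂ) := by
    apply Subtype.ext
    rw [lp.coeFn_single]
    rfl
  rw [h, lp.norm_single (by norm_num)]
  simp

lemma MemK.memℓp {a : ℤ → ℂ} (h : MemK a) : Memℓp a 2 := by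
  have := h convOne memℓp_convOne
  rwa [conv_convOne] at this

/-- Convolving with the unit sequence returns the sequence itself, so the operator norm bounds its
ℓ² norm and a fortiori each coefficient. -/
lemma ConvBoundedBy.norm_le {a : ℤ → ℂ} (h : ConvBoundedBy a C) (k : ℤ) : ‖a k‖ ≤ C := by
  obtain ⟨g, hg, hn⟩ := h ⟨convOne, memℓp_convOne⟩
  rw [norm_convOne, mul_one] at hn
  have h1 : (g : ℤ → ℂ) = a := by rw [hg]; exact conv_convOne a
  rw [← h1]
  exact (lp.norm_apply_le_norm (by norm_num) g k).trans hn

/-- The trigonometric polynomial `∑_{|k| ≤ K} c(k) e^{2πikζ}`. -/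
def trigPoly (K : ℕ) (c : ℤ → ℂ) (ζ : AddCircle (1 : ℝ)) : ℂ :=
  ∑ k ∈ Finset.Icc (-(K : ℤ)) K, c k * fourier k ζ

lemma continuous_trigPoly (K : ℕ) (c : ℤ → ℂ) : Continuous (trigPoly K c) := by
  unfold trigPoly; fun_prop

lemma trigPoly_sub (K : ℕ) (c d : ℤ → ℂ) (ζ : AddCircle (1 : ℝ)) :
    trigPoly K c ζ - trigPoly K d ζ = trigPoly K (c - d) ζ := by
  simp only [trigPoly, ← Finset.sum_sub_distrib, Pi.sub_apply, sub_mul]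

lemma card_Icc_neg (K : ℕ) : ((Finset.Icc (-(K : ℤ)) K).card : ℝ) = 2 * K + 1 := by
  rw [Int.card_Icc, show ((K : ℤ) + 1 - -(K : ℤ)).toNat = 2 * K + 1 by omega]
  push_cast; ring

lemma norm_trigPoly_le (K : ℕ) {c : ℤ → ℂ} (hc : ∀ k, ‖c k‖ ≤ C) (ζ : AddCircle (1 : ℝ)) :
    ‖trigPoly K c ζ‖ ≤ (2 * K + 1) * C := by
  refine (norm_sum_le _ _).trans ?_
  refine (Finset.sum_le_sum fun k _ => (?_ : ‖c k * fourier k ζ‖ ≤ C)).trans ?_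
  · rw [norm_mul, norm_fourier_apply, mul_one]; exact hc k
  · rw [Finset.sum_const, nsmul_eq_mul, card_Icc_neg]

lemma fourierCoeff_trigPoly {K : ℕ} {c : ℤ → ℂ} (hc : ∀ k : ℤ, ¬ |k| ≤ K → c k = 0) :
    fourierCoeff (trigPoly K c) = c := by
  have h : trigPoly K c = ∑ k ∈ Finset.Icc (-(K : ℤ)) K, fun ζ => c k * fourier k ζ := by
    funext ζ; simp [trigPoly, Finset.sum_apply]
  rw [h, fourierCoeff.sum _ _ fun k _ => Continuous.integrable_haar (by fun_prop)]
  funext n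
  simp only [Finset.sum_apply, fourierCoeff.const_mul, fourierCoeff_fourier, Pi.single_apply,
    mul_ite, mul_one, mul_zero, Finset.sum_ite_eq]
  split_ifs with hn
  · rfl
  · exact (hc n fun h => hn (Finset.mem_Icc.2 (abs_le.1 h))).symm

lemma fourierCoeff_const (c : ℂ) :
    fourierCoeff (fun _ : AddCircle (1 : ℝ) => c) = c • convOne := by
  funext n
  have h := congrFun (fourierCoeff_fourier (T := (1 : ℝ)) 0) n
  have h2 := fourierCoeff.const_mul (T := (1 : ℝ)) (fun t => fourier 0 t) c n
  rw [h] at h2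
  simp only [fourier_zero, mul_one] at h2
  rw [h2]; simp [convOne]

end Fourier

end CorrelatedMatrix

end

noncomputable section

namespace CorrelatedMatrix

/-! ### The operator `Ψ` in Fourier space -/

section LimitOperator

local notation "haar" => (AddCircle.haarAddCircle : Measure (AddCircle (1 : ℝ)))

/-- The properties of `ψ` on which the analysis of the limiting equation rests. -/
structure IsKernel (ψ : UnitIco → UnitIco → ℤ → ℤ → ℝ) {n : ℕ} (I : Fin n → Set UnitIco)
    (K : ℕ) (L c₀ : ℝ) : Prop where
  conn : ∀ α, (I α).OrdConnected
  cover : ∀ θ, ∃ α, θ ∈ I α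
  nonneg : 0 ≤ L
  lip : ∀ α β k l, ∀ θ ∈ I α, ∀ φ ∈ I β, ∀ θ' ∈ I α, ∀ φ' ∈ I β,
    |ψ θ φ k l - ψ θ' φ' k l| ≤ L * max |(θ : ℝ) - θ'| |(φ : ℝ) - φ'|
  eq_zero : ∀ θ φ (k l : ℤ), ¬ (|k| ≤ K ∧ |l| ≤ K) → ψ θ φ k l = 0
  abs_le_one : ∀ θ φ k l, |ψ θ φ k l| ≤ 1
  im : ∀ θ φ ζ ζ', (fourierKernel ψ K θ φ ζ ζ').im = 0
  le_re : ∀ θ φ ζ ζ', c₀ ≤ (fourierKernel ψ K θ φ ζ ζ').re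

lemma exists_isKernel {ψ : UnitIco → UnitIco → ℤ → ℤ → ℝ} {n : ℕ} {I : Fin n → Set UnitIco}
    {K : ℕ} {ξ : ∀ N : ℕ, Fin N → Fin N → Fin N → Fin N → ℝ}
    (hI : IsPieces ψ I) (hξ : IsDiscretization K ψ ξ) (hb : ∀ N, BandedTensor K (ξ N))
    (hneg : ∀ θ φ k l, ψ θ φ k l = ψ θ φ (-k) (-l))
    (hswap : ∀ θ φ k l, ψ θ φ k l = ψ φ θ l k) :
    ∃ L, ∀ c₀ : ℝ, (∀ N, IsSumOfSquares c₀ (ξ N)) → IsKernel ψ I K L c₀ := by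
  obtain ⟨L, hL0, hL⟩ := exists_lip_of_finset hI (Finset.Icc (-(K : ℤ)) K)
  refine ⟨L, fun c₀ hs => ⟨hI.conn, hI.cover, hL0.le, ?_,
    fun θ φ k l h => eq_zero_of_discretization hI hξ hb hswap θ φ h,
    fun θ φ k l => abs_le_one_of_discretization hI hξ hb hswap θ φ k l,
    fun θ φ ζ ζ' => fourierKernel_im hneg θ φ ζ ζ',
    fun θ φ ζ ζ' => le_fourierKernel_re hI hξ hb hs hswap θ φ ζ ζ'⟩⟩
  intro α β k l θ hθ φ hφ θ' hθ' φ' hφ'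
  by_cases h : |k| ≤ K ∧ |l| ≤ K
  · exact hL α β k (Finset.mem_Icc.2 (abs_le.1 h.1)) l (Finset.mem_Icc.2 (abs_le.1 h.2))
      θ hθ φ hφ θ' hθ' φ' hφ'
  · rw [eq_zero_of_discretization hI hξ hb hswap θ φ h,
      eq_zero_of_discretization hI hξ hb hswap θ' φ' h, sub_zero, abs_zero]
    exact mul_nonneg hL0.le (le_max_of_le_left (abs_nonneg _))

variable {ψ : UnitIco → UnitIco → ℤ → ℤ → ℝ} {n : ℕ} {I : Fin n → Set UnitIco}
  {K : ℕ} {L c₀ B B' : ℝ} {f f' : UnitIco → ℤ → ℂ}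

/-- The pieces are finitely many intervals, hence measurable. This gives measurability of everything
built from ψ. -/
lemma IsKernel.measurable_of_continuousOn {E : Type*} [TopologicalSpace E] [MeasurableSpace E]
    [BorelSpace E] (hk : IsKernel ψ I K L c₀) {g : UnitIco → E}
    (hg : ∀ α, ContinuousOn g (I α)) : Measurable g := by
  refine measurable_of_isOpen fun U hU => ?_
  have h : g ⁻¹' U = ⋃ α, g ⁻¹' U ∩ I α := by
    ext θ
    obtain ⟨α, hα⟩ := hk.cover θ
    simp only [Set.mem_iUnion, Set.mem_inter_iff]
    exact ⟨fun h => ⟨α, h, hα⟩, fun ⟨_, h, _⟩ => h⟩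
  rw [h]
  refine MeasurableSet.iUnion fun α => ?_
  obtain ⟨u, hu, he⟩ := continuousOn_iff'.1 (hg α) U hU
  rw [he]
  exact hu.measurableSet.inter (hk.conn α).measurableSet

lemma IsKernel.measurable (hk : IsKernel ψ I K L c₀) (θ : UnitIco) (k l : ℤ) :
    Measurable fun φ => ψ θ φ k l := by
  refine hk.measurable_of_continuousOn fun β => ?_
  obtain ⟨α, hα⟩ := hk.cover θ
  refine LipschitzOnWith.continuousOn (K := L.toNNReal) ?_
  refine LipschitzOnWith.of_dist_le_mul fun φ hφ φ' hφ' => ?_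
  have := hk.lip α β k l θ hα φ hφ θ hα φ' hφ'
  rw [Real.coe_toNNReal _ hk.nonneg, Real.dist_eq, Subtype.dist_eq, Real.dist_eq]
  simpa using this

instance : IsProbabilityMeasure lebIco := by
  constructor
  rw [lebIco, Measure.comap_apply _ Subtype.val_injective
    (fun s hs => measurableSet_Ico.subtype_image hs) _ MeasurableSet.univ, Set.image_univ, Subtype.range_coe, Real.volume_Ico]
  simp

/-- The functions `f(·, l)` are measurable and bounded by `B`. -/
structure IsBddMeas (f : UnitIco → ℤ → ℂ) (B : ℝ) : Prop where
  meas : ∀ l, Measurable fun θ => f θ l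
  bound : ∀ θ l, ‖f θ l‖ ≤ B

lemma IsBddMeas.nonneg (hf : IsBddMeas f B) : 0 ≤ B :=
  (norm_nonneg _).trans (hf.bound ⟨0, by simp⟩ 0)

lemma IsBddMeas.lin (hf : IsBddMeas f B) (hf' : IsBddMeas f' B') (a b : ℂ) :
    IsBddMeas (fun θ l => a * f θ l + b * f' θ l) (‖a‖ * B + ‖b‖ * B') where
  meas l := by
    have := hf.meas l
    have := hf'.meas l
    fun_prop
  bound θ l := (norm_add_le _ _).trans (by
    rw [norm_mul, norm_mul]
    exact add_le_add (mul_le_mul_of_nonneg_left (hf.bound θ l) (norm_nonneg _))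
      (mul_le_mul_of_nonneg_left (hf'.bound θ l) (norm_nonneg _)))

lemma IsKernel.norm_mul_le (hk : IsKernel ψ I K L c₀) (hf : IsBddMeas f B) (θ φ : UnitIco)
    (k l : ℤ) : ‖(ψ θ φ k l : ℂ) * f φ l‖ ≤ B := by
  rw [norm_mul, Complex.norm_real, Real.norm_eq_abs]
  exact (mul_le_mul (hk.abs_le_one θ φ k l) (hf.bound φ l) (norm_nonneg _) zero_le_one).trans
    (one_mul B).le

lemma IsKernel.integrable (hk : IsKernel ψ I K L c₀) (hf : IsBddMeas f B) (θ : UnitIco)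
    (k l : ℤ) : Integrable (fun φ => (ψ θ φ k l : ℂ) * f φ l) lebIco := by
  refine Integrable.of_bound (C := B) ?_ (Filter.Eventually.of_forall fun φ =>
    hk.norm_mul_le hf θ φ k l)
  have h1 := hk.measurable θ k l
  have h2 := hf.meas l
  exact Measurable.aestronglyMeasurable (by fun_prop)

lemma IsKernel.Psi_eq_sum (hk : IsKernel ψ I K L c₀) (f : UnitIco → ℤ → ℂ) (θ : UnitIco) (k : ℤ) :
    Psi ψ f θ k = ∑ l ∈ Finset.Icc (-(K : ℤ)) K, ∫ φ, (ψ θ φ k l : ℂ) * f φ l ∂lebIco := by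
  rw [Psi, tsum_eq_sum]
  intro l hl
  have h0 : ∀ φ, ψ θ φ k l = 0 := fun φ => hk.eq_zero θ φ k l fun h =>
    hl (Finset.mem_Icc.2 (abs_le.1 h.2))
  simp [h0]

lemma IsKernel.Psi_eq_zero (hk : IsKernel ψ I K L c₀) (f : UnitIco → ℤ → ℂ) (θ : UnitIco) {k : ℤ}
    (h : ¬ |k| ≤ K) : Psi ψ f θ k = 0 := by
  have h0 : ∀ φ l, ψ θ φ k l = 0 := fun φ l => hk.eq_zero θ φ k l fun h' => h h'.1
  simp [Psi, h0]

lemma IsKernel.norm_Psi_le (hk : IsKernel ψ I K L c₀) (hf : IsBddMeas f B) (θ : UnitIco) (k : ℤ) :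
    ‖Psi ψ f θ k‖ ≤ (2 * K + 1) * B := by
  rw [hk.Psi_eq_sum]
  refine (norm_sum_le _ _).trans ((Finset.sum_le_sum fun l _ => (?_ : _ ≤ B)).trans ?_)
  · have := norm_integral_le_of_norm_le_const (μ := lebIco)
      (Filter.Eventually.of_forall fun φ => hk.norm_mul_le hf θ φ k l)
    rw [probReal_univ, mul_one] at this
    exact this
  · rw [Finset.sum_const, nsmul_eq_mul, card_Icc_neg]

lemma IsKernel.Psi_lin (hk : IsKernel ψ I K L c₀) (hf : IsBddMeas f B) (hf' : IsBddMeas f' B')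
    (a b : ℂ) (θ : UnitIco) (k : ℤ) :
    Psi ψ (fun θ l => a * f θ l + b * f' θ l) θ k = a * Psi ψ f θ k + b * Psi ψ f' θ k := by
  simp only [hk.Psi_eq_sum, Finset.mul_sum, ← Finset.sum_add_distrib]
  refine Finset.sum_congr rfl fun l _ => ?_
  rw [← integral_const_mul, ← integral_const_mul, ← integral_add
    ((hk.integrable hf θ k l).const_mul a) ((hk.integrable hf' θ k l).const_mul b)]
  refine integral_congr_ae (Filter.Eventually.of_forall fun φ => ?_)
  simp only
  ring

lemma IsKernel.norm_Psi_sub_le (hk : IsKernel ψ I K L c₀) (hf : IsBddMeas f B)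
    {α : Fin n} {θ θ' : UnitIco} (hθ : θ ∈ I α) (hθ' : θ' ∈ I α) (k : ℤ) :
    ‖Psi ψ f θ k - Psi ψ f θ' k‖ ≤ (2 * K + 1) * (L * |(θ : ℝ) - θ'| * B) := by
  rw [hk.Psi_eq_sum, hk.Psi_eq_sum, ← Finset.sum_sub_distrib]
  refine (norm_sum_le _ _).trans ((Finset.sum_le_sum fun l _ =>
    (?_ : _ ≤ L * |(θ : ℝ) - θ'| * B)).trans ?_)
  · rw [← integral_sub (hk.integrable hf θ k l) (hk.integrable hf θ' k l)]
    have := norm_integral_le_of_norm_le_const (μ := lebIco) (C := L * |(θ : ℝ) - θ'| * B)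
      (f := fun φ => (ψ θ φ k l : ℂ) * f φ l - (ψ θ' φ k l : ℂ) * f φ l)
      (Filter.Eventually.of_forall fun φ => ?_)
    · rw [probReal_univ, mul_one] at this
      exact this
    · rw [← sub_mul, norm_mul, ← Complex.ofReal_sub, Complex.norm_real, Real.norm_eq_abs]
      obtain ⟨β, hβ⟩ := hk.cover φ
      have h1 := hk.lip α β k l θ hθ φ hβ θ' hθ' φ hβ
      rw [sub_self, abs_zero, max_eq_left (abs_nonneg _)] at h1
      exact mul_le_mul h1 (hf.bound φ l) (norm_nonneg _) ((abs_nonneg _).trans h1)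
  · rw [Finset.sum_const, nsmul_eq_mul, card_Icc_neg]

/-- The symbol `∑_k Ψ(f)(θ, k) e^{2πikζ}` of `Ψ(f)`. -/
def symb (ψ : UnitIco → UnitIco → ℤ → ℤ → ℝ) (K : ℕ) (f : UnitIco → ℤ → ℂ) (θ : UnitIco)
    (ζ : AddCircle (1 : ℝ)) : ℂ :=
  trigPoly K (Psi ψ f θ) ζ

lemma continuous_symb (f : UnitIco → ℤ → ℂ) (θ : UnitIco) : Continuous (symb ψ K f θ) :=
  continuous_trigPoly K _

lemma IsKernel.norm_symb_le (hk : IsKernel ψ I K L c₀) (hf : IsBddMeas f B) (θ : UnitIco)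
    (ζ : AddCircle (1 : ℝ)) : ‖symb ψ K f θ ζ‖ ≤ (2 * K + 1) ^ 2 * B := by
  refine (norm_trigPoly_le K (fun k => hk.norm_Psi_le hf θ k) ζ).trans (le_of_eq ?_)
  ring

lemma IsKernel.norm_symb_sub_le (hk : IsKernel ψ I K L c₀) (hf : IsBddMeas f B)
    {α : Fin n} {θ θ' : UnitIco} (hθ : θ ∈ I α) (hθ' : θ' ∈ I α) (ζ : AddCircle (1 : ℝ)) :
    ‖symb ψ K f θ ζ - symb ψ K f θ' ζ‖ ≤ (2 * K + 1) ^ 2 * (L * B) * |(θ : ℝ) - θ'| := by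
  rw [symb, symb, trigPoly_sub]
  refine (norm_trigPoly_le K (fun k => hk.norm_Psi_sub_le hf hθ hθ' k) ζ).trans (le_of_eq ?_)
  ring

lemma IsKernel.symb_lin (hk : IsKernel ψ I K L c₀) (hf : IsBddMeas f B) (hf' : IsBddMeas f' B')
    (a b : ℂ) (θ : UnitIco) (ζ : AddCircle (1 : ℝ)) :
    symb ψ K (fun θ l => a * f θ l + b * f' θ l) θ ζ = a * symb ψ K f θ ζ + b * symb ψ K f' θ ζ := by
  simp only [symb, trigPoly, hk.Psi_lin hf hf', Finset.mul_sum, ← Finset.sum_add_distrib]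
  exact Finset.sum_congr rfl fun k _ => by ring

lemma IsKernel.norm_symb_sub_le_of_norm_sub_le (hk : IsKernel ψ I K L c₀) (hf : IsBddMeas f B)
    (hf' : IsBddMeas f' B') {D : ℝ} (hD : ∀ θ l, ‖f θ l - f' θ l‖ ≤ D) (θ : UnitIco)
    (ζ : AddCircle (1 : ℝ)) : ‖symb ψ K f θ ζ - symb ψ K f' θ ζ‖ ≤ (2 * K + 1) ^ 2 * D := by
  have h1 := hk.symb_lin hf hf' 1 (-1) θ ζ
  have h2 : IsBddMeas (fun θ l => (1 : ℂ) * f θ l + (-1) * f' θ l) D :=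
    ⟨(hf.lin hf' 1 (-1)).meas, fun θ l => by
      rw [show (1 : ℂ) * f θ l + (-1) * f' θ l = f θ l - f' θ l by ring]; exact hD θ l⟩
  have h3 := hk.norm_symb_le h2 θ ζ
  rw [h1, show (1 : ℂ) * symb ψ K f θ ζ + (-1) * symb ψ K f' θ ζ =
    symb ψ K f θ ζ - symb ψ K f' θ ζ by ring] at h3
  exact h3

/-- Positivity: if `f̌` has nonnegative imaginary part, then the symbol of `Ψ(f)` has imaginary part
at least `c₀ Im tr f`. -/
lemma IsKernel.le_im_symb (hk : IsKernel ψ I K L c₀) (hf : IsBddMeas f B)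
    {h : UnitIco → AddCircle (1 : ℝ) → ℂ} (hInt : ∀ φ, Integrable (h φ) haar)
    (hpos : ∀ φ, ∀ᵐ ζ ∂haar, 0 ≤ (h φ ζ).im) (hrep : ∀ φ l, f φ l = fourierCoeff (h φ) l)
    (θ : UnitIco) (ζ : AddCircle (1 : ℝ)) :
    c₀ * (trT f).im ≤ (symb ψ K f θ ζ).im := by
  set s := Finset.Icc (-(K : ℤ)) K with hs
  set Q : UnitIco → ℂ := fun φ => ∑ k ∈ s, ∑ l ∈ s, (ψ θ φ k l : ℂ) * f φ l * fourier k ζ with hQ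
  have hQi : ∀ k l, Integrable (fun φ => (ψ θ φ k l : ℂ) * f φ l * fourier k ζ) lebIco :=
    fun k l => (hk.integrable hf θ k l).mul_const _
  have hQint : Integrable Q lebIco :=
    integrable_finsetSum _ fun k _ => integrable_finsetSum _ fun l _ => hQi k l
  have e1 : symb ψ K f θ ζ = ∫ φ, Q φ ∂lebIco := by
    rw [hQ, symb, trigPoly, integral_finsetSum _ fun k _ => integrable_finsetSum _ fun l _ => hQi k l]
    refine Finset.sum_congr rfl fun k _ => ?_
    rw [integral_finsetSum _ fun l _ => hQi k l, hk.Psi_eq_sum, Finset.sum_mul]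
    exact Finset.sum_congr rfl fun l _ => (integral_mul_const _ _).symm
  have hmul : ∀ φ l, Integrable (fun ζ' => fourier (-l) ζ' * h φ ζ') haar := fun φ l => by
    simpa only [smul_eq_mul] using (hInt φ).fourier_smul (n := -l)
  -- Undoing the Fourier coefficients in l brings in `fourierKernel`, which is real and at least c₀,
  -- as the density against which the function `h φ` is integrated.
  have e2 : ∀ φ, Q φ = ∫ ζ', fourierKernel ψ K θ φ ζ ζ' * h φ ζ' ∂haar := by
    intro φ
    have : ∀ ζ', fourierKernel ψ K θ φ ζ ζ' * h φ ζ' = ∑ k ∈ s, ∑ l ∈ s,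
        ((ψ θ φ k l : ℂ) * fourier k ζ) * (fourier (-l) ζ' * h φ ζ') := by
      intro ζ'
      simp only [fourierKernel, Finset.sum_mul]
      exact Finset.sum_congr rfl fun k _ => Finset.sum_congr rfl fun l _ => by ring
    simp only [this]
    rw [integral_finsetSum _ fun k _ => integrable_finsetSum _ fun l _ => (hmul φ l).const_mul _]
    refine Finset.sum_congr rfl fun k _ => ?_
    rw [integral_finsetSum _ fun l _ => (hmul φ l).const_mul _]
    refine Finset.sum_congr rfl fun l _ => ?_
    rw [integral_const_mul, hrep, fourierCoeff]
    simp only [smul_eq_mul]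
    ring
  have hker : ∀ φ, Integrable (fun ζ' => fourierKernel ψ K θ φ ζ ζ' * h φ ζ') haar := by
    intro φ
    have : ∀ ζ', fourierKernel ψ K θ φ ζ ζ' * h φ ζ' = ∑ k ∈ s, ∑ l ∈ s,
        ((ψ θ φ k l : ℂ) * fourier k ζ) * (fourier (-l) ζ' * h φ ζ') := by
      intro ζ'
      simp only [fourierKernel, Finset.sum_mul]
      exact Finset.sum_congr rfl fun k _ => Finset.sum_congr rfl fun l _ => by ring
    simp only [this]
    exact integrable_finsetSum _ fun k _ => integrable_finsetSum _ fun l _ => (hmul φ l).const_mul _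
  have e3 : ∀ φ, c₀ * (f φ 0).im ≤ (Q φ).im := by
    intro φ
    have hf0 : f φ 0 = ∫ ζ', h φ ζ' ∂haar := by
      rw [hrep, fourierCoeff]
      simp
    rw [e2 φ, hf0]
    have i1 := integral_im (hInt φ)
    have i2 := integral_im (hker φ)
    simp only [RCLike.im_to_complex] at i1 i2
    rw [← i1, ← i2, ← integral_const_mul]
    refine integral_mono_ae ((hInt φ).im.const_mul c₀) (hker φ).im ?_
    filter_upwards [hpos φ] with ζ' hζ'
    simp only [Complex.mul_im, hk.im, zero_mul, add_zero]
    exact mul_le_mul_of_nonneg_right (hk.le_re θ φ ζ ζ') hζ'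
  have hf0 : Integrable (fun φ => f φ 0) lebIco :=
    Integrable.of_bound (hf.meas 0).aestronglyMeasurable B
      (Filter.Eventually.of_forall fun φ => hf.bound φ 0)
  rw [e1, trT]
  have i1 := integral_im hf0
  have i2 := integral_im hQint
  simp only [RCLike.im_to_complex] at i1 i2
  rw [← i1, ← i2, ← integral_const_mul]
  exact integral_mono (hf0.im.const_mul c₀) hQint.im e3

lemma fourierCoeff_lin {g g' : AddCircle (1 : ℝ) → ℂ} (hg : Continuous g) (hg' : Continuous g')
    (a b : ℂ) (k : ℤ) : fourierCoeff (fun t => a * g t + b * g' t) k =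
      a * fourierCoeff g k + b * fourierCoeff g' k := by
  rw [fourierCoeff, fourierCoeff, fourierCoeff, ← integral_const_mul, ← integral_const_mul,
    ← integral_add]
  · refine integral_congr_ae (Filter.Eventually.of_forall fun t => ?_)
    simp only [smul_eq_mul]
    ring
  · exact Continuous.integrable_haar (by fun_prop)
  · exact Continuous.integrable_haar (by fun_prop)

/-- With these complex coefficients a domination inequality becomes nonnegativity of one imaginary
part. A linear map that preserves nonnegative imaginary parts therefore preserves domination. -/
lemma im_lin_eq (δ u v : ℝ) (e x y : ℂ) :
    (((δ * u ^ 2 : ℝ) - (2 * u * v : ℝ) * (Complex.I * e)) * x +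
      ((δ * v ^ 2 : ℝ) + (2 * u * v : ℝ) * (Complex.I * e)) * y).im =
    δ * (u ^ 2 * x.im + v ^ 2 * y.im) - 2 * u * v * (e * (x - y)).re := by
  simp only [Complex.add_im, Complex.mul_im, Complex.mul_re, Complex.sub_re, Complex.sub_im,
    Complex.add_re, Complex.ofReal_re, Complex.ofReal_im, Complex.I_re, Complex.I_im]
  ring

/-- A domination of `ȟ - ȟ'` by the imaginary parts is inherited by the symbols. -/
lemma IsKernel.two_norm_symb_sub_le (hk : IsKernel ψ I K L 0) (hf : IsBddMeas f B)
    (hf' : IsBddMeas f' B') {h h' : UnitIco → AddCircle (1 : ℝ) → ℂ}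
    (hc : ∀ φ, Continuous (h φ)) (hc' : ∀ φ, Continuous (h' φ))
    (hrep : ∀ φ l, f φ l = fourierCoeff (h φ) l) (hrep' : ∀ φ l, f' φ l = fourierCoeff (h' φ) l)
    {δ u v : ℝ} (hu : 0 ≤ u) (hv : 0 ≤ v)
    (hdom : ∀ φ ζ, 2 * u * v * ‖h φ ζ - h' φ ζ‖ ≤ δ * (u ^ 2 * (h φ ζ).im + v ^ 2 * (h' φ ζ).im))
    (θ : UnitIco) (ζ : AddCircle (1 : ℝ)) :
    2 * u * v * ‖symb ψ K f θ ζ - symb ψ K f' θ ζ‖ ≤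
      δ * (u ^ 2 * (symb ψ K f θ ζ).im + v ^ 2 * (symb ψ K f' θ ζ).im) := by
  -- The phase e makes the difference of symbols at (θ, ζ) nonnegative, so that its real part there
  -- is its norm. At all other points e only needs modulus 1.
  obtain ⟨e, he1, he⟩ := Complex.exists_norm_eq_mul_self (symb ψ K f θ ζ - symb ψ K f' θ ζ)
  have h1 := hk.le_im_symb (hf.lin hf' ((δ * u ^ 2 : ℝ) - (2 * u * v : ℝ) * (Complex.I * e))
    ((δ * v ^ 2 : ℝ) + (2 * u * v : ℝ) * (Complex.I * e)))
    (h := fun φ ζ => ((δ * u ^ 2 : ℝ) - (2 * u * v : ℝ) * (Complex.I * e)) * h φ ζ +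
      ((δ * v ^ 2 : ℝ) + (2 * u * v : ℝ) * (Complex.I * e)) * h' φ ζ)
    (fun φ => by
      have := hc φ
      have := hc' φ
      exact Continuous.integrable_haar (by fun_prop))
    (fun φ => Filter.Eventually.of_forall fun ζ => by
      rw [im_lin_eq]
      have h2 : (e * (h φ ζ - h' φ ζ)).re ≤ ‖h φ ζ - h' φ ζ‖ := by
        refine (Complex.re_le_norm _).trans ?_
        rw [norm_mul, he1, one_mul]
      have h3 := mul_le_mul_of_nonneg_left h2 (by positivity : 0 ≤ 2 * u * v)
      linarith [hdom φ ζ])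
    (fun φ l => by rw [fourierCoeff_lin (hc φ) (hc' φ), hrep, hrep']) θ ζ
  rw [hk.symb_lin hf hf', zero_mul, im_lin_eq, ← he, Complex.ofReal_re] at h1
  linarith

end LimitOperator

end CorrelatedMatrix

end

noncomputable section

namespace CorrelatedMatrix

/-! ### The limiting equation -/

section LimitEquation

local notation "haar" => (AddCircle.haarAddCircle : Measure (AddCircle (1 : ℝ)))

/-- The symbol of `(-z - Ψ(f))⁻¹`. -/
def limF (ψ : UnitIco → UnitIco → ℤ → ℤ → ℝ) (K : ℕ) (z : ℂ) (f : UnitIco → ℤ → ℂ) (θ : UnitIco)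
    (ζ : AddCircle (1 : ℝ)) : ℂ :=
  (-z - symb ψ K f θ ζ)⁻¹

/-- The coefficients of `(-z - Ψ(f))⁻¹`. -/
def limStep (ψ : UnitIco → UnitIco → ℤ → ℤ → ℝ) (K : ℕ) (z : ℂ) (f : UnitIco → ℤ → ℂ)
    (θ : UnitIco) (l : ℤ) : ℂ :=
  fourierCoeff (limF ψ K z f θ) l

/-- `f` is bounded by `B` and measurable, and the imaginary part of the symbol of `z + Ψ(f)` is at
least `w`. -/
structure Admissible (ψ : UnitIco → UnitIco → ℤ → ℤ → ℝ) (K : ℕ) (z : ℂ) (w B : ℝ)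
    (f : UnitIco → ℤ → ℂ) : Prop where
  bdd : IsBddMeas f B
  le_im : ∀ θ ζ, w ≤ z.im + (symb ψ K f θ ζ).im

variable {ψ : UnitIco → UnitIco → ℤ → ℤ → ℝ} {n : ℕ} {I : Fin n → Set UnitIco}
  {K : ℕ} {L c₀ B B' w : ℝ} {f f' : UnitIco → ℤ → ℂ} {z : ℂ}

lemma Admissible.le_norm (hf : Admissible ψ K z w B f) (θ : UnitIco) (ζ : AddCircle (1 : ℝ)) :
    w ≤ ‖-z - symb ψ K f θ ζ‖ := by
  refine (hf.le_im θ ζ).trans ((le_abs_self _).trans ?_)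
  have := Complex.abs_im_le_norm (-z - symb ψ K f θ ζ)
  rw [Complex.sub_im, Complex.neg_im, ← abs_neg] at this
  rwa [show -(-z.im - (symb ψ K f θ ζ).im) = z.im + (symb ψ K f θ ζ).im by ring] at this

lemma Admissible.ne_zero (hf : Admissible ψ K z w B f) (hw : 0 < w) (θ : UnitIco)
    (ζ : AddCircle (1 : ℝ)) : -z - symb ψ K f θ ζ ≠ 0 :=
  norm_pos_iff.1 (hw.trans_le (hf.le_norm θ ζ))

lemma Admissible.norm_limF_le (hf : Admissible ψ K z w B f) (hw : 0 < w) (θ : UnitIco)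
    (ζ : AddCircle (1 : ℝ)) : ‖limF ψ K z f θ ζ‖ ≤ w⁻¹ := by
  rw [limF, norm_inv]
  exact inv_anti₀ hw (hf.le_norm θ ζ)

lemma Admissible.continuous_limF (hf : Admissible ψ K z w B f) (hw : 0 < w) (θ : UnitIco) :
    Continuous (limF ψ K z f θ) :=
  (continuous_const.sub (continuous_symb f θ)).inv₀ fun ζ => hf.ne_zero hw θ ζ

lemma limF_im (f : UnitIco → ℤ → ℂ) (θ : UnitIco) (ζ : AddCircle (1 : ℝ)) :
    (limF ψ K z f θ ζ).im = ‖limF ψ K z f θ ζ‖ ^ 2 * (z.im + (symb ψ K f θ ζ).im) := by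
  rw [limF, Complex.inv_im, norm_inv, inv_pow, ← Complex.normSq_eq_norm_sq, Complex.sub_im,
    Complex.neg_im]
  ring

lemma Admissible.limF_im_nonneg (hf : Admissible ψ K z w B f) (hw : 0 < w) (θ : UnitIco)
    (ζ : AddCircle (1 : ℝ)) : 0 ≤ (limF ψ K z f θ ζ).im := by
  rw [limF_im]
  exact mul_nonneg (by positivity) (hw.le.trans (hf.le_im θ ζ))

lemma Admissible.le_limF_im (hk : IsKernel ψ I K L c₀) (hf : Admissible ψ K z w B f) (hw : 0 < w)
    (θ : UnitIco) (ζ : AddCircle (1 : ℝ)) :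
    w / (‖z‖ + (2 * K + 1) ^ 2 * B) ^ 2 ≤ (limF ψ K z f θ ζ).im := by
  rw [limF_im, limF, norm_inv, inv_pow, div_eq_inv_mul]
  have h1 := hf.le_norm θ ζ
  have h2 : ‖-z - symb ψ K f θ ζ‖ ≤ ‖z‖ + (2 * K + 1) ^ 2 * B := by
    refine (norm_sub_le _ _).trans ?_
    rw [norm_neg]
    exact add_le_add le_rfl (hk.norm_symb_le hf.bdd θ ζ)
  have h3 : 0 < ‖-z - symb ψ K f θ ζ‖ := hw.trans_le h1
  refine mul_le_mul ?_ (hf.le_im θ ζ) hw.le (by positivity)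
  exact inv_anti₀ (by positivity) (pow_le_pow_left₀ h3.le h2 2)

lemma limF_sub (hf : Admissible ψ K z w B f) (hf' : Admissible ψ K z w B' f') (hw : 0 < w)
    (θ θ' : UnitIco) (ζ : AddCircle (1 : ℝ)) :
    limF ψ K z f θ ζ - limF ψ K z f' θ' ζ =
      limF ψ K z f θ ζ * (symb ψ K f θ ζ - symb ψ K f' θ' ζ) * limF ψ K z f' θ' ζ := by
  have h1 := hf.ne_zero hw θ ζ
  have h2 := hf'.ne_zero hw θ' ζ
  rw [limF, limF]
  field_simp
  ring

lemma norm_limF_sub_le (hf : Admissible ψ K z w B f) (hf' : Admissible ψ K z w B' f') (hw : 0 < w)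
    (θ θ' : UnitIco) (ζ : AddCircle (1 : ℝ)) :
    ‖limF ψ K z f θ ζ - limF ψ K z f' θ' ζ‖ ≤
      (w⁻¹) ^ 2 * ‖symb ψ K f θ ζ - symb ψ K f' θ' ζ‖ := by
  rw [limF_sub hf hf' hw, norm_mul, norm_mul]
  have h1 := hf.norm_limF_le hw θ ζ
  have h2 := hf'.norm_limF_le hw θ' ζ
  have h3 : ‖limF ψ K z f θ ζ‖ * ‖limF ψ K z f' θ' ζ‖ ≤ w⁻¹ * w⁻¹ :=
    mul_le_mul h1 h2 (norm_nonneg _) ((norm_nonneg _).trans h1)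
  have := mul_le_mul_of_nonneg_right h3 (norm_nonneg (symb ψ K f θ ζ - symb ψ K f' θ' ζ))
  linarith

lemma Admissible.norm_limF_sub_le_lip (hk : IsKernel ψ I K L c₀) (hf : Admissible ψ K z w B f)
    (hw : 0 < w) {α : Fin n} {θ θ' : UnitIco} (hθ : θ ∈ I α) (hθ' : θ' ∈ I α)
    (ζ : AddCircle (1 : ℝ)) :
    ‖limF ψ K z f θ ζ - limF ψ K z f θ' ζ‖ ≤
      (w⁻¹) ^ 2 * ((2 * K + 1) ^ 2 * (L * B)) * |(θ : ℝ) - θ'| := by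
  refine (norm_limF_sub_le hf hf hw θ θ' ζ).trans ?_
  rw [mul_assoc]
  exact mul_le_mul_of_nonneg_left (hk.norm_symb_sub_le hf.bdd hθ hθ' ζ) (by positivity)

/-- Whatever the regularity of f, applying Ψ makes the symbol Lipschitz in θ on each piece, which
gives measurability of the new coefficients. -/
lemma Admissible.isBddMeas_limStep (hk : IsKernel ψ I K L c₀) (hf : Admissible ψ K z w B f)
    (hw : 0 < w) : IsBddMeas (limStep ψ K z f) w⁻¹ where
  meas l := by
    refine hk.measurable_of_continuousOn fun α => ?_
    have hB := hf.bdd.nonneg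
    have hL := hk.nonneg
    refine LipschitzOnWith.continuousOn
      (K := ((w⁻¹) ^ 2 * ((2 * K + 1) ^ 2 * (L * B))).toNNReal) ?_
    refine LipschitzOnWith.of_dist_le_mul fun θ hθ θ' hθ' => ?_
    rw [Real.coe_toNNReal _ (by positivity), dist_eq_norm, Subtype.dist_eq, Real.dist_eq, limStep,
      limStep, ← fourierCoeff_sub (hf.continuous_limF hw θ) (hf.continuous_limF hw θ')]
    exact norm_fourierCoeff_le (fun ζ => hf.norm_limF_sub_le_lip hk hw hθ hθ' ζ) l
  bound θ l := norm_fourierCoeff_le (fun ζ => hf.norm_limF_le hw θ ζ) l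

lemma Admissible.step (hk : IsKernel ψ I K L 0) (hz : 0 < z.im)
    (hf : Admissible ψ K z z.im B f) : Admissible ψ K z z.im (z.im)⁻¹ (limStep ψ K z f) where
  bdd := hf.isBddMeas_limStep hk hz
  le_im θ ζ := by
    have := hk.le_im_symb (hf.isBddMeas_limStep hk hz) (h := limF ψ K z f)
      (fun φ => Continuous.integrable_haar (hf.continuous_limF hz φ))
      (fun φ => Filter.Eventually.of_forall fun ζ => hf.limF_im_nonneg hz φ ζ)
      (fun φ l => rfl) θ ζ
    linarith

/-- The difference of the symbols of `(-z - Ψ(f))⁻¹` and `(-z - Ψ(f'))⁻¹` is dominated by their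
imaginary parts. -/
def LimClose (ψ : UnitIco → UnitIco → ℤ → ℤ → ℝ) (K : ℕ) (z : ℂ) (δ : ℝ)
    (f f' : UnitIco → ℤ → ℂ) : Prop :=
  ∀ u v : ℝ, 0 ≤ u → 0 ≤ v → ∀ θ ζ, 2 * u * v * ‖limF ψ K z f θ ζ - limF ψ K z f' θ ζ‖ ≤
    δ * (u ^ 2 * (limF ψ K z f θ ζ).im + v ^ 2 * (limF ψ K z f' θ ζ).im)

/-- The contraction factor of the limiting iteration. -/
def limRate (K : ℕ) (z : ℂ) : ℝ :=
  (2 * K + 1) ^ 2 * (z.im)⁻¹ / (z.im + (2 * K + 1) ^ 2 * (z.im)⁻¹)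

lemma limRate_nonneg (hz : 0 < z.im) : 0 ≤ limRate K z := by
  unfold limRate; positivity

lemma limRate_lt_one (hz : 0 < z.im) : limRate K z < 1 := by
  unfold limRate
  rw [div_lt_one (by positivity)]
  linarith

/-- The ratio x/(Im z + x) increases with x, and `limRate` is its value at the largest admissible x.
-/
lemma le_limRate_mul (hz : 0 < z.im) {x : ℝ} (hx : x ≤ (2 * K + 1) ^ 2 * (z.im)⁻¹) :
    x ≤ limRate K z * (z.im + x) := by
  unfold limRate
  rw [div_mul_eq_mul_div, le_div_iff₀ (by positivity)]
  nlinarith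

/-- The scalar version of the contraction for F. The weights u and v play the role of test vectors;
the resolvent identity multiplies them by the moduli of the resolvents, which is how `limF_im`
transforms the imaginary part of the denominator. -/
lemma LimClose.step (hk : IsKernel ψ I K L 0) (hz : 0 < z.im)
    (hf : Admissible ψ K z z.im B f) (hf' : Admissible ψ K z z.im B' f') {δ : ℝ} (hδ : 0 ≤ δ)
    (h : LimClose ψ K z δ f f') :
    LimClose ψ K z (limRate K z * δ) (limStep ψ K z f) (limStep ψ K z f') := by
  intro u v hu hv θ ζ
  have ha := hf.step hk hz
  have hb := hf'.step hk hz
  set a := limStep ψ K z f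
  set b := limStep ψ K z f'
  have hdom : 2 * (u * ‖limF ψ K z a θ ζ‖) * (v * ‖limF ψ K z b θ ζ‖) *
      ‖symb ψ K a θ ζ - symb ψ K b θ ζ‖ ≤ δ * ((u * ‖limF ψ K z a θ ζ‖) ^ 2 * (symb ψ K a θ ζ).im +
        (v * ‖limF ψ K z b θ ζ‖) ^ 2 * (symb ψ K b θ ζ).im) := by
    refine hk.two_norm_symb_sub_le ha.bdd hb.bdd (h := limF ψ K z f) (h' := limF ψ K z f')
      (fun φ => hf.continuous_limF hz φ) (fun φ => hf'.continuous_limF hz φ) (fun _ _ => rfl)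
      (fun _ _ => rfl) (by positivity) (by positivity) (fun φ ζ' => ?_) θ ζ
    exact h _ _ (by positivity) (by positivity) φ ζ'
  have e : 2 * u * v * ‖limF ψ K z a θ ζ - limF ψ K z b θ ζ‖ =
      2 * (u * ‖limF ψ K z a θ ζ‖) * (v * ‖limF ψ K z b θ ζ‖) *
      ‖symb ψ K a θ ζ - symb ψ K b θ ζ‖ := by
    rw [limF_sub ha hb hz, norm_mul, norm_mul]; ring
  have hq : ∀ g, Admissible ψ K z z.im (z.im)⁻¹ g → ∀ t : ℝ,
      t ^ 2 * ‖limF ψ K z g θ ζ‖ ^ 2 * (symb ψ K g θ ζ).im ≤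
        limRate K z * (t ^ 2 * (limF ψ K z g θ ζ).im) := by
    intro g hg t
    have h1 : (symb ψ K g θ ζ).im ≤ (2 * K + 1) ^ 2 * (z.im)⁻¹ :=
      (le_abs_self _).trans ((Complex.abs_im_le_norm _).trans (hk.norm_symb_le hg.bdd θ ζ))
    have h2 := mul_le_mul_of_nonneg_left (le_limRate_mul hz h1)
      (by positivity : 0 ≤ t ^ 2 * ‖limF ψ K z g θ ζ‖ ^ 2)
    rw [limF_im g]
    linarith
  rw [e]
  refine hdom.trans ?_
  have h1 := hq a ha u
  have h2 := hq b hb v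
  have h3 := mul_le_mul_of_nonneg_left (add_le_add h1 h2) hδ
  linarith

/-- A lower bound for the imaginary part of the symbols of the iterates. -/
def limLower (K : ℕ) (z : ℂ) : ℝ := z.im / (‖z‖ + (2 * K + 1) ^ 2 * (z.im)⁻¹) ^ 2

lemma limLower_pos (hz : 0 < z.im) : 0 < limLower K z := by
  unfold limLower; positivity

/-- A finite initial distance: the resolvents are bounded above in modulus, and their imaginary
parts are bounded below by `limLower`. -/
lemma limClose_of_admissible (hk : IsKernel ψ I K L 0) (hz : 0 < z.im)
    (hf : Admissible ψ K z z.im (z.im)⁻¹ f) (hf' : Admissible ψ K z z.im (z.im)⁻¹ f') :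
    LimClose ψ K z (2 * (z.im)⁻¹ / limLower K z) f f' := by
  intro u v hu hv θ ζ
  have hl := limLower_pos (K := K) hz
  have h1 := hf.le_limF_im hk hz θ ζ
  have h2 := hf'.le_limF_im hk hz θ ζ
  have h3 : ‖limF ψ K z f θ ζ - limF ψ K z f' θ ζ‖ ≤ 2 * (z.im)⁻¹ := by
    refine (norm_sub_le _ _).trans ?_
    linarith [hf.norm_limF_le hz θ ζ, hf'.norm_limF_le hz θ ζ]
  change limLower K z ≤ _ at h1 h2
  have h4 : (u ^ 2 + v ^ 2) * limLower K z ≤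
      u ^ 2 * (limF ψ K z f θ ζ).im + v ^ 2 * (limF ψ K z f' θ ζ).im := by
    have := mul_le_mul_of_nonneg_left h1 (sq_nonneg u)
    have := mul_le_mul_of_nonneg_left h2 (sq_nonneg v)
    linarith
  have h5 := mul_le_mul_of_nonneg_left h4 (by positivity : 0 ≤ 2 * (z.im)⁻¹ / limLower K z)
  refine le_trans ?_ h5
  rw [show 2 * (z.im)⁻¹ / limLower K z * ((u ^ 2 + v ^ 2) * limLower K z) =
    (u ^ 2 + v ^ 2) * (2 * (z.im)⁻¹) by field_simp]
  refine mul_le_mul ?_ h3 (norm_nonneg _) (by positivity)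
  nlinarith [sq_nonneg (u - v)]

lemma LimClose.norm_sub_le {δ : ℝ} (hδ : 0 ≤ δ) (h : LimClose ψ K z δ f f') (hw : 0 < w)
    (hf : Admissible ψ K z w B f) (hf' : Admissible ψ K z w B' f')
    (θ : UnitIco) (ζ : AddCircle (1 : ℝ)) :
    ‖limF ψ K z f θ ζ - limF ψ K z f' θ ζ‖ ≤ δ * w⁻¹ := by
  have h1 := h 1 1 zero_le_one zero_le_one θ ζ
  have h2 := (le_abs_self _).trans ((Complex.abs_im_le_norm _).trans (hf.norm_limF_le hw θ ζ))
  have h3 := (le_abs_self _).trans ((Complex.abs_im_le_norm _).trans (hf'.norm_limF_le hw θ ζ))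
  have h4 := mul_le_mul_of_nonneg_left (add_le_add h2 h3) hδ
  linarith

/-- The iterates from 0 converge geometrically, uniformly over all coefficients. Pointwise limits
keep measurability, the bound and the inequality for the symbol, and uniform convergence lets the
limit pass through Ψ. -/
lemma exists_limStep_eq (hk : IsKernel ψ I K L 0) (hz : 0 < z.im) :
    ∃ f, Admissible ψ K z z.im (z.im)⁻¹ f ∧ limStep ψ K z f = f := by
  set q := limRate K z
  have hq0 : 0 ≤ q := limRate_nonneg hz
  have hq1 : q < 1 := limRate_lt_one hz
  set δ₀ := 2 * (z.im)⁻¹ / limLower K z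
  have hδ₀ : 0 ≤ δ₀ := div_nonneg (by positivity) (limLower_pos hz).le
  set F : ℕ → UnitIco → ℤ → ℂ := fun j => (limStep ψ K z)^[j] 0 with hF
  have hFs : ∀ j, F (j + 1) = limStep ψ K z (F j) := fun j => Function.iterate_succ_apply' _ _ _
  have hadm : ∀ j, Admissible ψ K z z.im (z.im)⁻¹ (F j) := by
    intro j
    induction j with
    | zero =>
      refine ⟨⟨fun l => measurable_const, fun θ l => ?_⟩, fun θ ζ => ?_⟩
      · simp [hF, hz.le]
      · simp [hF, symb, trigPoly, Psi]
    | succ j ih => rw [hFs]; exact ih.step hk hz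
  have hclose : ∀ j, LimClose ψ K z (δ₀ * q ^ j) (F j) (F (j + 1)) := by
    intro j
    induction j with
    | zero => rw [pow_zero, mul_one]; exact limClose_of_admissible hk hz (hadm 0) (hadm 1)
    | succ j ih =>
      rw [hFs j, hFs (j + 1)]
      have := ih.step hk hz (hadm j) (hadm (j + 1)) (by positivity)
      rw [show limRate K z * (δ₀ * q ^ j) = δ₀ * q ^ (j + 1) by rw [pow_succ]; ring] at this
      exact this
  have hdist : ∀ θ l j, dist (F (j + 1) θ l) (F (j + 1 + 1) θ l) ≤ δ₀ * (z.im)⁻¹ * q ^ j := by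
    intro θ l j
    rw [dist_eq_norm, hFs j, hFs (j + 1), limStep, limStep,
      ← fourierCoeff_sub ((hadm j).continuous_limF hz θ) ((hadm (j + 1)).continuous_limF hz θ)]
    refine norm_fourierCoeff_le (fun ζ => ?_) l
    refine ((hclose j).norm_sub_le (by positivity) hz (hadm j) (hadm (j + 1)) θ ζ).trans ?_
    exact le_of_eq (by ring)
  choose f hf using fun θ l => cauchySeq_tendsto_of_complete
    (cauchySeq_of_le_geometric q (δ₀ * (z.im)⁻¹) hq1 (hdist θ l))
  have hrate : ∀ θ l j, ‖F (j + 1) θ l - f θ l‖ ≤ δ₀ * (z.im)⁻¹ * q ^ j / (1 - q) := by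
    intro θ l j
    rw [← dist_eq_norm]
    exact dist_le_of_le_geometric_of_tendsto q (δ₀ * (z.im)⁻¹) hq1 (hdist θ l) (hf θ l) j
  have hlim0 : Filter.Tendsto (fun j : ℕ => δ₀ * (z.im)⁻¹ * q ^ j / (1 - q)) Filter.atTop (nhds 0) := by
    have := ((tendsto_pow_atTop_nhds_zero_of_lt_one hq0 hq1).const_mul (δ₀ * (z.im)⁻¹)).div_const (1 - q)
    simpa using this
  have hbdd : IsBddMeas f (z.im)⁻¹ := by
    refine ⟨fun l => ?_, fun θ l => ?_⟩
    · refine measurable_of_tendsto_metrizable (f := fun (j : ℕ) θ => F (j + 1) θ l)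
        (fun j => (hadm (j + 1)).bdd.meas l) ?_
      exact tendsto_pi_nhds.2 fun θ => hf θ l
    · exact le_of_tendsto (hf θ l).norm (Filter.Eventually.of_forall fun j => (hadm (j + 1)).bdd.bound θ l)
  have hsymb : ∀ j θ ζ, ‖symb ψ K (F (j + 1)) θ ζ - symb ψ K f θ ζ‖ ≤
      (2 * K + 1) ^ 2 * (δ₀ * (z.im)⁻¹ * q ^ j / (1 - q)) := fun j θ ζ =>
    hk.norm_symb_sub_le_of_norm_sub_le (hadm (j + 1)).bdd hbdd (fun θ l => hrate θ l j) θ ζ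
  have hsymbt : ∀ θ ζ, Filter.Tendsto (fun j => symb ψ K (F (j + 1)) θ ζ) Filter.atTop
      (nhds (symb ψ K f θ ζ)) := by
    intro θ ζ
    rw [tendsto_iff_norm_sub_tendsto_zero]
    refine squeeze_zero (fun _ => norm_nonneg _) (fun j => hsymb j θ ζ) ?_
    simpa using hlim0.const_mul ((2 * K + 1 : ℝ) ^ 2)
  have hadmf : Admissible ψ K z z.im (z.im)⁻¹ f := by
    refine ⟨hbdd, fun θ ζ => ?_⟩
    refine ge_of_tendsto (((Complex.continuous_im.tendsto _).comp (hsymbt θ ζ)).const_add z.im) ?_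
    exact Filter.Eventually.of_forall fun j => (hadm (j + 1)).le_im θ ζ
  refine ⟨f, hadmf, ?_⟩
  funext θ l
  have h1 : Filter.Tendsto (fun j => F (j + 1 + 1) θ l) Filter.atTop (nhds (f θ l)) :=
    (Filter.tendsto_add_atTop_iff_nat 1).2 (hf θ l)
  refine tendsto_nhds_unique ?_ h1
  rw [tendsto_iff_norm_sub_tendsto_zero]
  have h2 : Filter.Tendsto (fun j : ℕ => ((z.im)⁻¹) ^ 2 * ((2 * K + 1) ^ 2 *
      (δ₀ * (z.im)⁻¹ * q ^ j / (1 - q)))) Filter.atTop (nhds 0) := by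
    simpa only [mul_zero] using
      (hlim0.const_mul ((2 * K + 1 : ℝ) ^ 2)).const_mul (((z.im)⁻¹) ^ 2)
  refine squeeze_zero (fun _ => norm_nonneg _) (fun j => ?_) h2
  rw [hFs (j + 1), limStep, limStep,
    ← fourierCoeff_sub ((hadm (j + 1)).continuous_limF hz θ) (hadmf.continuous_limF hz θ)]
  refine norm_fourierCoeff_le (fun ζ => ?_) l
  exact (norm_limF_sub_le (hadm (j + 1)) hadmf hz θ θ ζ).trans
    (mul_le_mul_of_nonneg_left (hsymb j θ ζ) (by positivity))

lemma IsKernel.fourierCoeff_denom (hk : IsKernel ψ I K L c₀) (z : ℂ) (f : UnitIco → ℤ → ℂ)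
    (θ : UnitIco) :
    fourierCoeff (fun ζ => -z - symb ψ K f θ ζ) = -(z • convOne) - Psi ψ f θ := by
  funext k
  have h1 := fourierCoeff_sub (f := fun _ => -z) (g := symb ψ K f θ) continuous_const
    (continuous_symb f θ) k
  have h2 : fourierCoeff (symb ψ K f θ) = Psi ψ f θ :=
    fourierCoeff_trigPoly fun k hk' => hk.Psi_eq_zero f θ hk'
  rw [h1, fourierCoeff_const, h2]
  simp

lemma isLimitSolution_of_limStep_eq (hk : IsKernel ψ I K L 0) (hz : 0 < z.im)
    (hf : Admissible ψ K z z.im (z.im)⁻¹ f) (hfix : limStep ψ K z f = f) :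
    IsLimitSolution ψ z f := by
  have hrep : ∀ θ, f θ = fourierCoeff (limF ψ K z f θ) := fun θ => by
    conv_lhs => rw [← hfix]
    rfl
  have hcont := fun θ => hf.continuous_limF hz θ
  refine ⟨⟨⟨hf.bdd.meas, fun θ => ?_, (z.im)⁻¹, fun θ => ?_⟩, limLower K z, limLower_pos hz,
    fun θ => ?_⟩, fun θ => ⟨?_, ?_, ?_⟩⟩
  · rw [hrep]; exact memK_fourierCoeff (hcont θ)
  · rw [hrep]; exact convBoundedBy_fourierCoeff (hcont θ) fun ζ => hf.norm_limF_le hz θ ζ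
  · have h1 := invFourier_fourierCoeff (hcont θ)
    rw [← hrep] at h1
    filter_upwards [h1] with ζ hζ
    rw [hζ]
    exact hf.le_limF_im hk hz θ ζ
  · rw [← hk.fourierCoeff_denom]
    exact memK_fourierCoeff (continuous_const.sub (continuous_symb f θ))
  · rw [hrep]; exact memK_fourierCoeff (hcont θ)
  · have hmem : Memℓp (f θ) 2 := by
      rw [hrep]; exact (memK_fourierCoeff (hcont θ)).memℓp
    funext k
    have hc : Continuous fun ζ => -z - symb ψ K f θ ζ := continuous_const.sub (continuous_symb f θ)
    rw [← hk.fourierCoeff_denom, ← fourierCoeff_invFourier hmem, ← fourierCoeff_mul hc]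
    have h1 := invFourier_fourierCoeff (hcont θ)
    rw [← hrep] at h1
    have h2 : (fun ζ => (-z - symb ψ K f θ ζ) * invFourier (f θ) ζ) =ᵐ[haar] fun _ => (1 : ℂ) := by
      filter_upwards [h1] with ζ hζ
      rw [hζ, limF, mul_inv_cancel₀ (hf.ne_zero hz θ ζ)]
    rw [fourierCoeff_congr_ae h2, fourierCoeff_const, one_smul]

/-- A solution of the limiting equation is given by the coefficients of its symbol, whose
denominator has imaginary part at least `Im z + c₀ Im tr m`. -/
lemma IsLimitSolution.admissible (hk : IsKernel ψ I K L c₀)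
    (hm : IsLimitSolution ψ z f) (hw : 0 < w) (hle : w ≤ z.im + c₀ * (trT f).im) :
    limStep ψ K z f = f ∧ Admissible ψ K z w w⁻¹ f := by
  obtain ⟨⟨⟨hmeas, hK, C, hC⟩, ε, hε, hpos⟩, hinv⟩ := hm
  have hbdd : IsBddMeas f C := ⟨hmeas, fun θ l => (hC θ).norm_le l⟩
  have hmem : ∀ θ, Memℓp (f θ) 2 := fun θ => (hK θ).memℓp
  have hsymb := hk.le_im_symb hbdd (h := fun φ => invFourier (f φ))
    (fun φ => (Lp.memLp (invFourier (f φ))).integrable (by norm_num))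
    (fun φ => (hpos φ).mono fun ζ hζ => hε.le.trans hζ)
    (fun φ l => (congrFun (fourierCoeff_invFourier (hmem φ)) l).symm)
  -- At first only the bound C from membership in 𝒯 is known. Once the coefficients of f are
  -- identified with those of the resolvent, the bound improves to w⁻¹.
  have hadm : Admissible ψ K z w C f := ⟨hbdd, fun θ ζ => by linarith [hsymb θ ζ]⟩
  have hfix : limStep ψ K z f = f := by
    funext θ l
    have hc : Continuous fun ζ => -z - symb ψ K f θ ζ := continuous_const.sub (continuous_symb f θ)
    have hcl := hadm.continuous_limF hw θ
    have hm2 : MemLp (fun ζ => (-z - symb ψ K f θ ζ) * invFourier (f θ) ζ) 2 haar := by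
      obtain ⟨D, hD⟩ := (isCompact_range hc).isBounded.exists_norm_le
      refine (Lp.memLp (invFourier (f θ))).of_le_mul (c := D) ?_ ?_
      · exact hc.aestronglyMeasurable.mul (Lp.aestronglyMeasurable _)
      · exact Filter.Eventually.of_forall fun t => by
          rw [norm_mul]; exact mul_le_mul_of_nonneg_right (hD _ ⟨t, rfl⟩) (norm_nonneg _)
    have hae : (hm2.toLp : AddCircle (1 : ℝ) → ℂ) =ᵐ[haar] _ := MemLp.coeFn_toLp _
    have h1 : fourierCoeff (hm2.toLp : AddCircle (1 : ℝ) → ℂ) =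
        fourierCoeff (fun _ : AddCircle (1 : ℝ) => (1 : ℂ)) := by
      rw [fourierCoeff_congr_ae hae, fourierCoeff_const, one_smul, ← (hinv θ).2.2]
      funext k
      rw [fourierCoeff_mul hc, fourierCoeff_invFourier (hmem θ), hk.fourierCoeff_denom]
    have h2 := fourierCoeff_injective_ae continuous_const h1
    -- The inverse for convolution becomes the pointwise inverse, for almost every ζ.
    have h3 : limF ψ K z f θ =ᵐ[haar] invFourier (f θ) := by
      filter_upwards [hae, h2] with ζ h4 h5
      rw [h4] at h5
      exact (eq_inv_of_mul_eq_one_right h5).symm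
    rw [limStep, fourierCoeff_congr_ae h3, fourierCoeff_invFourier (hmem θ)]
  refine ⟨hfix, ?_, hadm.le_im⟩
  have := hadm.isBddMeas_limStep hk hw
  rwa [hfix] at this

lemma existsUnique_isLimitSolution (hk : IsKernel ψ I K L 0) (hz : 0 < z.im) :
    ∃! m, IsLimitSolution ψ z m := by
  obtain ⟨f, hf, hfix⟩ := exists_limStep_eq hk hz
  refine ⟨f, isLimitSolution_of_limStep_eq hk hz hf hfix, fun m hm => ?_⟩
  obtain ⟨hmfix, hmadm⟩ := hm.admissible hk hz (by simp)
  set δ₀ := 2 * (z.im)⁻¹ / limLower K z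
  have hδ₀ : 0 ≤ δ₀ := div_nonneg (by positivity) (limLower_pos hz).le
  have hq0 := limRate_nonneg (K := K) hz
  have hclose : ∀ j : ℕ, LimClose ψ K z (δ₀ * limRate K z ^ j) m f := by
    intro j
    induction j with
    | zero => rw [pow_zero, mul_one]; exact limClose_of_admissible hk hz hmadm hf
    | succ j ih =>
      have := ih.step hk hz hmadm hf (by positivity)
      rw [hmfix, hfix, show limRate K z * (δ₀ * limRate K z ^ j) = δ₀ * limRate K z ^ (j + 1) by
        rw [pow_succ]; ring] at this
      exact this
  have heq : ∀ θ ζ, limF ψ K z m θ ζ = limF ψ K z f θ ζ := by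
    intro θ ζ
    rw [← sub_eq_zero, ← norm_le_zero_iff]
    have hlim : Filter.Tendsto (fun j : ℕ => δ₀ * limRate K z ^ j * (z.im)⁻¹) Filter.atTop (nhds 0) := by
      simpa using ((tendsto_pow_atTop_nhds_zero_of_lt_one hq0
        (limRate_lt_one (K := K) hz)).const_mul δ₀).mul_const (z.im)⁻¹
    exact ge_of_tendsto hlim (Filter.Eventually.of_forall fun j =>
      (hclose j).norm_sub_le (by positivity) hz hmadm hf θ ζ)
  rw [← hmfix, ← hfix]
  funext θ l
  rw [limStep, limStep, show limF ψ K z m θ = limF ψ K z f θ from funext (heq θ)]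

end LimitEquation

end CorrelatedMatrix

end

noncomputable section

namespace CorrelatedMatrix

/-! ### Regularity of the solution of the limiting equation -/

section Profile

local notation "haar" => (AddCircle.haarAddCircle : Measure (AddCircle (1 : ℝ)))

variable {ψ : UnitIco → UnitIco → ℤ → ℤ → ℝ} {n : ℕ} {I : Fin n → Set UnitIco}
  {K : ℕ} {L c₀ B w : ℝ} {f : UnitIco → ℤ → ℂ} {z : ℂ}

/-- The Toeplitz matrix with symbol `a`. -/
def toeplitz (N : ℕ) (a : ℤ → ℂ) : Matrix (Fin N) (Fin N) ℂ := Matrix.of fun j l => a (idxDiff j l)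

/-- A coefficient function which is bounded by `b` in `ℓ²`, is Lipschitz in `ℓ²` on the pieces `I α`
with constant `ℓ`, and has Toeplitz matrices with nonnegative imaginary part. -/
structure IsProfile (I : Fin n → Set UnitIco) (b ℓ : ℝ) (m : UnitIco → ℤ → ℂ) : Prop where
  bdd : IsBddMeas m b
  nonneg : 0 ≤ ℓ
  sum_sq_le : ∀ θ (s : Finset ℤ), ∑ k ∈ s, ‖m θ k‖ ^ 2 ≤ b ^ 2
  sum_sq_sub_le : ∀ α, ∀ θ ∈ I α, ∀ θ' ∈ I α, ∀ s : Finset ℤ,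
    ∑ k ∈ s, ‖m θ k - m θ' k‖ ^ 2 ≤ (ℓ * |(θ : ℝ) - θ'|) ^ 2
  imForm_nonneg : ∀ θ N (u : Fin N → ℂ), 0 ≤ imForm (toeplitz N (m θ)) u

/-- The Toeplitz form at u is the integral of |v|² g, where v is the trigonometric polynomial with
coefficients u. -/
lemma imForm_toeplitz_nonneg {g : AddCircle (1 : ℝ) → ℂ} (hg : Continuous g)
    (hpos : ∀ ζ, 0 ≤ (g ζ).im) {N : ℕ} (u : Fin N → ℂ) :
    0 ≤ imForm (toeplitz N (fourierCoeff g)) u := by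
  set v : AddCircle (1 : ℝ) → ℂ := fun ζ => ∑ l : Fin N, u l * fourier (-((l : ℕ) : ℤ)) ζ with hv
  have hvc : Continuous v := by rw [hv]; fun_prop
  have e : sesq (toeplitz N (fourierCoeff g)) u u = ∫ ζ, ((‖v ζ‖ ^ 2 : ℝ) : ℂ) * g ζ ∂haar := by
    rw [sesq_eq_sum]
    have h1 : ∀ ζ, ((‖v ζ‖ ^ 2 : ℝ) : ℂ) * g ζ = ∑ j, ∑ l, star (u j) * u l *
        (fourier (-(idxDiff j l)) ζ * g ζ) := by
      intro ζ
      have h2 : ((‖v ζ‖ ^ 2 : ℝ) : ℂ) = star (v ζ) * v ζ := by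
        push_cast; exact (Complex.conj_mul' _).symm
      rw [h2, hv, star_sum, Finset.sum_mul, Finset.sum_mul]
      refine Finset.sum_congr rfl fun j _ => ?_
      rw [Finset.mul_sum, Finset.sum_mul]
      refine Finset.sum_congr rfl fun l _ => ?_
      rw [star_mul', RCLike.star_def, ← fourier_neg,
        show -(idxDiff j l) = - -((j : ℕ) : ℤ) + -((l : ℕ) : ℤ) by simp only [idxDiff]; ring,
        fourier_add]
      ring
    simp only [h1]
    have hi : ∀ j l : Fin N, Integrable (fun ζ => star (u j) * u l *
        (fourier (-(idxDiff j l)) ζ * g ζ)) haar := fun j l =>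
      Continuous.integrable_haar (by fun_prop)
    rw [integral_finsetSum _ fun j _ => integrable_finsetSum _ fun l _ => hi j l]
    refine Finset.sum_congr rfl fun j _ => ?_
    rw [integral_finsetSum _ fun l _ => hi j l]
    refine Finset.sum_congr rfl fun l _ => ?_
    rw [integral_const_mul, toeplitz, Matrix.of_apply, fourierCoeff]
    simp only [smul_eq_mul]
    ring
  have hi : Integrable (fun ζ => ((‖v ζ‖ ^ 2 : ℝ) : ℂ) * g ζ) haar :=
    Continuous.integrable_haar (by fun_prop)
  have him := integral_im hi
  simp only [RCLike.im_to_complex] at him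
  rw [imForm, e, ← him]
  refine integral_nonneg fun ζ => ?_
  simp only [Complex.im_ofReal_mul]
  exact mul_nonneg (by positivity) (hpos ζ)

/-- Bounds on the resolvent and its increments that are uniform in ζ become ℓ² bounds by Parseval.
These control whole rows of the discretization, not only single entries. -/
lemma Admissible.isProfile (hk : IsKernel ψ I K L c₀) (hf : Admissible ψ K z w w⁻¹ f) (hw : 0 < w)
    (hfix : limStep ψ K z f = f) :
    IsProfile I w⁻¹ ((w⁻¹) ^ 2 * ((2 * K + 1) ^ 2 * (L * w⁻¹))) f := by
  have hrep : ∀ θ, f θ = fourierCoeff (limF ψ K z f θ) := fun θ => by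
    conv_lhs => rw [← hfix]
    rfl
  have hL := hk.nonneg
  have hcont := fun θ => hf.continuous_limF hw θ
  refine ⟨hf.bdd, by positivity, fun θ s => ?_, fun α θ hθ θ' hθ' s => ?_, fun θ N u => ?_⟩
  · rw [hrep]
    exact sum_sq_fourierCoeff_le (hcont θ) (fun ζ => hf.norm_limF_le hw θ ζ) s
  · have h1 := sum_sq_fourierCoeff_le (g := fun ζ => limF ψ K z f θ ζ - limF ψ K z f θ' ζ)
      ((hcont θ).sub (hcont θ')) (fun ζ => hf.norm_limF_sub_le_lip hk hw hθ hθ' ζ) s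
    simp only [fourierCoeff_sub (hcont θ) (hcont θ')] at h1
    rw [← hrep, ← hrep] at h1
    exact h1
  · rw [hrep]
    exact imForm_toeplitz_nonneg (hcont θ) (fun ζ => hf.limF_im_nonneg hw θ ζ) u

/-- The limiting equation, in coefficients. -/
lemma Admissible.equation (hf : Admissible ψ K z w B f) (hw : 0 < w)
    (hfix : limStep ψ K z f = f) (θ : UnitIco) (k : ℤ) :
    -z * f θ k - ∑ κ ∈ Finset.Icc (-(K : ℤ)) K, Psi ψ f θ κ * f θ (k - κ) =
      if k = 0 then 1 else 0 := by
  have hrep : ∀ k, f θ k = fourierCoeff (limF ψ K z f θ) k := fun k => by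
    conv_lhs => rw [← hfix]
    rfl
  have hcl := hf.continuous_limF hw θ
  have hi : ∀ κ : ℤ, Integrable (fun ζ => Psi ψ f θ κ * (fourier (-(k - κ)) ζ *
      limF ψ K z f θ ζ)) haar := fun κ => Continuous.integrable_haar (by fun_prop)
  have e1 : ∑ κ ∈ Finset.Icc (-(K : ℤ)) K, Psi ψ f θ κ * f θ (k - κ) =
      ∫ ζ, fourier (-k) ζ * (symb ψ K f θ ζ * limF ψ K z f θ ζ) ∂haar := by
    have h1 : ∀ ζ, fourier (-k) ζ * (symb ψ K f θ ζ * limF ψ K z f θ ζ) =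
        ∑ κ ∈ Finset.Icc (-(K : ℤ)) K, Psi ψ f θ κ * (fourier (-(k - κ)) ζ *
          limF ψ K z f θ ζ) := by
      intro ζ
      rw [symb, trigPoly, Finset.sum_mul, Finset.mul_sum]
      refine Finset.sum_congr rfl fun κ _ => ?_
      rw [show -(k - κ) = -k + κ by ring, fourier_add]
      ring
    simp only [h1]
    rw [integral_finsetSum _ fun κ _ => hi κ]
    refine Finset.sum_congr rfl fun κ _ => ?_
    rw [integral_const_mul, hrep, fourierCoeff]
    simp only [smul_eq_mul]
  have e2 : -z * f θ k = ∫ ζ, fourier (-k) ζ * (-z * limF ψ K z f θ ζ) ∂haar := by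
    rw [hrep, fourierCoeff, ← integral_const_mul]
    refine integral_congr_ae (Filter.Eventually.of_forall fun ζ => ?_)
    simp only [smul_eq_mul]
    ring
  have hsc := continuous_symb (ψ := ψ) (K := K) f θ
  rw [e1, e2, ← integral_sub (Continuous.integrable_haar (by fun_prop))
    (Continuous.integrable_haar (by fun_prop))]
  have e3 : ∀ ζ, fourier (-k) ζ * (-z * limF ψ K z f θ ζ) -
      fourier (-k) ζ * (symb ψ K f θ ζ * limF ψ K z f θ ζ) = fourier (-k) ζ • (1 : ℂ) := by
    intro ζ
    rw [← mul_sub, ← sub_mul, limF, mul_inv_cancel₀ (hf.ne_zero hw θ ζ), smul_eq_mul]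
  simp only [e3]
  have := congrFun (fourierCoeff_const 1) k
  rw [fourierCoeff] at this
  rw [this]
  simp [convOne, Pi.single_apply]

end Profile

/-! ### Interior indices -/

section Good

variable {ψ : UnitIco → UnitIco → ℤ → ℤ → ℝ} {n : ℕ} {I : Fin n → Set UnitIco}
  {K : ℕ} {L c₀ : ℝ} {N r : ℕ}

/-- The indices within distance `r` of `i` exist and belong to the same piece. -/
def Interior (I : Fin n → Set UnitIco) (r : ℕ) (i : Fin N) : Prop :=
  (∃ α, Inside (I α) (gridPt i) ((r : ℝ) / N)) ∧ r ≤ (i : ℕ) ∧ (i : ℕ) + r < N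

lemma card_near_le (x : ℝ) (r : ℕ) :
    (Finset.univ.filter fun i : Fin N => |((i : ℕ) : ℝ) - x| ≤ r).card ≤ 2 * r + 1 := by
  have h : (Finset.univ.filter fun i : Fin N => |((i : ℕ) : ℝ) - x| ≤ r).card ≤
      (Finset.Icc (⌈x⌉ - r) (⌊x⌋ + r : ℤ)).card := by
    refine Finset.card_le_card_of_injOn (fun i => ((i : ℕ) : ℤ)) ?_ ?_
    · intro i hi
      simp only [Finset.coe_filter, Set.mem_ofPred_eq, Finset.mem_univ, true_and] at hi
      rw [abs_le] at hi
      simp only [Finset.coe_Icc, Set.mem_Icc]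
      constructor
      · rw [sub_le_iff_le_add, Int.ceil_le]
        push_cast; linarith
      · rw [← sub_le_iff_le_add, Int.le_floor]
        push_cast; linarith
    · intro i _ j _ hij
      exact Fin.ext (by simpa using hij)
  rw [Int.card_Icc] at h
  have := Int.floor_le_ceil x
  omega

/-- The upper end of a set of parameters. -/
def upperEnd (s : Set UnitIco) : ℝ := sSup (Subtype.val '' s)

/-- The lower end of a set of parameters. -/
def lowerEnd (s : Set UnitIco) : ℝ := sInf (Subtype.val '' s)

/-- If a point at distance at most ρ lies outside an interval, the end of the interval on that side
lies in between. -/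
lemma near_end_of_not_inside {s : Set UnitIco} (hs : s.OrdConnected) {x : UnitIco} (hx : x ∈ s)
    {ρ : ℝ} (h : ¬ Inside s x ρ) : |(x : ℝ) - upperEnd s| ≤ ρ ∨ |(x : ℝ) - lowerEnd s| ≤ ρ := by
  simp only [Inside, not_forall] at h
  obtain ⟨y, hy, hys⟩ := h
  have hbA : BddAbove (Subtype.val '' s) := ⟨1, by rintro _ ⟨t, -, rfl⟩; exact t.2.2.le⟩
  have hbB : BddBelow (Subtype.val '' s) := ⟨0, by rintro _ ⟨t, -, rfl⟩; exact t.2.1⟩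
  have hne : (Subtype.val '' s).Nonempty := ⟨x, x, hx, rfl⟩
  rw [abs_le] at hy
  rcases le_total x y with hxy | hxy
  · left
    have h1 : (x : ℝ) ≤ upperEnd s := le_csSup hbA ⟨x, hx, rfl⟩
    have h2 : upperEnd s ≤ y := by
      refine csSup_le hne ?_
      rintro _ ⟨t, ht, rfl⟩
      by_contra hlt
      exact hys (hs.out hx ht ⟨hxy, (not_le.1 hlt).le⟩)
    rw [abs_le]
    constructor <;> linarith
  · right
    have h1 : lowerEnd s ≤ x := csInf_le hbB ⟨x, hx, rfl⟩
    have h2 : y ≤ lowerEnd s := by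
      refine le_csInf hne ?_
      rintro _ ⟨t, ht, rfl⟩
      by_contra hlt
      exact hys (hs.out ht hx ⟨(not_le.1 hlt).le, hxy⟩)
    rw [abs_le]
    constructor <;> linarith

open Classical in
/-- All but a bounded number of indices are interior. -/
lemma IsKernel.card_not_interior_le (hk : IsKernel ψ I K L c₀) (N r : ℕ) :
    (Finset.univ.filter fun i : Fin N => ¬ Interior I r i).card ≤ 2 * r + n * (2 * (2 * r + 1)) := by
  rcases Nat.eq_zero_or_pos N with rfl | hN
  · simp
  have hN' : (0 : ℝ) < N := by exact_mod_cast hN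
  set near : ℝ → Finset (Fin N) := fun x =>
    Finset.univ.filter fun i : Fin N => |((i : ℕ) : ℝ) - N * x| ≤ r with hnear
  -- An index fails to be interior only near an end of the index range or near one of the two ends
  -- of its piece.
  have hsub : (Finset.univ.filter fun i : Fin N => ¬ Interior I r i) ⊆
      ((Finset.univ.filter fun i : Fin N => (i : ℕ) < r) ∪
        (Finset.univ.filter fun i : Fin N => N ≤ (i : ℕ) + r)) ∪
      Finset.univ.biUnion fun α => near (upperEnd (I α)) ∪ near (lowerEnd (I α)) := by
    intro i hi
    have hi' : ¬ Interior I r i := (Finset.mem_filter.1 hi).2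
    simp only [Finset.mem_union, Finset.mem_filter, Finset.mem_univ, true_and, Finset.mem_biUnion,
      hnear]
    by_contra hcon
    push Not at hcon
    obtain ⟨⟨h1, h2⟩, h3⟩ := hcon
    refine hi' ⟨?_, h1, h2⟩
    obtain ⟨α, hα⟩ := hk.cover (gridPt i)
    refine ⟨α, ?_⟩
    by_contra hin
    have hscale : ∀ x : ℝ, |(gridPt i : ℝ) - x| ≤ (r : ℝ) / N → |((i : ℕ) : ℝ) - N * x| ≤ r := by
      intro x hx
      have e : ((i : ℕ) : ℝ) - N * x = N * ((gridPt i : ℝ) - x) := by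
        simp only [gridPt]; field_simp
      rw [e, abs_mul, abs_of_pos hN']
      rw [le_div_iff₀ hN'] at hx
      linarith
    rcases near_end_of_not_inside (hk.conn α) hα hin with h | h
    · exact absurd (hscale _ h) (not_le.2 (h3 α).1)
    · exact absurd (hscale _ h) (not_le.2 (h3 α).2)
  refine (Finset.card_le_card hsub).trans ((Finset.card_union_le _ _).trans ?_)
  have h1 : (Finset.univ.filter fun i : Fin N => (i : ℕ) < r).card ≤ r := by
    have := Finset.card_le_card_of_injOn (s := Finset.univ.filter fun i : Fin N => (i : ℕ) < r)
      (t := Finset.range r) (fun i => (i : ℕ)) (fun i hi => by simpa using hi)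
      (fun i _ j _ h => Fin.ext h)
    simpa using this
  have h2 : (Finset.univ.filter fun i : Fin N => N ≤ (i : ℕ) + r).card ≤ r := by
    have := Finset.card_le_card_of_injOn (s := Finset.univ.filter fun i : Fin N => N ≤ (i : ℕ) + r)
      (t := Finset.Ico (N - r) N) (fun i => (i : ℕ)) (fun i hi => by
        simp only [Finset.coe_filter, Set.mem_ofPred_eq, Finset.mem_univ, true_and] at hi
        simp only [Finset.coe_Ico, Set.mem_Ico]
        omega)
      (fun i _ j _ h => Fin.ext h)
    rw [Nat.card_Ico] at this
    omega
  have h3 : (Finset.univ.biUnion fun α => near (upperEnd (I α)) ∪ near (lowerEnd (I α))).card ≤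
      n * (2 * (2 * r + 1)) := by
    refine Finset.card_biUnion_le.trans ((Finset.sum_le_card_nsmul _ _ (2 * (2 * r + 1))
      fun α _ => ?_).trans (by simp))
    refine (Finset.card_union_le _ _).trans ?_
    have := card_near_le (N := N) (N * upperEnd (I α)) r
    have := card_near_le (N := N) (N * lowerEnd (I α)) r
    simp only [hnear]
    omega
  have h4 := Finset.card_union_le (Finset.univ.filter fun i : Fin N => (i : ℕ) < r)
    (Finset.univ.filter fun i : Fin N => N ≤ (i : ℕ) + r)
  omega

end Good

/-! ### Riemann sums -/

section Riemann

variable {N : ℕ}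

/-- The cell `[j/N, (j+1)/N)`. -/
def cell (j : Fin N) : Set UnitIco :=
  Subtype.val ⁻¹' Set.Ico (((j : ℕ) : ℝ) / N) ((((j : ℕ) : ℝ) + 1) / N)

lemma measurableSet_cell (j : Fin N) : MeasurableSet (cell j) :=
  measurable_subtype_coe measurableSet_Ico

lemma abs_sub_gridPt_le {j : Fin N} {θ : UnitIco} (h : θ ∈ cell j) :
    |(θ : ℝ) - gridPt j| ≤ 1 / N := by
  have h1 : ((j : ℕ) : ℝ) / N ≤ θ := h.1
  have h2 : (θ : ℝ) < (((j : ℕ) : ℝ) + 1) / N := h.2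
  rw [add_div] at h2
  have e : (gridPt j : ℝ) = ((j : ℕ) : ℝ) / N := rfl
  have h3 : (0 : ℝ) ≤ 1 / N := by positivity
  rw [e, abs_le]
  constructor <;> linarith

lemma lebIco_real_cell (j : Fin N) : lebIco.real (cell j) = (N : ℝ)⁻¹ := by
  have hN : (0 : ℝ) < N := by exact_mod_cast (Nat.zero_le _).trans_lt j.2
  have hj : ((j : ℕ) : ℝ) + 1 ≤ N := by exact_mod_cast j.2
  rw [Measure.real, lebIco, Measure.comap_apply _ Subtype.val_injective
    (fun s hs => measurableSet_Ico.subtype_image hs) _ (measurableSet_cell j), cell,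
    Subtype.image_preimage_coe, Set.inter_eq_self_of_subset_right, Real.volume_Ico,
    ENNReal.toReal_ofReal]
  · field_simp; ring
  · rw [sub_nonneg]; gcongr; linarith
  · intro x hx
    exact ⟨le_trans (by positivity) hx.1, hx.2.trans_le ((div_le_one hN).2 hj)⟩

lemma exists_mem_cell (hN : 0 < N) (θ : UnitIco) : ∃ j : Fin N, θ ∈ cell j := by
  have hN' : (0 : ℝ) < N := by exact_mod_cast hN
  have h0 := θ.2.1
  have h1 := θ.2.2
  have hf : ⌊(θ : ℝ) * N⌋₊ < N := by
    rw [Nat.floor_lt (by positivity)]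
    nlinarith
  refine ⟨⟨⌊(θ : ℝ) * N⌋₊, hf⟩, ?_, ?_⟩
  · rw [div_le_iff₀ hN']; exact Nat.floor_le (by positivity)
  · rw [lt_div_iff₀ hN']; exact Nat.lt_floor_add_one _

lemma eq_of_mem_cell {j j' : Fin N} {θ : UnitIco} (h : θ ∈ cell j) (h' : θ ∈ cell j') : j = j' := by
  have hN : (0 : ℝ) < N := by exact_mod_cast (Nat.zero_le _).trans_lt j.2
  have key : ∀ a b : Fin N, θ ∈ cell a → θ ∈ cell b → (a : ℕ) ≤ b := by
    intro a b ha hb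
    have h1 : ((a : ℕ) : ℝ) / N < (((b : ℕ) : ℝ) + 1) / N := lt_of_le_of_lt ha.1 hb.2
    have h2 : ((a : ℕ) : ℝ) < ((b : ℕ) : ℝ) + 1 := (div_lt_div_iff_of_pos_right hN).1 h1
    have h3 : (a : ℕ) < (b : ℕ) + 1 := by exact_mod_cast h2
    omega
  exact Fin.ext (le_antisymm (key _ _ h h') (key _ _ h' h))

lemma sum_indicator_cell {E : Type*} [AddCommMonoid E] (c : Fin N → E) {j : Fin N} {θ : UnitIco}
    (h : θ ∈ cell j) : ∑ i, (cell i).indicator (fun _ => c i) θ = c j := by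
  rw [Finset.sum_eq_single j, Set.indicator_of_mem h]
  · intro i _ hij
    exact Set.indicator_of_notMem (fun hi => hij (eq_of_mem_cell hi h)) _
  · simp

/-- The Riemann sum is the integral of the step function with value f(j/N) on the cell of j, which
has mass 1/N. -/
lemma norm_integral_sub_sum_le (hN : 0 < N) {f : UnitIco → ℂ} (hf : Integrable f lebIco)
    {c : Fin N → ℝ} (h : ∀ j, ∀ θ ∈ cell j, ‖f θ - f (gridPt j)‖ ≤ c j) :
    ‖∫ θ, f θ ∂lebIco - (N : ℂ)⁻¹ * ∑ j : Fin N, f (gridPt j)‖ ≤ (N : ℝ)⁻¹ * ∑ j, c j := by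
  have hInt : ∀ {E : Type} [NormedAddCommGroup E] [NormedSpace ℝ E] (d : Fin N → E),
      ∀ j ∈ Finset.univ, Integrable ((cell j).indicator fun _ => d j) lebIco := fun d j _ =>
    (integrable_const _).indicator (measurableSet_cell j)
  have e : ∀ {E : Type} [NormedAddCommGroup E] [NormedSpace ℝ E] [CompleteSpace E] (d : Fin N → E),
      ∫ θ, ∑ j, (cell j).indicator (fun _ => d j) θ ∂lebIco = (N : ℝ)⁻¹ • ∑ j, d j := by
    intro E _ _ _ d
    rw [integral_finsetSum _ (hInt d), Finset.smul_sum]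
    refine Finset.sum_congr rfl fun j _ => ?_
    rw [integral_indicator_const _ (measurableSet_cell j), lebIco_real_cell]
  have e1 := e fun j => f (gridPt j)
  have e2 := e c
  rw [smul_eq_mul] at e2
  have e3 : (N : ℂ)⁻¹ * ∑ j : Fin N, f (gridPt j) = (N : ℝ)⁻¹ • ∑ j : Fin N, f (gridPt j) := by
    rw [Complex.real_smul]; push_cast; rfl
  rw [e3, ← e1, ← e2, ← integral_sub hf (integrable_finsetSum _ (hInt _))]
  refine norm_integral_le_of_norm_le (integrable_finsetSum _ (hInt c))
    (Filter.Eventually.of_forall fun θ => ?_)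
  obtain ⟨j, hj⟩ := exists_mem_cell hN θ
  rw [sum_indicator_cell _ hj, sum_indicator_cell c hj]
  exact h j θ hj

end Riemann

end CorrelatedMatrix

end

noncomputable section

namespace CorrelatedMatrix

open scoped Matrix.Norms.L2Operator

/-! ### Consistency of the discretization -/

section Consistency

variable {ψ : UnitIco → UnitIco → ℤ → ℤ → ℝ} {n : ℕ} {I : Fin n → Set UnitIco}
  {K : ℕ} {L c₀ b ℓ C w : ℝ} {m : UnitIco → ℤ → ℂ} {z : ℂ} {N : ℕ}
  {ξ : Fin N → Fin N → Fin N → Fin N → ℝ}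

/-- A bound for the number of indices which are not interior. -/
def boundaryCount (n r : ℕ) : ℝ := 2 * r + n * (2 * (2 * r + 1))

lemma boundaryCount_nonneg (n r : ℕ) : 0 ≤ boundaryCount n r := by
  unfold boundaryCount; positivity

/-- Typical use: a is O(1/N), c is O(1), and exceptions are bounded in number, so the sum is O(1).
-/
lemma sum_ite_le {ι : Type*} [Fintype ι] {P : ι → Prop} [DecidablePred P] {a B c : ℝ} (ha : 0 ≤ a) (hc : 0 ≤ c)
    (hB : ((Finset.univ.filter fun i => ¬ P i).card : ℝ) ≤ B) :
    ∑ i, (if P i then a else c) ≤ Fintype.card ι * a + B * c := by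
  have h : ∀ i, (if P i then a else c) ≤ a + if ¬ P i then c else 0 := by
    intro i; split_ifs <;> simp_all
  refine (Finset.sum_le_sum fun i _ => h i).trans ?_
  rw [Finset.sum_add_distrib, ← Finset.sum_filter, Finset.sum_const, Finset.sum_const,
    nsmul_eq_mul, nsmul_eq_mul, Finset.card_univ]
  have := mul_le_mul_of_nonneg_right hB hc
  linarith

open Classical in
lemma IsKernel.card_not_interior_le' (hk : IsKernel ψ I K L c₀) (N r : ℕ) :
    ((Finset.univ.filter fun i : Fin N => ¬ Interior I r i).card : ℝ) ≤ boundaryCount n r := by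
  have := hk.card_not_interior_le N r
  rw [boundaryCount]
  exact_mod_cast this

/-- The tensor `ξ` agrees with its limit up to `C / N` away from the discontinuities, and has the
symmetry of a covariance tensor. -/
structure IsNearKernel (K : ℕ) (ψ : UnitIco → UnitIco → ℤ → ℤ → ℝ) (I : Fin n → Set UnitIco)
    (C : ℝ) (ξ : Fin N → Fin N → Fin N → Fin N → ℝ) : Prop where
  banded : BandedTensor K ξ
  near : ∀ i j k l, Interior I (K + 1) i → Interior I (K + 1) j → |idxDiff i k| ≤ K →
    |idxDiff j l| ≤ K → 2 * (K : ℤ) < |idxDiff i j| →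
    |ξ i j k l - ψ (gridPt i) (gridPt j) (idxDiff i k) (idxDiff j l)| ≤ C / N

/-- For |i − j| > 2K the positions (i, j) and (k, l) lie on the same side of the diagonal, so no
mixed case occurs; below it the symmetries of ξ and ψ apply. The radius K + 1 gives strict room
beyond the excluded distance K/N. -/
lemma exists_isNearKernel {ξ : ∀ N : ℕ, Fin N → Fin N → Fin N → Fin N → ℝ} (hI : IsPieces ψ I)
    (hξ : IsDiscretization K ψ ξ) (hb : ∀ N, BandedTensor K (ξ N))
    (hswap : ∀ θ φ k l, ψ θ φ k l = ψ φ θ l k)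
    (hsym : ∀ N i j k l, j < i → l < k → ξ N i j k l = ξ N j i l k) :
    ∃ C, 0 ≤ C ∧ ∀ N, IsNearKernel K ψ I C (ξ N) := by
  obtain ⟨C, hC⟩ := hξ
  refine ⟨|C|, abs_nonneg C, fun N => ⟨hb N, fun i j k l hi hj hik hjl hij => ?_⟩⟩
  have hN : (0 : ℝ) < N := by exact_mod_cast (Nat.zero_le _).trans_lt i.2
  have hle : C / N ≤ |C| / N := by gcongr; exact le_abs_self C
  obtain ⟨⟨α, hα⟩, -, -⟩ := hi
  obtain ⟨⟨β, hβ⟩, -, -⟩ := hj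
  have hlt : (K : ℝ) / N < ((K + 1 : ℕ) : ℝ) / N := by
    push_cast; gcongr; linarith
  refine le_trans ?_ hle
  rw [abs_le] at hik hjl
  rcases lt_abs.1 hij with h | h
  · simp only [idxDiff] at hik hjl h
    exact hC N i j k l (Fin.le_def.2 (by omega)) (Fin.le_def.2 (by omega))
      (not_nearDiscontinuity hI hlt hα hβ _ _)
  · simp only [idxDiff] at hik hjl h
    rw [hsym N i j k l (Fin.lt_def.2 (by omega)) (Fin.lt_def.2 (by omega)), hswap]
    exact hC N j i l k (Fin.le_def.2 (by omega)) (Fin.le_def.2 (by omega))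
      (not_nearDiscontinuity hI hlt hβ hα _ _)

lemma sum_Icc_eq_sum_band {E : Type*} [AddCommMonoid E] (g : ℤ → E) {i : Fin N} (h1 : K ≤ (i : ℕ))
    (h2 : (i : ℕ) + K < N) :
    ∑ κ ∈ Finset.Icc (-(K : ℤ)) K, g κ =
      ∑ k : Fin N, if |idxDiff i k| ≤ K then g (idxDiff i k) else 0 := by
  rw [← Finset.sum_filter]
  symm
  refine Finset.sum_bij (fun k _ => idxDiff i k) ?_ ?_ ?_ ?_
  · intro k hk
    exact Finset.mem_Icc.2 (abs_le.1 (Finset.mem_filter.1 hk).2)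
  · intro k _ k' _ h
    exact idxDiff_injective i h
  · intro κ hκ
    rw [Finset.mem_Icc] at hκ
    have hmem : ((i : ℕ) + κ).toNat < N := by omega
    have e : idxDiff i ⟨((i : ℕ) + κ).toNat, hmem⟩ = κ := by simp only [idxDiff]; omega
    refine ⟨⟨((i : ℕ) + κ).toNat, hmem⟩, ?_, e⟩
    rw [Finset.mem_filter, e]
    exact ⟨Finset.mem_univ _, abs_le.2 hκ⟩
  · intro k _; rfl

lemma IsProfile.norm_sub_le (hm : IsProfile I b ℓ m) {α : Fin n} {θ θ' : UnitIco} (hθ : θ ∈ I α)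
    (hθ' : θ' ∈ I α) (k : ℤ) : ‖m θ k - m θ' k‖ ≤ ℓ * |(θ : ℝ) - θ'| := by
  have h := hm.sum_sq_sub_le α θ hθ θ' hθ' {k}
  rw [Finset.sum_singleton] at h
  exact abs_le_of_sq_le_sq' h (mul_nonneg hm.nonneg (abs_nonneg _)) |>.2

lemma norm_toLp_comp_idxDiff_le {a : ℤ → ℂ} {c : ℝ} (hc : 0 ≤ c)
    (h : ∀ s : Finset ℤ, ∑ k ∈ s, ‖a k‖ ^ 2 ≤ c ^ 2) (k : Fin N) :
    ‖WithLp.toLp 2 (fun l : Fin N => a (idxDiff k l))‖ ≤ c := by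
  refine abs_le_of_sq_le_sq' ?_ hc |>.2
  rw [EuclideanSpace.norm_sq_eq]
  have := h (Finset.univ.map ⟨idxDiff k, idxDiff_injective k⟩)
  rw [Finset.sum_map] at this
  exact this

/-- The constant of consistency for `Ξ`. -/
def xiConst (n K : ℕ) (L b ℓ C : ℝ) : ℝ :=
  (2 * K + 1) * (C * b + (L * b + ℓ)) +
    (boundaryCount n (K + 1) + (2 * (2 * K) + 1) + boundaryCount n (K + 1)) * (2 * ((2 * K + 1) * b))

lemma norm_sum_band_le {f : Fin N → ℂ} (i : Fin N) {c : ℝ} (hc : 0 ≤ c)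
    (h : ∀ j, |idxDiff i j| ≤ K → ‖f j‖ ≤ c) (h0 : ∀ j, ¬ |idxDiff i j| ≤ K → f j = 0) :
    ‖∑ j, f j‖ ≤ (2 * K + 1) * c := by
  refine (norm_sum_le _ _).trans ?_
  have e : ∀ j, ‖f j‖ = if |idxDiff i j| ≤ K then ‖f j‖ else 0 := by
    intro j
    split_ifs with hj
    · rfl
    · rw [h0 j hj, norm_zero]
  rw [Finset.sum_congr rfl fun j _ => e j]
  exact sum_band_le i hc h

lemma norm_sum_Icc_le {f : ℤ → ℂ} {c : ℝ} (h : ∀ k, ‖f k‖ ≤ c) :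
    ‖∑ k ∈ Finset.Icc (-(K : ℤ)) K, f k‖ ≤ (2 * K + 1) * c := by
  refine (norm_sum_le _ _).trans ((Finset.sum_le_sum fun k _ => h k).trans ?_)
  rw [Finset.sum_const, nsmul_eq_mul, card_Icc_neg]

open Classical in
lemma norm_Xi_sub_Psi_le (hk : IsKernel ψ I K L c₀) (hC : 0 ≤ C) (hξ : IsNearKernel K ψ I C ξ)
    (hm : IsProfile I b ℓ m) {i k : Fin N} (hi : Interior I (K + 1) i) (hik : |idxDiff i k| ≤ K) :
    ‖Xi ξ (discretize N m) i k - Psi ψ m (gridPt i) (idxDiff i k)‖ ≤ xiConst n K L b ℓ C / N := by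
  have hN0 : 0 < N := (Nat.zero_le _).trans_lt i.2
  have hN : (0 : ℝ) < N := by exact_mod_cast hN0
  have hb := hm.bdd.nonneg
  have hℓ := hm.nonneg
  have hL := hk.nonneg
  set θ := gridPt i
  set κ := idxDiff i k
  set f : UnitIco → ℂ := fun φ => ∑ l ∈ Finset.Icc (-(K : ℤ)) K, (ψ θ φ κ l : ℂ) * m φ l with hf
  set X : Fin N → ℂ := fun j => ∑ l, (ξ i j k l : ℂ) * m (gridPt j) (idxDiff j l) with hX
  have hfn : ∀ φ, ‖f φ‖ ≤ (2 * K + 1) * b := fun φ =>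
    norm_sum_Icc_le fun l => hk.norm_mul_le hm.bdd θ φ κ l
  have hξm : ∀ j l, ‖(ξ i j k l : ℂ) * m (gridPt j) (idxDiff j l)‖ ≤ b := by
    intro j l
    rw [norm_mul, Complex.norm_real, Real.norm_eq_abs]
    exact (mul_le_mul (hξ.banded.abs_le i j k l) (hm.bdd.bound _ _) (norm_nonneg _)
      zero_le_one).trans (one_mul b).le
  have hξ0 : ∀ j l, ¬ |idxDiff j l| ≤ K → ξ i j k l = 0 := by
    intro j l hjl
    by_contra h
    exact hjl (hξ.banded.eq_zero i j k l h).2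
  have hXn : ∀ j, ‖X j‖ ≤ (2 * K + 1) * b := fun j =>
    norm_sum_band_le j hb (fun l _ => hξm j l) fun l hl => by rw [hξ0 j l hl]; simp
  have e1 : Xi ξ (discretize N m) i k = (N : ℂ)⁻¹ * ∑ j, X j := by
    simp only [Xi, discretize, Matrix.of_apply, hX]
  have e2 : Psi ψ m θ κ = ∫ φ, f φ ∂lebIco := by
    rw [hk.Psi_eq_sum, hf, integral_finsetSum _ fun l _ => hk.integrable hm.bdd θ κ l]
  have hfint : Integrable f lebIco :=
    integrable_finsetSum _ fun l _ => hk.integrable hm.bdd θ κ l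
  obtain ⟨⟨α, hα⟩, -, -⟩ := id hi
  have hθα : θ ∈ I α := hα θ (by simp only [θ, sub_self, abs_zero]; positivity)
  -- replacing `ξ` by `ψ`
  have hA : ∀ j, ‖X j - f (gridPt j)‖ ≤
      if Interior I (K + 1) j ∧ ¬ |idxDiff i j| ≤ (2 * K : ℕ) then (2 * K + 1) * (C / N * b)
      else 2 * ((2 * K + 1) * b) := by
    intro j
    split_ifs with h
    · obtain ⟨hj, hij⟩ := h
      have hij' : 2 * (K : ℤ) < |idxDiff i j| := by push_cast at hij; exact not_le.1 hij
      rw [hf]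
      simp only
      rw [sum_Icc_eq_sum_band _ (by have := hj.2.1; omega : K ≤ (j : ℕ))
        (by have := hj.2.2; omega), hX]
      simp only
      rw [← Finset.sum_sub_distrib]
      refine norm_sum_band_le j (by positivity) (fun l hl => ?_) fun l hl => ?_
      · rw [if_pos hl, ← sub_mul, norm_mul, ← Complex.ofReal_sub, Complex.norm_real,
          Real.norm_eq_abs]
        exact mul_le_mul (hξ.near i j k l hi hj hik hl hij') (hm.bdd.bound _ _) (norm_nonneg _)
          (by positivity)
      · rw [if_neg hl, hξ0 j l hl]; simp
    · refine (norm_sub_le _ _).trans ?_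
      linarith [hXn j, hfn (gridPt j)]
  -- The error of the Riemann sum. Radius K + 1 ≥ 1 puts the whole cell of an interior index into
  -- one piece, where both ψ and m are Lipschitz.
  have hB : ∀ j : Fin N, ∀ φ ∈ cell j, ‖f φ - f (gridPt j)‖ ≤
      if Interior I (K + 1) j then (2 * K + 1) * ((L * b + ℓ) / N) else 2 * ((2 * K + 1) * b) := by
    intro j φ hφ
    split_ifs with hj
    · obtain ⟨⟨β, hβ⟩, -, -⟩ := hj
      have hd := abs_sub_gridPt_le hφ
      have hd' : (1 : ℝ) / N ≤ ((K + 1 : ℕ) : ℝ) / N := by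
        push_cast; gcongr; linarith [(Nat.cast_nonneg K : (0 : ℝ) ≤ K)]
      have hφβ : φ ∈ I β := hβ φ (hd.trans hd')
      have hjβ : gridPt j ∈ I β := hβ _ (by rw [sub_self, abs_zero]; positivity)
      rw [hf]
      simp only
      rw [← Finset.sum_sub_distrib]
      refine norm_sum_Icc_le fun l => ?_
      have h1 := hk.lip α β κ l θ hθα φ hφβ θ hθα (gridPt j) hjβ
      rw [sub_self, abs_zero, max_eq_right (abs_nonneg _)] at h1
      have h2 := hm.norm_sub_le hφβ hjβ l
      have e : (ψ θ φ κ l : ℂ) * m φ l - (ψ θ (gridPt j) κ l : ℂ) * m (gridPt j) l =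
          ((ψ θ φ κ l - ψ θ (gridPt j) κ l : ℝ) : ℂ) * m φ l +
          (ψ θ (gridPt j) κ l : ℂ) * (m φ l - m (gridPt j) l) := by
        push_cast; ring
      rw [e]
      refine (norm_add_le _ _).trans ?_
      rw [norm_mul, norm_mul, Complex.norm_real, Complex.norm_real, Real.norm_eq_abs,
        Real.norm_eq_abs]
      have h3 : |ψ θ φ κ l - ψ θ (gridPt j) κ l| * ‖m φ l‖ ≤ L * (1 / N) * b :=
        mul_le_mul (h1.trans (mul_le_mul_of_nonneg_left hd hL)) (hm.bdd.bound _ _) (norm_nonneg _)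
          (by positivity)
      have h4 : |ψ θ (gridPt j) κ l| * ‖m φ l - m (gridPt j) l‖ ≤ 1 * (ℓ * (1 / N)) :=
        mul_le_mul (hk.abs_le_one _ _ _ _) (h2.trans (mul_le_mul_of_nonneg_left hd hℓ))
          (norm_nonneg _) zero_le_one
      calc _ ≤ L * (1 / N) * b + 1 * (ℓ * (1 / N)) := add_le_add h3 h4
        _ = (L * b + ℓ) / N := by ring
    · refine (norm_sub_le _ _).trans ?_
      linarith [hfn φ, hfn (gridPt j)]
  have hR := norm_integral_sub_sum_le hN0 hfint hB
  -- The exceptional j are the non-interior ones and those so close to i that a mixed case of ξ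
  -- could occur. Their number is bounded independently of N.
  have hcard : ((Finset.univ.filter fun j : Fin N =>
      ¬ (Interior I (K + 1) j ∧ ¬ |idxDiff i j| ≤ (2 * K : ℕ))).card : ℝ) ≤
      boundaryCount n (K + 1) + (2 * (2 * K) + 1) := by
    have hsub : (Finset.univ.filter fun j : Fin N =>
        ¬ (Interior I (K + 1) j ∧ ¬ |idxDiff i j| ≤ (2 * K : ℕ))) ⊆
        (Finset.univ.filter fun j : Fin N => ¬ Interior I (K + 1) j) ∪
        (Finset.univ.filter fun j : Fin N => |idxDiff i j| ≤ (2 * K : ℕ)) := by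
      intro j hj
      simp only [Finset.mem_filter, Finset.mem_univ, true_and, Finset.mem_union] at hj ⊢
      tauto
    have h1 := (Finset.card_le_card hsub).trans (Finset.card_union_le _ _)
    have h2 := card_band_le (2 * K) i
    have h3 := hk.card_not_interior_le' N (K + 1)
    have h4 : ((Finset.univ.filter fun j : Fin N =>
        ¬ (Interior I (K + 1) j ∧ ¬ |idxDiff i j| ≤ (2 * K : ℕ))).card : ℝ) ≤
        (Finset.univ.filter fun j : Fin N => ¬ Interior I (K + 1) j).card + (2 * (2 * K) + 1) := by
      exact_mod_cast h1.trans (Nat.add_le_add_left h2 _)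
    linarith
  have hS1 := sum_ite_le (P := fun j : Fin N => Interior I (K + 1) j ∧ ¬ |idxDiff i j| ≤ (2 * K : ℕ))
    (a := (2 * K + 1) * (C / N * b)) (c := 2 * ((2 * K + 1) * b)) (by positivity) (by positivity) hcard
  have hS2 := sum_ite_le (P := fun j : Fin N => Interior I (K + 1) j)
    (a := (2 * K + 1) * ((L * b + ℓ) / N)) (c := 2 * ((2 * K + 1) * b)) (by positivity)
    (by positivity) (hk.card_not_interior_le' N (K + 1))
  rw [Fintype.card_fin] at hS1 hS2
  have hD : ‖(N : ℂ)⁻¹ * ∑ j, X j - (N : ℂ)⁻¹ * ∑ j : Fin N, f (gridPt j)‖ ≤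
      (N : ℝ)⁻¹ * ∑ j, (if Interior I (K + 1) j ∧ ¬ |idxDiff i j| ≤ (2 * K : ℕ) then
        (2 * K + 1) * (C / N * b) else 2 * ((2 * K + 1) * b)) := by
    rw [← mul_sub, ← Finset.sum_sub_distrib, norm_mul, norm_inv, Complex.norm_natCast]
    refine mul_le_mul_of_nonneg_left ?_ (by positivity)
    exact (norm_sum_le _ _).trans (Finset.sum_le_sum fun j _ => hA j)
  rw [e1, e2]
  rw [norm_sub_rev] at hR
  refine (norm_sub_le_norm_sub_add_norm_sub _ ((N : ℂ)⁻¹ * ∑ j : Fin N, f (gridPt j)) _).trans ?_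
  refine (add_le_add hD hR).trans ?_
  have hfin := mul_le_mul_of_nonneg_left (add_le_add hS1 hS2) (inv_nonneg.2 hN.le)
  rw [← mul_add]
  refine hfin.trans (le_of_eq ?_)
  rw [xiConst]
  field_simp
  ring

end Consistency

end CorrelatedMatrix

end

noncomputable section

namespace CorrelatedMatrix

open scoped Matrix.Norms.L2Operator

/-! ### The defect of the discretized solution -/

section Defect

variable {ψ : UnitIco → UnitIco → ℤ → ℤ → ℝ} {n : ℕ} {I : Fin n → Set UnitIco}
  {K : ℕ} {L c₀ b ℓ C w : ℝ} {m : UnitIco → ℤ → ℂ} {z : ℂ} {N : ℕ}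
  {ξ : Fin N → Fin N → Fin N → Fin N → ℝ}

/-- The Euclidean norm of a row of a matrix. -/
def rowNorm (A : Matrix (Fin N) (Fin N) ℂ) (i : Fin N) : ℝ := ‖WithLp.toLp 2 (A i)‖

/-- The row vector `(m(θ, l - k))_l`. -/
def shiftRow (N : ℕ) (a : ℤ → ℂ) (k : Fin N) : EuclideanSpace ℂ (Fin N) :=
  WithLp.toLp 2 fun l => a (idxDiff k l)

lemma IsProfile.norm_shiftRow_le (hm : IsProfile I b ℓ m) (θ : UnitIco) (k : Fin N) :
    ‖shiftRow N (m θ) k‖ ≤ b :=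
  norm_toLp_comp_idxDiff_le hm.bdd.nonneg (hm.sum_sq_le θ) k

lemma IsProfile.norm_shiftRow_sub_le (hm : IsProfile I b ℓ m) {α : Fin n} {θ θ' : UnitIco}
    (hθ : θ ∈ I α) (hθ' : θ' ∈ I α) (k : Fin N) :
    ‖shiftRow N (m θ) k - shiftRow N (m θ') k‖ ≤ ℓ * |(θ : ℝ) - θ'| :=
  norm_toLp_comp_idxDiff_le (a := fun l => m θ l - m θ' l)
    (mul_nonneg hm.nonneg (abs_nonneg _)) (hm.sum_sq_sub_le α θ hθ θ' hθ') k

lemma denomMatrix_mul_apply (A : Matrix (Fin N) (Fin N) ℂ) (i l : Fin N) :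
    (denomMatrix ξ z A * A) i l = -z * A i l - ∑ k, Xi ξ A i k * A k l := by
  rw [denomMatrix, Matrix.sub_mul, Matrix.sub_apply, Matrix.neg_mul, Matrix.smul_mul, Matrix.one_mul,
    Matrix.neg_apply, Matrix.smul_apply, smul_eq_mul, Matrix.mul_apply, neg_mul]

lemma BandedTensor.Xi_eq_zero (hb : BandedTensor K ξ) (A : Matrix (Fin N) (Fin N) ℂ) {i k : Fin N}
    (h : ¬ |idxDiff i k| ≤ K) : Xi ξ A i k = 0 := by
  have := hb.norm_apply_le A i k
  rw [if_neg h] at this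
  exact norm_le_zero_iff.1 this

lemma IsProfile.norm_Xi_apply_le (hb : BandedTensor K ξ) (hm : IsProfile I b ℓ m) (i k : Fin N) :
    ‖Xi ξ (discretize N m) i k‖ ≤ (2 * K + 1) * b := by
  have hb0 := hm.bdd.nonneg
  have hN : (0 : ℝ) < N := by exact_mod_cast (Nat.zero_le _).trans_lt i.2
  refine (hb.norm_apply_le _ i k).trans ?_
  split_ifs
  · rw [inv_mul_le_iff₀ hN]
    refine (Finset.sum_le_card_nsmul _ _ ((2 * K + 1) * b) fun j _ =>
      sum_band_le j hb0 fun l _ => hm.bdd.bound _ _).trans ?_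
    simp
  · positivity

lemma norm_sum_ite_band_le {E : Type*} [SeminormedAddCommGroup E] {f : Fin N → E} (i : Fin N)
    {c : ℝ} (hc : 0 ≤ c) (h : ∀ j, |idxDiff i j| ≤ K → ‖f j‖ ≤ c) :
    ‖∑ j, (if |idxDiff i j| ≤ K then f j else 0)‖ ≤ (2 * K + 1) * c := by
  refine (norm_sum_le _ _).trans ?_
  have e : ∀ j, ‖if |idxDiff i j| ≤ K then f j else 0‖ =
      if |idxDiff i j| ≤ K then ‖f j‖ else 0 := by
    intro j; split_ifs <;> simp
  simp only [e]
  exact sum_band_le i hc h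

/-- The size of the defect on interior rows, up to the factor `N⁻¹`. -/
def interiorConst (n K : ℕ) (L b ℓ C : ℝ) : ℝ :=
  (2 * K + 1) * (xiConst n K L b ℓ C * b + (2 * K + 1) * b * (ℓ * (K + 1)))

lemma xiConst_nonneg (hL : 0 ≤ L) (hb : 0 ≤ b) (hℓ : 0 ≤ ℓ) (hC : 0 ≤ C) :
    0 ≤ xiConst n K L b ℓ C := by
  have := boundaryCount_nonneg n (K + 1)
  unfold xiConst; positivity

lemma interiorConst_nonneg (hL : 0 ≤ L) (hb : 0 ≤ b) (hℓ : 0 ≤ ℓ) (hC : 0 ≤ C) :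
    0 ≤ interiorConst n K L b ℓ C := by
  have := xiConst_nonneg (n := n) (K := K) hL hb hℓ hC
  unfold interiorConst; positivity

/-- The limiting equation at θ = i/N is subtracted. Two errors remain, both over the band: Ξ against
Ψ, and row k of the discretization, which uses m(k/N), against the shifted row of m(i/N). The latter
is small in ℓ² by the Lipschitz bound. -/
lemma rowNorm_defect_le_of_interior (hk : IsKernel ψ I K L c₀) (hC : 0 ≤ C)
    (hξ : IsNearKernel K ψ I C ξ) (hm : IsProfile I b ℓ m)
    (heq : ∀ θ k, -z * m θ k - ∑ κ ∈ Finset.Icc (-(K : ℤ)) K, Psi ψ m θ κ * m θ (k - κ) =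
      if k = 0 then 1 else 0) {i : Fin N} (hi : Interior I (K + 1) i) :
    rowNorm (denomMatrix ξ z (discretize N m) * discretize N m - 1) i ≤
      interiorConst n K L b ℓ C / N := by
  have hN : (0 : ℝ) < N := by exact_mod_cast (Nat.zero_le _).trans_lt i.2
  have hb0 := hm.bdd.nonneg
  have hℓ := hm.nonneg
  have hxi := xiConst_nonneg (n := n) (K := K) hk.nonneg hb0 hℓ hC
  set P : Fin N → ℂ := fun k => Psi ψ m (gridPt i) (idxDiff i k) with hP
  set X : Fin N → ℂ := fun k => Xi ξ (discretize N m) i k with hX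
  have e : WithLp.toLp 2 ((denomMatrix ξ z (discretize N m) * discretize N m - 1) i) =
      ∑ k, if |idxDiff i k| ≤ K then -((X k - P k) • shiftRow N (m (gridPt k)) k) +
        P k • (shiftRow N (m (gridPt i)) k - shiftRow N (m (gridPt k)) k) else 0 := by
    ext l
    have h1 := heq (gridPt i) (idxDiff i l)
    rw [sum_Icc_eq_sum_band _ (by have := hi.2.1; omega : K ≤ (i : ℕ))
      (by have := hi.2.2; omega)] at h1
    have h2 : ((1 : Matrix (Fin N) (Fin N) ℂ) i l) = if idxDiff i l = 0 then 1 else 0 := by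
      rw [Matrix.one_apply]
      congr 1
      simp only [idxDiff, Fin.ext_iff, eq_iff_iff]
      omega
    have h3 : ∀ k, Xi ξ (discretize N m) i k * discretize N m k l =
        if |idxDiff i k| ≤ K then X k * m (gridPt k) (idxDiff k l) else 0 := by
      intro k
      split_ifs with hik
      · rfl
      · rw [hξ.banded.Xi_eq_zero _ hik, zero_mul]
    have h4 : ∀ k, idxDiff i l - idxDiff i k = idxDiff k l := by
      intro k; simp only [idxDiff]; ring
    simp only [h4] at h1
    rw [WithLp.ofLp_toLp, Matrix.sub_apply, denomMatrix_mul_apply, h2, ← h1]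
    simp only [h3]
    simp only [discretize, Matrix.of_apply, WithLp.ofLp_sum, Finset.sum_apply]
    rw [sub_sub_sub_cancel_left, ← Finset.sum_sub_distrib]
    refine Finset.sum_congr rfl fun k _ => ?_
    split_ifs with hik
    · simp only [shiftRow, PiLp.add_apply, PiLp.neg_apply, PiLp.smul_apply, PiLp.sub_apply,
        smul_eq_mul, hP]
      ring
    · simp
  rw [rowNorm, e]
  have hbound : ∀ k, |idxDiff i k| ≤ K → ‖-((X k - P k) • shiftRow N (m (gridPt k)) k) +
      P k • (shiftRow N (m (gridPt i)) k - shiftRow N (m (gridPt k)) k)‖ ≤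
      (xiConst n K L b ℓ C * b + (2 * K + 1) * b * (ℓ * (K + 1))) / N := by
    intro k hik
    obtain ⟨⟨α, hα⟩, -, -⟩ := id hi
    have hiα : gridPt i ∈ I α := hα _ (by rw [sub_self, abs_zero]; positivity)
    have hd : |(gridPt k : ℝ) - gridPt i| ≤ ((K + 1 : ℕ) : ℝ) / N := by
      have e1 : (gridPt k : ℝ) - gridPt i = ((idxDiff i k : ℤ) : ℝ) / N := by
        simp only [gridPt, idxDiff]; push_cast; ring
      rw [e1, abs_div, abs_of_pos hN]
      gcongr
      have : |((idxDiff i k : ℤ) : ℝ)| ≤ (K : ℝ) := by exact_mod_cast hik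
      push_cast; linarith
    have hkα : gridPt k ∈ I α := hα _ hd
    have h1 := norm_Xi_sub_Psi_le hk hC hξ hm hi hik
    have h2 := hm.norm_shiftRow_le (N := N) (gridPt k) k
    have h3 := hm.norm_shiftRow_sub_le (N := N) hiα hkα k
    have h4 := hk.norm_Psi_le hm.bdd (gridPt i) (idxDiff i k)
    rw [abs_sub_comm] at hd
    refine (norm_add_le _ _).trans ?_
    rw [norm_neg, norm_smul, norm_smul]
    have h5 : ‖X k - P k‖ * ‖shiftRow N (m (gridPt k)) k‖ ≤ xiConst n K L b ℓ C / N * b :=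
      mul_le_mul h1 h2 (norm_nonneg _) (by positivity)
    have h6 : ‖P k‖ * ‖shiftRow N (m (gridPt i)) k - shiftRow N (m (gridPt k)) k‖ ≤
        ((2 * K + 1) * b) * (ℓ * (((K + 1 : ℕ) : ℝ) / N)) :=
      mul_le_mul h4 (h3.trans (mul_le_mul_of_nonneg_left hd hℓ)) (norm_nonneg _) (by positivity)
    refine (add_le_add h5 h6).trans (le_of_eq ?_)
    push_cast
    ring
  refine (norm_sum_ite_band_le i (by positivity) hbound).trans (le_of_eq ?_)
  rw [interiorConst]; ring

/-- The size of the defect on boundary rows. -/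
def boundaryConst (K : ℕ) (b Z : ℝ) : ℝ := Z * b + (2 * K + 1) * ((2 * K + 1) * b * b) + 1

/-- No regularity is available near the ends of pieces, but a bound of order 1 suffices for
boundedly many rows. -/
lemma rowNorm_defect_le {Z : ℝ} (hZ : ‖z‖ ≤ Z) (hb : BandedTensor K ξ) (hm : IsProfile I b ℓ m)
    (i : Fin N) :
    rowNorm (denomMatrix ξ z (discretize N m) * discretize N m - 1) i ≤ boundaryConst K b Z := by
  have hb0 := hm.bdd.nonneg
  have hZ0 := (norm_nonneg z).trans hZ
  set X : Fin N → ℂ := fun k => Xi ξ (discretize N m) i k with hX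
  have e : WithLp.toLp 2 ((denomMatrix ξ z (discretize N m) * discretize N m - 1) i) =
      (-z) • shiftRow N (m (gridPt i)) i -
      (∑ k, if |idxDiff i k| ≤ K then X k • shiftRow N (m (gridPt k)) k else 0) -
      EuclideanSpace.single i (1 : ℂ) := by
    ext l
    rw [WithLp.ofLp_toLp, Matrix.sub_apply, denomMatrix_mul_apply]
    simp only [PiLp.sub_apply, PiLp.smul_apply, shiftRow, WithLp.ofLp_sum, Finset.sum_apply,
      discretize, Matrix.of_apply, smul_eq_mul]
    congr 1
    · congr 1
      refine Finset.sum_congr rfl fun k _ => ?_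
      split_ifs with hik
      · simp [hX, discretize]
      · have := hb.Xi_eq_zero (discretize N m) hik
        rw [discretize] at this
        rw [this]; simp
    · rw [Matrix.one_apply]
      simp [eq_comm]
  rw [rowNorm, e]
  have h1 : ‖∑ k, (if |idxDiff i k| ≤ K then X k • shiftRow N (m (gridPt k)) k else 0)‖ ≤
      (2 * K + 1) * ((2 * K + 1) * b * b) := by
    refine norm_sum_ite_band_le i (by positivity) fun k _ => ?_
    rw [norm_smul]
    exact mul_le_mul (hm.norm_Xi_apply_le hb i k) (hm.norm_shiftRow_le _ _) (norm_nonneg _)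
      (by positivity)
  have h2 : ‖(-z) • shiftRow N (m (gridPt i)) i‖ ≤ Z * b := by
    rw [norm_smul, norm_neg]
    exact mul_le_mul hZ (hm.norm_shiftRow_le _ _) (norm_nonneg _) hZ0
  have h3 : ‖EuclideanSpace.single i (1 : ℂ)‖ = 1 := by simp
  refine (norm_sub_le _ _).trans ?_
  have := norm_sub_le ((-z) • shiftRow N (m (gridPt i)) i)
    (∑ k, (if |idxDiff i k| ≤ K then X k • shiftRow N (m (gridPt k)) k else 0))
  rw [boundaryConst]
  linarith

lemma sum_band_mul_le (a e : Fin N → ℝ) {α β : ℝ} (hα : 0 ≤ α) (hβ : 0 ≤ β)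
    (ha' : ∑ j, a j ^ 2 ≤ α ^ 2) (he' : ∑ j, e j ^ 2 ≤ β ^ 2) :
    ∑ j, ∑ l, (if |idxDiff j l| ≤ K then a j * e l else 0) ≤ (2 * K + 1) * (α * β) := by
  have e1 : ∑ j, ∑ l, (if |idxDiff j l| ≤ K then a j * e l else 0) =
      ∑ p : Fin N × Fin N, (if |idxDiff p.1 p.2| ≤ K then a p.1 else 0) *
        (if |idxDiff p.1 p.2| ≤ K then e p.2 else 0) := by
    rw [Fintype.sum_prod_type]
    refine Finset.sum_congr rfl fun j _ => Finset.sum_congr rfl fun l _ => ?_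
    split_ifs <;> simp
  rw [e1]
  refine (abs_le_of_sq_le_sq' ?_ (by positivity)).2
  refine (Finset.sum_mul_sq_le_sq_mul_sq _ _ _).trans ?_
  have h1 : ∑ p : Fin N × Fin N, (if |idxDiff p.1 p.2| ≤ K then a p.1 else 0) ^ 2 ≤
      (2 * K + 1) * α ^ 2 := by
    rw [Fintype.sum_prod_type]
    refine le_trans ?_ (mul_le_mul_of_nonneg_left ha' (by positivity))
    rw [Finset.mul_sum]
    refine Finset.sum_le_sum fun j _ => ?_
    have : ∀ l, (if |idxDiff j l| ≤ K then a j else 0) ^ 2 =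
        if |idxDiff j l| ≤ K then a j ^ 2 else 0 := by intro l; split_ifs <;> simp
    simp only [this]
    exact sum_band_le j (sq_nonneg _) fun _ _ => le_rfl
  have h2 : ∑ p : Fin N × Fin N, (if |idxDiff p.1 p.2| ≤ K then e p.2 else 0) ^ 2 ≤
      (2 * K + 1) * β ^ 2 := by
    rw [Fintype.sum_prod_type, Finset.sum_comm]
    refine le_trans ?_ (mul_le_mul_of_nonneg_left he' (by positivity))
    rw [Finset.mul_sum]
    refine Finset.sum_le_sum fun l _ => ?_
    have : ∀ j, (if |idxDiff j l| ≤ K then e l else 0) ^ 2 =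
        if |idxDiff l j| ≤ K then e l ^ 2 else 0 := by
      intro j; rw [abs_idxDiff_comm]; split_ifs <;> simp
    simp only [this]
    exact sum_band_le l (sq_nonneg _) fun _ _ => le_rfl
  refine (mul_le_mul h1 h2 (by positivity) (by positivity)).trans (le_of_eq ?_)
  ring

/-- The product is the sum over r of column r of G times row r of E, and Cauchy–Schwarz on the band
bounds each term. Since only the sum of row norms of E enters, each bad row costs O(1), not O(N). -/
lemma bandSum_mul_le (G E : Matrix (Fin N) (Fin N) ℂ) :
    bandSum K (G * E) ≤ (2 * K + 1) * (‖G‖ * ∑ r, rowNorm E r) := by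
  have h1 : bandSum K (G * E) ≤
      ∑ r, ∑ j, ∑ l, if |idxDiff j l| ≤ K then ‖G j r‖ * ‖E r l‖ else 0 := by
    have e : ∑ r, ∑ j, ∑ l, (if |idxDiff j l| ≤ K then ‖G j r‖ * ‖E r l‖ else 0) =
        ∑ j, ∑ l, ∑ r, if |idxDiff j l| ≤ K then ‖G j r‖ * ‖E r l‖ else 0 := by
      rw [Finset.sum_comm]
      exact Finset.sum_congr rfl fun j _ => Finset.sum_comm
    rw [e]
    refine Finset.sum_le_sum fun j _ => Finset.sum_le_sum fun l _ => ?_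
    split_ifs
    · rw [Matrix.mul_apply]
      exact (norm_sum_le _ _).trans (Finset.sum_le_sum fun r _ => by rw [norm_mul])
    · simp
  refine h1.trans ?_
  rw [Finset.mul_sum, Finset.mul_sum]
  refine Finset.sum_le_sum fun r _ => ?_
  refine sum_band_mul_le (fun j => ‖G j r‖) (fun l => ‖E r l‖) (norm_nonneg _) (norm_nonneg _)
    (sum_sq_col_le G r) (le_of_eq ?_)
  rw [rowNorm, EuclideanSpace.norm_sq_eq]

open Classical in
/-- The discretized solution solves the matrix equation up to an error `O(N⁻¹)`. -/
lemma norm_Xi_sub_le {Z g : ℝ} (hZ : ‖z‖ ≤ Z) (hk : IsKernel ψ I K L c₀) (hC : 0 ≤ C)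
    (hξ : IsNearKernel K ψ I C ξ) (hm : IsProfile I b ℓ m)
    (heq : ∀ θ k, -z * m θ k - ∑ κ ∈ Finset.Icc (-(K : ℤ)) K, Psi ψ m θ κ * m θ (k - κ) =
      if k = 0 then 1 else 0) {G : Matrix (Fin N) (Fin N) ℂ}
    (hG : G * denomMatrix ξ z (discretize N m) = 1) (hg : ‖G‖ ≤ g) :
    ‖Xi ξ (G - discretize N m)‖ ≤ (2 * K + 1) ^ 2 * g *
      (interiorConst n K L b ℓ C + boundaryCount n (K + 1) * boundaryConst K b Z) / N := by
  rcases Nat.eq_zero_or_pos N with rfl | hN0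
  · have : Xi ξ (G - discretize 0 m) = 0 := by ext i; exact i.elim0
    rw [this, norm_zero]; simp
  have hN : (0 : ℝ) < N := by exact_mod_cast hN0
  have hb0 := hm.bdd.nonneg
  have hg0 := (norm_nonneg _).trans hg
  have hZ0 := (norm_nonneg z).trans hZ
  have hic := interiorConst_nonneg (n := n) (K := K) hk.nonneg hb0 hm.nonneg hC
  set E := denomMatrix ξ z (discretize N m) * discretize N m - 1 with hE
  -- As G inverts the denominator, the distance from the discretization to G is G applied to the
  -- defect.
  have e1 : G - discretize N m = -(G * E) := by
    rw [hE, Matrix.mul_sub, ← Matrix.mul_assoc, hG, Matrix.one_mul, Matrix.mul_one, neg_sub]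
  have e2 : bandSum K (G - discretize N m) = bandSum K (G * E) := by
    rw [e1]; simp [bandSum]
  have hbc : 0 ≤ boundaryConst K b Z := by unfold boundaryConst; positivity
  have hrows : ∑ r, rowNorm E r ≤
      interiorConst n K L b ℓ C + boundaryCount n (K + 1) * boundaryConst K b Z := by
    have h1 : ∀ r, rowNorm E r ≤ if Interior I (K + 1) r then interiorConst n K L b ℓ C / N else
        boundaryConst K b Z := by
      intro r
      split_ifs with hr
      · exact rowNorm_defect_le_of_interior hk hC hξ hm heq hr
      · exact rowNorm_defect_le hZ hξ.banded hm r
    refine (Finset.sum_le_sum fun r _ => h1 r).trans ((sum_ite_le (by positivity) hbc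
      (hk.card_not_interior_le' N (K + 1))).trans (le_of_eq ?_))
    rw [Fintype.card_fin]
    field_simp
  have h2 := hξ.banded.norm_Xi_le (G - discretize N m)
  have hr0 : 0 ≤ ∑ r, rowNorm E r := Finset.sum_nonneg fun r _ => norm_nonneg _
  have h3 : bandSum K (G - discretize N m) ≤ (2 * K + 1) * (g *
      (interiorConst n K L b ℓ C + boundaryCount n (K + 1) * boundaryConst K b Z)) := by
    rw [e2]
    refine (bandSum_mul_le G E).trans (mul_le_mul_of_nonneg_left ?_ (by positivity))
    exact mul_le_mul hg hrows hr0 hg0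
  refine h2.trans ((mul_le_mul_of_nonneg_left (mul_le_mul_of_nonneg_left h3 (by positivity))
    (by positivity)).trans (le_of_eq ?_))
  field_simp

end Defect

end CorrelatedMatrix

end

noncomputable section

namespace CorrelatedMatrix

open scoped Matrix.Norms.L2Operator

/-! ### Invertibility at the discretized solution -/

section Blocks

variable {ψ : UnitIco → UnitIco → ℤ → ℤ → ℝ} {n : ℕ} {I : Fin n → Set UnitIco}
  {K : ℕ} {L c₀ b ℓ C w : ℝ} {m : UnitIco → ℤ → ℂ} {z : ℂ} {N : ℕ}
  {ξ : Fin N → Fin N → Fin N → Fin N → ℝ}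

/-- The first index of the block of length `Λ` containing `j`. -/
def blockStart (Λ : ℕ) (j : Fin N) : Fin N :=
  ⟨Λ * ((j : ℕ) / Λ), (Nat.mul_div_le _ _).trans_lt j.2⟩

/-- The block diagonal matrix with Toeplitz blocks of length `Λ` that approximates the
discretization of `m`. -/
def blockToeplitz (N Λ : ℕ) (m : UnitIco → ℤ → ℂ) : Matrix (Fin N) (Fin N) ℂ :=
  Matrix.of fun j l => if blockStart Λ j = blockStart Λ l then
    m (gridPt (blockStart Λ j)) (idxDiff j l) else 0

/-- The form splits over the blocks, and on each block it is the form of a Toeplitz matrix of m at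
the block's first grid point, evaluated at the restriction of u. -/
lemma IsProfile.imForm_blockToeplitz_nonneg (hm : IsProfile I b ℓ m) (Λ : ℕ) (u : Fin N → ℂ) :
    0 ≤ imForm (blockToeplitz N Λ m) u := by
  have e : sesq (blockToeplitz N Λ m) u u = ∑ p : Fin N, sesq (toeplitz N (m (gridPt p)))
      (fun j => if blockStart Λ j = p then u j else 0)
      (fun j => if blockStart Λ j = p then u j else 0) := by
    simp only [sesq_eq_sum]
    conv_rhs => rw [Finset.sum_comm]
    refine Finset.sum_congr rfl fun j _ => ?_
    conv_rhs => rw [Finset.sum_comm]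
    refine Finset.sum_congr rfl fun l _ => ?_
    rw [Finset.sum_eq_single (blockStart Λ j)]
    · simp only [blockToeplitz, toeplitz, Matrix.of_apply]
      by_cases h : blockStart Λ j = blockStart Λ l
      · simp [h]
      · simp [h, Ne.symm h]
    · intro p _ hp
      simp [Ne.symm hp]
    · simp
  rw [imForm, e, Complex.im_sum]
  exact Finset.sum_nonneg fun p _ => hm.imForm_nonneg (gridPt p) N _

/-- Quotient and remainder by Λ locate an index: there are at most N/Λ + 1 blocks, each with at most
2K positions near its ends. -/
lemma card_near_block_end_le (K Λ N : ℕ) (hΛ : 0 < Λ) :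
    ((Finset.univ.filter fun j : Fin N =>
      ¬ (K ≤ (j : ℕ) % Λ ∧ (j : ℕ) % Λ + K < Λ)).card : ℝ) ≤ ((N : ℝ) / Λ + 1) * (2 * K) := by
  have h : (Finset.univ.filter fun j : Fin N =>
      ¬ (K ≤ (j : ℕ) % Λ ∧ (j : ℕ) % Λ + K < Λ)).card ≤
      (Finset.range (N / Λ + 1) ×ˢ (Finset.range K ∪ Finset.Ico (Λ - K) Λ)).card := by
    refine Finset.card_le_card_of_injOn (fun j : Fin N => ((j : ℕ) / Λ, (j : ℕ) % Λ)) ?_ ?_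
    · intro j hj
      simp only [Finset.coe_filter, Set.mem_ofPred_eq, Finset.mem_univ, true_and] at hj
      simp only [Finset.coe_product, Set.mem_prod, Finset.mem_coe, Finset.mem_range,
        Finset.mem_union, Finset.mem_Ico]
      have h1 : (j : ℕ) / Λ ≤ N / Λ := Nat.div_le_div_right j.2.le
      have h2 := Nat.mod_lt (j : ℕ) hΛ
      omega
    · intro j _ j' _ h
      simp only [Prod.mk.injEq] at h
      refine Fin.ext ?_
      rw [← Nat.div_add_mod (j : ℕ) Λ, ← Nat.div_add_mod (j' : ℕ) Λ, h.1, h.2]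
  rw [Finset.card_product, Finset.card_range] at h
  have h2 : (Finset.range K ∪ Finset.Ico (Λ - K) Λ).card ≤ 2 * K := by
    refine (Finset.card_union_le _ _).trans ?_
    rw [Finset.card_range, Nat.card_Ico]
    omega
  have h3 := h.trans (Nat.mul_le_mul_left _ h2)
  have h4 : ((Finset.univ.filter fun j : Fin N =>
      ¬ (K ≤ (j : ℕ) % Λ ∧ (j : ℕ) % Λ + K < Λ)).card : ℝ) ≤ (((N / Λ : ℕ) : ℝ) + 1) * (2 * K) := by
    exact_mod_cast h3
  refine h4.trans (mul_le_mul_of_nonneg_right ?_ (by positivity))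
  have := @Nat.cast_div_le ℝ _ _ _ N Λ
  linarith

/-- The averaged distance of the discretization of `m` to its block approximation. -/
def blockConst (n K Λ : ℕ) (b ℓ : ℝ) : ℝ :=
  (2 * K + 1) * (ℓ * Λ + (boundaryCount n Λ + 2 * K) * (2 * b))

open Classical in
-- Well inside a block the only error is the variation of m, at most ℓΛ/N. Within K of a block end,
-- band entries crossing into the next block are lost; this affects a proportion of order 1/Λ of the
-- rows, which does not vanish as N grows. Hence the separate term in Λ.
lemma inv_mul_bandSum_sub_blockToeplitz_le (hk : IsKernel ψ I K L c₀) (hm : IsProfile I b ℓ m)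
    (hN0 : 0 < N) {Λ : ℕ} (hΛ : 0 < Λ) :
    (N : ℝ)⁻¹ * bandSum K (discretize N m - blockToeplitz N Λ m) ≤
      blockConst n K Λ b ℓ / N + (2 * K + 1) * (4 * K * b) / Λ := by
  have hN : (0 : ℝ) < N := by exact_mod_cast hN0
  have hΛ' : (0 : ℝ) < Λ := by exact_mod_cast hΛ
  have hb := hm.bdd.nonneg
  have hℓ := hm.nonneg
  set P : Fin N → Prop := fun j => Interior I Λ j ∧ (K ≤ (j : ℕ) % Λ ∧ (j : ℕ) % Λ + K < Λ) with hP
  have hentry : ∀ j l : Fin N, |idxDiff j l| ≤ K → ‖(discretize N m - blockToeplitz N Λ m) j l‖ ≤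
      if P j then ℓ * (Λ / N) else 2 * b := by
    intro j l hjl
    rw [Matrix.sub_apply, discretize, blockToeplitz, Matrix.of_apply, Matrix.of_apply]
    split_ifs with h1 h2 h2
    · obtain ⟨⟨⟨α, hα⟩, -, -⟩, -⟩ := h2
      have hjα : gridPt j ∈ I α := hα _ (by rw [sub_self, abs_zero]; positivity)
      have hd : |(gridPt (blockStart Λ j) : ℝ) - gridPt j| ≤ (Λ : ℝ) / N := by
        have e1 : (gridPt (blockStart Λ j) : ℝ) - gridPt j = -(((j : ℕ) % Λ : ℕ) : ℝ) / N := by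
          have h3 : ((j : ℕ) : ℝ) = (Λ * ((j : ℕ) / Λ) : ℕ) + ((j : ℕ) % Λ : ℕ) := by
            exact_mod_cast (Nat.div_add_mod (j : ℕ) Λ).symm
          change ((Λ * ((j : ℕ) / Λ) : ℕ) : ℝ) / N - ((j : ℕ) : ℝ) / N = _
          rw [← sub_div]
          congr 1
          linarith
        rw [e1, abs_div, abs_neg, abs_of_pos hN, Nat.abs_cast]
        gcongr
        exact (Nat.mod_lt _ hΛ).le
      have hsα : gridPt (blockStart Λ j) ∈ I α := hα _ hd
      refine (hm.norm_sub_le hjα hsα _).trans ?_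
      rw [abs_sub_comm]
      exact mul_le_mul_of_nonneg_left hd hℓ
    · refine (norm_sub_le _ _).trans ?_
      linarith [hm.bdd.bound (gridPt j) (idxDiff j l),
        hm.bdd.bound (gridPt (blockStart Λ j)) (idxDiff j l)]
    · exfalso
      apply h1
      obtain ⟨-, h3, h4⟩ := h2
      have h5 := Nat.div_add_mod (j : ℕ) Λ
      rw [abs_le] at hjl
      simp only [idxDiff] at hjl
      have h6 : (l : ℕ) / Λ = (j : ℕ) / Λ := by
        refine Nat.div_eq_of_lt_le ?_ ?_
        · rw [mul_comm]; omega
        · rw [Nat.add_mul, one_mul, mul_comm]; omega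
      simp only [blockStart, h6]
    · rw [sub_zero]
      linarith [hm.bdd.bound (gridPt j) (idxDiff j l)]
  have hpos : ∀ j, 0 ≤ if P j then ℓ * ((Λ : ℝ) / N) else 2 * b := by
    intro j; split_ifs <;> positivity
  have h1 : bandSum K (discretize N m - blockToeplitz N Λ m) ≤
      ∑ j, (2 * K + 1) * (if P j then ℓ * ((Λ : ℝ) / N) else 2 * b) :=
    Finset.sum_le_sum fun j _ => sum_band_le j (hpos j) (hentry j)
  have hcard : ((Finset.univ.filter fun j : Fin N => ¬ P j).card : ℝ) ≤
      boundaryCount n Λ + ((N : ℝ) / Λ + 1) * (2 * K) := by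
    have hsub : (Finset.univ.filter fun j : Fin N => ¬ P j) ⊆
        (Finset.univ.filter fun j : Fin N => ¬ Interior I Λ j) ∪
        (Finset.univ.filter fun j : Fin N => ¬ (K ≤ (j : ℕ) % Λ ∧ (j : ℕ) % Λ + K < Λ)) := by
      intro j hj
      simp only [hP, Finset.mem_filter, Finset.mem_univ, true_and, Finset.mem_union] at hj ⊢
      tauto
    have h2 := (Finset.card_le_card hsub).trans (Finset.card_union_le _ _)
    have h3 : ((Finset.univ.filter fun j : Fin N => ¬ P j).card : ℝ) ≤
        (Finset.univ.filter fun j : Fin N => ¬ Interior I Λ j).card +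
        (Finset.univ.filter fun j : Fin N =>
          ¬ (K ≤ (j : ℕ) % Λ ∧ (j : ℕ) % Λ + K < Λ)).card := by exact_mod_cast h2
    have h4 := hk.card_not_interior_le' N Λ
    have h5 := card_near_block_end_le K Λ N hΛ
    linarith
  have h2 := sum_ite_le (P := P) (a := ℓ * ((Λ : ℝ) / N)) (c := 2 * b) (by positivity)
    (by positivity) hcard
  rw [← Finset.mul_sum] at h1
  rw [Fintype.card_fin] at h2
  have h3 := h1.trans (mul_le_mul_of_nonneg_left h2 (by positivity))
  refine (mul_le_mul_of_nonneg_left h3 (by positivity)).trans (le_of_eq ?_)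
  rw [blockConst]
  field_simp
  ring

open Classical in
lemma norm_trT_sub_le (hk : IsKernel ψ I K L c₀) (hm : IsProfile I b ℓ m) (hN0 : 0 < N) :
    ‖trT m - (N : ℂ)⁻¹ * (discretize N m).trace‖ ≤ (ℓ + boundaryCount n 1 * (2 * b)) / N := by
  have hN : (0 : ℝ) < N := by exact_mod_cast hN0
  have hb := hm.bdd.nonneg
  have hℓ := hm.nonneg
  have hInt : Integrable (fun φ => m φ 0) lebIco :=
    Integrable.of_bound (hm.bdd.meas 0).aestronglyMeasurable b
      (Filter.Eventually.of_forall fun φ => hm.bdd.bound φ 0)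
  have h1 := norm_integral_sub_sum_le hN0 hInt
    (c := fun j : Fin N => if Interior I 1 j then ℓ * (1 / N) else 2 * b) (fun j θ hθ => by
      split_ifs with hj
      · obtain ⟨⟨β, hβ⟩, -, -⟩ := hj
        have hd := abs_sub_gridPt_le hθ
        have hjβ : gridPt j ∈ I β := hβ _ (by rw [sub_self, abs_zero]; positivity)
        have hθβ : θ ∈ I β := hβ _ (by rw [Nat.cast_one]; exact hd)
        exact (hm.norm_sub_le hθβ hjβ 0).trans (mul_le_mul_of_nonneg_left hd hℓ)
      · refine (norm_sub_le _ _).trans ?_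
        linarith [hm.bdd.bound θ 0, hm.bdd.bound (gridPt j) 0])
  have h2 := sum_ite_le (P := fun j : Fin N => Interior I 1 j) (a := ℓ * (1 / (N : ℝ)))
    (c := 2 * b) (by positivity) (by positivity) (hk.card_not_interior_le' N 1)
  rw [Fintype.card_fin] at h2
  have e : (discretize N m).trace = ∑ j : Fin N, m (gridPt j) 0 := by
    simp only [Matrix.trace, Matrix.diag, discretize, Matrix.of_apply, idxDiff_self]
  rw [trT, e]
  refine h1.trans ((mul_le_mul_of_nonneg_left h2 (by positivity)).trans (le_of_eq ?_))
  field_simp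

lemma norm_trace_le_bandSum (A : Matrix (Fin N) (Fin N) ℂ) : ‖A.trace‖ ≤ bandSum K A := by
  refine (norm_sum_le _ _).trans (Finset.sum_le_sum fun j _ => ?_)
  refine le_trans (le_of_eq ?_) (Finset.single_le_sum
    (f := fun l => if |idxDiff j l| ≤ K then ‖A j l‖ else 0)
    (fun l _ => by split_ifs <;> positivity) (Finset.mem_univ j))
  simp [idxDiff_self]

/-- For large `N`, the imaginary part of `-z - Ξ(M̂)` is bounded away from zero. -/
lemma exists_half_le_neg_imForm (hk : IsKernel ψ I K L c₀) (hc₀ : 0 ≤ c₀) (hb : 0 ≤ b) (hℓ : 0 ≤ ℓ)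
    (hw : 0 < w) : ∃ N₀ : ℕ, ∀ N : ℕ, N₀ ≤ N → ∀ (ξ : Fin N → Fin N → Fin N → Fin N → ℝ)
      (z : ℂ) (m : UnitIco → ℤ → ℂ), BandedTensor K ξ → IsSumOfSquares c₀ ξ → IsProfile I b ℓ m →
      w ≤ z.im + c₀ * (trT m).im →
      ∀ u, w / 2 * nsq u ≤ -imForm (denomMatrix ξ z (discretize N m)) u := by
  -- Λ is fixed first and N₀ may depend on it; the two errors take w/4 each.
  obtain ⟨Λ, hΛ⟩ := exists_nat_gt ((c₀ + (2 * K + 1)) * ((2 * K + 1) * (4 * K * b)) / (w / 4))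
  have hΛ' : (0 : ℝ) < Λ := lt_of_le_of_lt (by positivity) hΛ
  have hΛ0 : 0 < Λ := by exact_mod_cast hΛ'
  rw [div_lt_iff₀ (by positivity)] at hΛ
  set Q : ℝ := (c₀ + (2 * K + 1)) * blockConst n K Λ b ℓ + c₀ * (ℓ + boundaryCount n 1 * (2 * b))
    with hQ
  have hQ0 : 0 ≤ Q := by
    have := boundaryCount_nonneg n 1
    have := boundaryCount_nonneg n Λ
    rw [hQ, blockConst]; positivity
  obtain ⟨N₀, hN₀⟩ := exists_nat_gt (Q / (w / 4))
  refine ⟨N₀, fun N hN ξ z m hban hs hm hle u => ?_⟩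
  have hNN : Q / (w / 4) < N := hN₀.trans_le (by exact_mod_cast hN)
  have hNpos : (0 : ℝ) < N := lt_of_le_of_lt (by positivity) hNN
  have hN0 : 0 < N := by exact_mod_cast hNpos
  rw [div_lt_iff₀ (by positivity)] at hNN
  set A := blockToeplitz N Λ m with hA
  set τ := (N : ℝ)⁻¹ * bandSum K (discretize N m - A) with hτ
  have hτ1 : τ ≤ blockConst n K Λ b ℓ / N + (2 * K + 1) * (4 * K * b) / Λ :=
    inv_mul_bandSum_sub_blockToeplitz_le hk hm hN0 hΛ0
  have hnsq : 0 ≤ nsq u := by unfold nsq; positivity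
  have hXi : Xi ξ (discretize N m) = Xi ξ A + Xi ξ (discretize N m - A) := by
    rw [Xi_sub]; abel
  -- The discretization itself need not have nonnegative imaginary part. Positivity of Ξ is used for
  -- the block matrix, and the difference is controlled by its averaged band sum.
  have h1 := hs.le_imForm_Xi (hm.imForm_blockToeplitz_nonneg Λ) u
  have h2 := abs_imForm_le (Xi ξ (discretize N m - A)) u
  have h3 := mul_le_mul_of_nonneg_right (hban.norm_Xi_le (discretize N m - A)) hnsq
  have h4 := (abs_le.1 (h2.trans h3)).1
  have h5 : (trT m).im - τ - (ℓ + boundaryCount n 1 * (2 * b)) / N ≤ (N : ℝ)⁻¹ * A.trace.im := by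
    have h6 := (Complex.abs_im_le_norm _).trans (norm_trT_sub_le hk hm hN0)
    have h7 : ‖(N : ℂ)⁻¹ * (discretize N m - A).trace‖ ≤ τ := by
      rw [norm_mul, norm_inv, Complex.norm_natCast]
      exact mul_le_mul_of_nonneg_left (norm_trace_le_bandSum _) (by positivity)
    have h8 := (Complex.abs_im_le_norm _).trans h7
    have e1 : ∀ x : ℂ, ((N : ℂ)⁻¹ * x).im = (N : ℝ)⁻¹ * x.im := by
      intro x
      rw [← Complex.ofReal_natCast, ← Complex.ofReal_inv, Complex.im_ofReal_mul]
    rw [Complex.sub_im, e1] at h6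
    rw [e1, Matrix.trace_sub, Complex.sub_im, mul_sub] at h8
    have := (abs_le.1 h6).2
    have := (abs_le.1 h8).2
    linarith
  have h9 := mul_le_mul_of_nonneg_right (mul_le_mul_of_nonneg_left h5 hc₀) hnsq
  have herr : (c₀ + (2 * K + 1)) * τ + c₀ * ((ℓ + boundaryCount n 1 * (2 * b)) / N) ≤ w / 2 := by
    have h10 := mul_le_mul_of_nonneg_left hτ1 (by positivity : 0 ≤ c₀ + (2 * (K : ℝ) + 1))
    have h11 : (c₀ + (2 * K + 1)) * (blockConst n K Λ b ℓ / N + (2 * K + 1) * (4 * K * b) / Λ) +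
        c₀ * ((ℓ + boundaryCount n 1 * (2 * b)) / N) =
        Q / N + (c₀ + (2 * K + 1)) * ((2 * K + 1) * (4 * K * b)) / Λ := by
      rw [hQ]; ring
    have h12 : Q / N ≤ w / 4 := by rw [div_le_iff₀ hNpos]; linarith
    have h13 : (c₀ + (2 * K + 1)) * ((2 * K + 1) * (4 * K * b)) / Λ ≤ w / 4 := by
      rw [div_le_iff₀ hΛ']; linarith
    linarith
  have h14 := mul_le_mul_of_nonneg_right herr hnsq
  have h15 := mul_le_mul_of_nonneg_right hle hnsq
  rw [neg_imForm_denomMatrix, hXi, imForm_add]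
  linarith

/-- `F(M̂)` solves the matrix equation approximately, with uniform bounds. -/
theorem exists_approxSolution (hk : IsKernel ψ I K L c₀) (hc₀ : 0 ≤ c₀) (hC : 0 ≤ C) (hw : 0 < w)
    {Z : ℝ} (hZ : 0 ≤ Z) : ∃ d g h C' : ℝ, 0 < d ∧ 0 < g ∧ 0 < h ∧ 0 ≤ C' ∧ ∃ N₀ : ℕ,
      ∀ N : ℕ, N₀ ≤ N → ∀ (ξ : Fin N → Fin N → Fin N → Fin N → ℝ) (z : ℂ)
        (m : UnitIco → ℤ → ℂ), IsNearKernel K ψ I C ξ → IsSumOfSquares c₀ ξ → ‖z‖ ≤ Z →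
        IsLimitSolution ψ z m → w ≤ z.im + c₀ * (trT m).im →
        IsUnit (denomMatrix ξ z (discretize N m)) ∧
        ApproxSolution ξ z (discretize N m) (F ξ z (discretize N m)) d g h (C' / N) := by
  have hL := hk.nonneg
  set b := w⁻¹ with hb
  set ℓ := (w⁻¹) ^ 2 * ((2 * K + 1) ^ 2 * (L * w⁻¹)) with hℓ
  have hb0 : 0 ≤ b := by positivity
  have hℓ0 : 0 ≤ ℓ := by positivity
  obtain ⟨N₀, hN₀⟩ := exists_half_le_neg_imForm hk hc₀ hb0 hℓ0 hw
  have hic := interiorConst_nonneg (n := n) (K := K) hL hb0 hℓ0 hC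
  have hbc : 0 ≤ boundaryConst K b Z := by unfold boundaryConst; positivity
  have hbd := boundaryCount_nonneg n (K + 1)
  set d : ℝ := Z + 1 + (2 * K + 1) * ((2 * K + 1) * b) with hd
  have hd0 : 0 < d := by positivity
  refine ⟨d, (w / 2)⁻¹, w / 2 / d ^ 2, (2 * K + 1) ^ 2 * (w / 2)⁻¹ *
      (interiorConst n K L b ℓ C + boundaryCount n (K + 1) * boundaryConst K b Z), hd0,
    by positivity, by positivity, by positivity, N₀, fun N hN ξ z m hξ hs hz hm hle => ?_⟩
  obtain ⟨hfix, hadm⟩ := hm.admissible hk hw hle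
  have hprof := hadm.isProfile hk hw hfix
  have him := hN₀ N hN ξ z m hξ.banded hs hprof hle
  have hu : IsUnit (denomMatrix ξ z (discretize N m)) := isUnit_of_imForm_le (by positivity) him
  have hdet := (Matrix.isUnit_iff_isUnit_det _).1 hu
  have hmul : denomMatrix ξ z (discretize N m) * F ξ z (discretize N m) = 1 :=
    Matrix.mul_nonsing_inv _ hdet
  have hmul' : F ξ z (discretize N m) * denomMatrix ξ z (discretize N m) = 1 :=
    Matrix.nonsing_inv_mul _ hdet
  have hg := norm_le_of_imForm_le (by positivity : 0 < w / 2) hmul him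
  have hdn : ‖denomMatrix ξ z (discretize N m)‖ ≤ d := by
    have h1 : ‖Xi ξ (discretize N m)‖ ≤ (2 * K + 1) * ((2 * K + 1) * b) := by
      refine norm_le_of_banded (by positivity) fun i k => ?_
      split_ifs with hik
      · exact hprof.norm_Xi_apply_le hξ.banded i k
      · rw [hξ.banded.Xi_eq_zero _ hik, norm_zero]
    have h2 : ‖-(z • (1 : Matrix (Fin N) (Fin N) ℂ))‖ ≤ Z := by
      rw [norm_neg, norm_smul]
      exact (mul_le_of_le_one_right (norm_nonneg _) norm_one_le).trans hz
    refine (norm_sub_le _ _).trans ?_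
    rw [hd]
    linarith
  refine ⟨hu, hmul, hdn, hg, fun u => ?_, ?_⟩
  · exact le_imForm_of_mul_eq_one (by positivity) hd0 hmul hdn him u
  · exact norm_Xi_sub_le hz hk hC hξ hprof (fun θ k => hadm.equation hw hfix θ k) hmul' hg

/-- Given linear stability at approximate solutions, the solution of the matrix equation is
within `O(N⁻¹)` of `F(M̂)`. -/
theorem exists_norm_sub_le (hk : IsKernel ψ I K L c₀) (hc₀ : 0 ≤ c₀) (hC : 0 ≤ C) (hw : 0 < w)
    {Z : ℝ} (hZ : 0 ≤ Z) (S : ∀ N : ℕ, (Fin N → Fin N → Fin N → Fin N → ℝ) → ℂ → Prop)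
    (hS : ∀ d g h : ℝ, 0 < d → 0 < g → 0 < h → ∃ ε₀ C : ℝ, 0 < ε₀ ∧ 0 < C ∧
      ∀ (N : ℕ) (ξ : Fin N → Fin N → Fin N → Fin N → ℝ) (z : ℂ) (A G : Matrix (Fin N) (Fin N) ℂ),
        0 < N → S N ξ z → ApproxSolution ξ z A G d g h ε₀ → LinearlyStable ξ G C) :
    ∃ (c : ℝ) (N₀ : ℕ), ∀ N : ℕ, N₀ ≤ N → ∀ (ξ : Fin N → Fin N → Fin N → Fin N → ℝ) (z : ℂ)
        (m : UnitIco → ℤ → ℂ) (M : Matrix (Fin N) (Fin N) ℂ), S N ξ z → IsNearKernel K ψ I C ξ →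
        IsSumOfSquares c₀ ξ → IsSumOfSquares 0 ξ → 0 < z.im → ‖z‖ ≤ Z →
        IsLimitSolution ψ z m → w ≤ z.im + c₀ * (trT m).im → IsMatrixSolution ξ z M →
        IsUnit (denomMatrix ξ z (discretize N m)) ∧
        ‖M - F ξ z (discretize N m)‖ ≤ c / N := by
  obtain ⟨d, g, h, C', hd, hg, hh, hC', N₁, hN₁⟩ := exists_approxSolution hk hc₀ hC hw hZ
  obtain ⟨ε₀, A, hε₀, hA, hstab⟩ := hS d g h hd hg hh
  -- The summands correspond to the stability threshold ε₀, the contraction condition and the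
  -- positivity condition for the corrected solution.
  set D : ℝ := C' / ε₀ + 2 * (A * (g * C') * (1 + 4 * (2 * K + 1) ^ 2 * A * g ^ 2)) +
    2 * A * g ^ 2 * C' / h with hD
  obtain ⟨N₂, hN₂⟩ := exists_nat_gt D
  refine ⟨2 * A * g ^ 2 * C', max N₁ N₂, fun N hN ξ z m M hSN hξ hs hs0 hz hzZ hm hle hM => ?_⟩
  obtain ⟨hu, happ⟩ := hN₁ N ((le_max_left _ _).trans hN) ξ z m hξ hs hzZ hm hle
  have hDN : D < N := hN₂.trans_le (by exact_mod_cast (le_max_right _ _).trans hN)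
  have hD1 : 0 ≤ C' / ε₀ := by positivity
  have hD2 : 0 ≤ 2 * (A * (g * C') * (1 + 4 * (2 * K + 1) ^ 2 * A * g ^ 2)) := by positivity
  have hD3 : 0 ≤ 2 * A * g ^ 2 * C' / h := by positivity
  have hNpos : (0 : ℝ) < N := lt_of_le_of_lt (by positivity) hDN
  have h1 : C' / N ≤ ε₀ := by
    rw [div_le_iff₀ hNpos, ← div_le_iff₀' hε₀]
    linarith
  have hT := hstab N ξ z _ _ (by exact_mod_cast hNpos) hSN (happ.mono h1)
  refine ⟨hu, ?_⟩
  have h2 : A * (g * (C' / N)) * (1 + 4 * (2 * K + 1) ^ 2 * A * g ^ 2) ≤ 1 / 2 := by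
    have e : A * (g * (C' / N)) * (1 + 4 * (2 * K + 1) ^ 2 * A * g ^ 2) =
        (A * (g * C') * (1 + 4 * (2 * K + 1) ^ 2 * A * g ^ 2)) / N := by ring
    rw [e, div_le_iff₀ hNpos]
    linarith
  have h3 : 2 * A * g ^ 2 * (C' / N) ≤ h := by
    rw [← mul_div_assoc, div_le_iff₀ hNpos, ← div_le_iff₀' hh]
    linarith
  have h4 := norm_sub_le_of_linearlyStable hξ.banded hs0 hz hA happ hT h2 h3 hM
  rw [mul_div_assoc]
  exact h4

end Blocks

end CorrelatedMatrix

end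

/-! ### Conclusion -/

namespace CorrelatedMatrix

lemma xi_swap {N : ℕ} {Ω : Type*} [MeasurableSpace Ω] (P : Measure Ω)
    (x : UpperIdx N → Ω → ℝ) {i j k l : Fin N} (hij : j < i) (hkl : l < k) :
    xi P x i j k l = xi P x j i l k := by
  rw [xi, dif_neg (fun h => absurd h.1 (not_le.2 hij)), dif_pos ⟨hij, hkl⟩, xi,
    dif_pos ⟨hij.le, hkl.le⟩]

end CorrelatedMatrix

theorem mainTheorem4
    (Ω : ℕ → Type*) [∀ N, MeasurableSpace (Ω N)]
    (P : ∀ N, Measure (Ω N)) [∀ N, IsProbabilityMeasure (P N)]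
    (x : ∀ N, CorrelatedMatrix.UpperIdx N → Ω N → ℝ)
    (K : ℕ)
    (ψ : CorrelatedMatrix.UnitIco → CorrelatedMatrix.UnitIco → ℤ → ℤ → ℝ)
    -- the entries are square integrable, centered, of variance at most `1`, and `K`-dependent
    (hL2 : ∀ N a, MemLp (x N a) 2 (P N))
    (hcentered : ∀ N a, ∫ ω, x N a ω ∂(P N) = 0)
    (hvar : ∀ N a, ∫ ω, (x N a ω) ^ 2 ∂(P N) ≤ 1)
    (hdep : ∀ N, CorrelatedMatrix.KDependent (P N) K (x N))
    -- `ψ` is piecewise Lipschitz and symmetric, and `ξ` is its discretization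
    (hψ : CorrelatedMatrix.PiecewiseLipschitz ψ)
    (hψneg : ∀ θ φ k l, ψ θ φ k l = ψ θ φ (-k) (-l))
    (hψswap : ∀ θ φ k l, ψ θ φ k l = ψ φ θ l k)
    (hξ : CorrelatedMatrix.IsDiscretization K ψ
      (fun N => CorrelatedMatrix.xi (P N) (x N))) :
    -- unique solvability of the matrix equation
    (∀ (N : ℕ) (z : ℂ), 0 < z.im →
      ∃! M : Matrix (Fin N) (Fin N) ℂ,
        CorrelatedMatrix.IsMatrixSolution (CorrelatedMatrix.xi (P N) (x N)) z M) ∧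
    -- unique solvability of the limiting equation
    (∀ z : ℂ, 0 < z.im →
      ∃! m : CorrelatedMatrix.UnitIco → ℤ → ℂ, CorrelatedMatrix.IsLimitSolution ψ z m) ∧
    -- for these solutions `M = M(N, z)` and `m = m(z)`:
    (∀ (M : ∀ N : ℕ, ℂ → Matrix (Fin N) (Fin N) ℂ)
        (m : ℂ → CorrelatedMatrix.UnitIco → ℤ → ℂ),
      (∀ (N : ℕ) (z : ℂ), 0 < z.im →
        CorrelatedMatrix.IsMatrixSolution (CorrelatedMatrix.xi (P N) (x N)) z (M N z)) →
      (∀ z : ℂ, 0 < z.im → CorrelatedMatrix.IsLimitSolution ψ z (m z)) →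
      -- the approximation at a fixed `z`
      (∀ z : ℂ, 0 < z.im → ∃ c : ℝ,
        (∃ N₀ : ℕ, ∀ N : ℕ, N₀ ≤ N →
          IsUnit (CorrelatedMatrix.denomMatrix (CorrelatedMatrix.xi (P N) (x N)) z
            (CorrelatedMatrix.discretize N (m z)))) ∧
        ∀ N : ℕ, 1 ≤ N →
          IsUnit (CorrelatedMatrix.denomMatrix (CorrelatedMatrix.xi (P N) (x N)) z
            (CorrelatedMatrix.discretize N (m z))) →
          CorrelatedMatrix.opNorm (M N z -
            CorrelatedMatrix.F (CorrelatedMatrix.xi (P N) (x N)) z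
              (CorrelatedMatrix.discretize N (m z))) ≤ c / N) ∧
      -- the uniform approximation, if `ξ` is positive definite
      (∀ c₀ : ℝ, 0 < c₀ →
        (∀ N, (CorrelatedMatrix.covMatrix (P N) (x N) - c₀ • 1).PosSemidef) →
        ∀ D : Set ℂ, IsOpen D → IsConnected D → Bornology.IsBounded D →
          (∀ z ∈ D, 0 < z.im) →
          ∀ ω : ℝ, 0 < ω → (∀ z ∈ D, ω ≤ (CorrelatedMatrix.trT (m z)).im) →
          ∃ (c : ℝ) (N₀ : ℕ), ∀ N : ℕ, N₀ ≤ N → ∀ z ∈ D,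
            IsUnit (CorrelatedMatrix.denomMatrix (CorrelatedMatrix.xi (P N) (x N)) z
              (CorrelatedMatrix.discretize N (m z))) ∧
            CorrelatedMatrix.opNorm (M N z -
              CorrelatedMatrix.F (CorrelatedMatrix.xi (P N) (x N)) z
                (CorrelatedMatrix.discretize N (m z))) ≤ c / N)) := by
  have hb : ∀ N, CorrelatedMatrix.BandedTensor K (CorrelatedMatrix.xi (P N) (x N)) := fun N =>
    CorrelatedMatrix.bandedTensor_xi (hL2 N) (hcentered N) (hvar N) (hdep N)
  have hs0 : ∀ N, CorrelatedMatrix.IsSumOfSquares 0 (CorrelatedMatrix.xi (P N) (x N)) := fun N =>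
    CorrelatedMatrix.isSumOfSquares_xi (by
      rw [zero_smul, sub_zero]; exact CorrelatedMatrix.posSemidef_covMatrix (hL2 N))
  obtain ⟨n, I, hI⟩ := hψ.exists_isPieces
  obtain ⟨L, hL⟩ := CorrelatedMatrix.exists_isKernel hI hξ hb hψneg hψswap
  obtain ⟨C, hC, hnear⟩ := CorrelatedMatrix.exists_isNearKernel hI hξ hb hψswap
    (fun N i j k l h1 h2 => CorrelatedMatrix.xi_swap (P N) (x N) h1 h2)
  have hk0 := hL 0 hs0
  refine ⟨fun N z hz => CorrelatedMatrix.existsUnique_isMatrixSolution (hs0 N) hz (hb N),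
    fun z hz => CorrelatedMatrix.existsUnique_isLimitSolution hk0 hz, fun M m hM hm => ⟨?_, ?_⟩⟩
  · intro z hz
    -- At fixed z no lower bound on the covariance is needed: c₀ = 0, w = Im z, and stability comes
    -- from Im z.
    obtain ⟨c, N₀, hN₀⟩ := CorrelatedMatrix.exists_norm_sub_le hk0 le_rfl hC hz (norm_nonneg z)
      (fun N ξ z' => CorrelatedMatrix.IsSumOfSquares 0 ξ ∧ z.im ≤ z'.im)
      (fun d g h hd hg hh => by
        obtain ⟨ε₀, A, h1, h2, h3⟩ := CorrelatedMatrix.exists_linearlyStable_of_im hz hd hg hh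
        exact ⟨ε₀, A, h1, h2, fun N ξ z' B G _ hS H => h3 N ξ z' B G hS.1 hS.2 H⟩)
    have hlarge := fun N (hN : N₀ ≤ N) => hN₀ N hN _ z (m z) (M N z) ⟨hs0 N, le_rfl⟩ (hnear N)
      (hs0 N) (hs0 N) hz le_rfl (hm z hz) (by simp) (hM N z hz)
    set e : ℕ → ℝ := fun N => CorrelatedMatrix.opNorm (M N z -
      CorrelatedMatrix.F (CorrelatedMatrix.xi (P N) (x N)) z
        (CorrelatedMatrix.discretize N (m z))) with he
    have he0 : ∀ N, 0 ≤ e N := fun N => norm_nonneg _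
    -- The finitely many N below N₀ are absorbed into the constant by summing N times the error.
    refine ⟨max c (∑ N ∈ Finset.range N₀, N * e N), ⟨N₀, fun N hN => (hlarge N hN).1⟩,
      fun N hN _ => ?_⟩
    have hNpos : (0 : ℝ) < N := by exact_mod_cast hN
    rcases le_or_gt N₀ N with h | h
    · exact (hlarge N h).2.trans (div_le_div_of_nonneg_right (le_max_left _ _) hNpos.le)
    · change e N ≤ _
      rw [le_div_iff₀ hNpos, mul_comm]
      refine le_trans ?_ (le_max_right _ _)
      exact Finset.single_le_sum (f := fun N : ℕ => (N : ℝ) * e N)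
        (fun i _ => mul_nonneg (Nat.cast_nonneg _) (he0 i)) (Finset.mem_range.2 h)
  · intro c₀ hc₀ hcov D _ _ hbdd hDim ω hω hDω
    have hs : ∀ N, CorrelatedMatrix.IsSumOfSquares c₀ (CorrelatedMatrix.xi (P N) (x N)) := fun N =>
      CorrelatedMatrix.isSumOfSquares_xi (hcov N)
    obtain ⟨Z, hZ⟩ := hbdd.exists_norm_le
    -- Im z may tend to 0 on 𝒟, so w = c₀ω: the denominator is bounded below through c₀ Im tr m
    -- instead. Boundedness of 𝒟 enters through Z.
    obtain ⟨c, N₀, hN₀⟩ := CorrelatedMatrix.exists_norm_sub_le (hL c₀ hs) hc₀.le hC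
      (mul_pos hc₀ hω) (abs_nonneg Z)
      (fun N ξ z => CorrelatedMatrix.BandedTensor K ξ ∧ CorrelatedMatrix.IsSumOfSquares c₀ ξ ∧
        0 < z.im)
      (fun d g h hd hg hh => by
        obtain ⟨ε₀, A, h1, h2, h3⟩ :=
          CorrelatedMatrix.exists_linearlyStable_of_flat K hc₀ hd hg hh
        exact ⟨ε₀, A, h1, h2, fun N ξ z B G hN hS H => h3 N ξ z B G hN hS.1 hS.2.1 hS.2.2 H⟩)
    refine ⟨c, N₀, fun N hN z hz => ?_⟩
    have hzim := hDim z hz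
    refine hN₀ N hN _ z (m z) (M N z) ⟨hb N, hs N, hzim⟩ (hnear N) (hs N) (hs0 N) hzim
      ((hZ z hz).trans (le_abs_self Z)) (hm z hzim) ?_ (hM N z hzim)
    have := mul_le_mul_of_nonneg_left (hDω z hz) hc₀.le
    linarith
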